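/- **Notation.** For $\tau$ in the upper half-plane put $\mathbf e(x)=e^{2\pi i x}$, $q=\mathbf e(\tau)$, $\theta(\xi,\tau)=\sum_{\nu\in\mathbb Z+1/2}(-1)^{\nu-1/2}q^{\nu^2/2}\mathbf e(\nu\xi)$, and let the Kronecker function be $F(\xi,\alpha,\tau)=\frac{\theta'(0,\tau)\theta(\xi+\alpha,\tau)}{\theta(\xi,\tau)\theta(\alpha,\tau)}=\sum_{n\ge0}f_n(\xi,\tau)(2\pi i\alpha)^{n-1}$. With $r_\tau(\xi)=\Im\xi/\Im\tau$ let $\omega_n=\sum_{k=0}^n\frac{r_\tau(\xi)^k}{k!}f_{n-k}$. The A-elliptic multiple zeta value $A(n_1,\dots,n_l;\tau)$ is the regularized iterated integral $\int_{[0,1]}\omega_{n_1}(t_1,\tau)dt_1\cdots\omega_{n_l}(t_l,\tau)dt_l$ (over $t_1\ge\dots\ge t_l$), i.e. the constant term in the expansion of the integral over $[\varepsilon,1-\varepsilon]$ in powers of $\log(-2\pi i\varepsilon)$ (principal branch), up to $O(\varepsilon^\nu)$ with $\nu>0$, as $\varepsilon\to0^+$. Put $A_{n,r}(\tau)=A(n,\underbrace{0,\dots,0}_{r-1};\tau)$,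 let $A^\infty_{n,r}$ be the constant term of its $q$-expansion (its limit at $\tau\to i\infty$), and let $$\mathcal A(X,Y;\tau)=\sum_{n\ge0,\,r\ge1}\frac{A_{n,r}(\tau)}{(2\pi i)^{r-1}}X^{n-1}Y^{r-1},\qquad \mathcal A^\infty(X,Y)=\sum_{n\ge0,\,r\ge1}\frac{A^\infty_{n,r}}{(2\pi i)^{r-1}}X^{n-1}Y^{r-1};$$ $\mathcal A_+$, $\mathcal A_+^\infty$ denote the same sums restricted to $n\ge1$. Let $\Lambda(u,\beta)=u^{-\beta}\sum_{k\ge1}\mathrm{Li}_k(u)\beta^{k-1}$ for $u=\mathbf e(\xi)$, as a function of $\xi$ (so $u^{-\beta}=\mathbf e(-\xi\beta)$, and $\mathrm{Li}_k(\mathbf e(\xi))$ is continued analytically from $\Im\xi>0$ to $\mathbb C\setminus((-\infty,0]\cup[1,\infty))$). Let $\mathtt E(\xi,\alpha,\beta,\tau)=\sum_{n\in\mathbb Z}\mathbf e(n\alpha)\Lambda(\mathbf e(\xi+n\tau),\beta)$ for $1<|\mathbf e(\alpha)|$, $1<|\mathbf e(\alpha-\tau\beta)|<|q|^{-1}$.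 For $\xi=r\tau+s\ne0$ with $r,s\in[0,1)$, Levin's generating series of elliptic polylogarithms is $$\Xi(\xi,X,Y,\tau)=-\frac1{2\pi i}\exp(rX+sY)\,\mathtt E\Big(\xi,\frac X{2\pi i},\frac Y{2\pi i},\tau\Big),$$ and the elliptic polylogarithms $\Lambda_{m,n}(\xi,\tau)$ are defined by $\mathtt E(\xi,\alpha,\beta,\tau)-\frac{\mathbf e(-\xi\beta)}{2\pi i\beta(\alpha-\tau\beta)}-\frac1{\alpha(1-\mathbf e(\beta))}=\sum_{m,n\ge0}\Lambda_{m,n}(\xi,\tau)\alpha^m\beta^n$ near $(\alpha,\beta)=(0,0)$ (for $(\alpha,\beta)$, $\beta\neq0$, in the above domain). **Statement.** (0) For all $n\ge 0$, $r\ge1$ the limit $A^\infty_{n,r}=\lim_{\Im\tau\to\infty}A_{n,r}(\tau)$ exists. (1) Let $X,Y\in\mathbb C$ with $|X|<2\pi$, $0<|Y|<2\pi$, $|X-\tau Y|<2\pi|m\tau+n|$ for all integers $(m,n)\neq(0,0)$, and $1<|e^X|$, $1<|e^{X-\tau Y}|<|q|^{-1}$. Then the series $\mathtt E(\xi,\frac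 X{2\pi i},\frac Y{2\pi i},\tau)$ for every $\xi$ as above, the two series $\mathcal A(X-\tau Y,-Y;\tau)$ and $\mathcal A^\infty(X,-Y)$, and the series of zeta values below are absolutely convergent, and, as $\xi\to0$ within the punctured parallelogram $\{r\tau+s\neq0: r,s\in[0,1)\}$, $$\Big(\Xi(\xi,X,Y,\tau)-\frac1{2\pi i}\log(-2\pi i\xi)\Big)\Big|_{\xi=0}=-\frac{\mathcal A^\infty(X,-Y)}{2\pi i(e^{-Y}-1)}+\frac{\mathcal A(X-\tau Y,-Y;\tau)}{2\pi i(e^{-Y}-1)}+\frac1{e^X-1}\Big(\frac1{e^Y-1}-\frac1Y\Big)-\sum_{k\ge2}\frac{\zeta(k)}{(2\pi i)^k}Y^{k-1}$$ (principal branch of the logarithm). Equivalently, the same limit equals $$-\frac{\tau}{X(X-\tau Y)}-\frac{\mathcal A_+^\infty(X,-Y)}{2\pi i(e^{-Y}-1)}+\frac{\mathcal A_+(X-\tau Y,-Y;\tau)}{2\pi i(e^{-Y}-1)}+\frac1{e^X-1}\Big(\frac1{e^Y-1}-\frac1Y\Big)-\sum_{k\ge2}\frac{\zeta(k)}{(2\pi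 i)^k}Y^{k-1}.$$ (2) Depth-one A-elliptic multiple zeta values are special values of elliptic polylogarithms: the $\Lambda_{m,n}(\xi,\tau)$ exist for every nonzero $\xi$ in the parallelogram; the limits $\lambda_{m,n}(\tau)=\lim_{\xi\to0}\Lambda_{m,n}(\xi,\tau)$ for $(m,n)\ne(0,0)$ and $\lambda_{0,0}(\tau)=\lim_{\xi\to0}(\Lambda_{0,0}(\xi,\tau)+\log(-2\pi i\xi))$ exist, with $\xi\to0$ as in (1); and for all $s,n,r\ge0$ there are finitely many polynomials $p,P_{a,b}\in\mathbb C[T]$ such that for all $\tau$ in the upper half-plane $$A(\underbrace{0,\dots,0}_s,n,\underbrace{0,\dots,0}_r;\tau)=p(\tau)+\sum_{a,b}P_{a,b}(\tau)\,\lambda_{a,b}(\tau).$$ -/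

import Mathlib

open Complex Filter Topology Asymptotics
open UpperHalfPlane (atImInfty)

namespace EllPol

noncomputable section

/-- The normalized exponential `e(x) = exp (2πi x)`. -/
def e (x : ℂ) : ℂ := Complex.exp (2 * Real.pi * I * x)

/-! ### Theta function, Kronecker function, and the functions `f_n`, `ω_n` -/

/-- The odd Jacobi theta function
`θ(ξ,τ) = ∑_{ν ∈ ℤ + 1/2} (-1)^(ν - 1/2) q^(ν²/2) u^ν`, with `q = e(τ)`, `u = e(ξ)` and
`ν = n + 1/2`. -/
def theta (τ : UpperHalfPlane) (ξ : ℂ) : ℂ :=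
  ∑' n : ℤ, (-1 : ℂ) ^ n * e (((n : ℂ) + 1 / 2) ^ 2 / 2 * τ) * e (((n : ℂ) + 1 / 2) * ξ)

/-- The Kronecker function `F(ξ,α,τ) = θ'(0) θ(ξ+α) / (θ(ξ) θ(α))`. -/
def kroneckerF (ξ α : ℂ) (τ : UpperHalfPlane) : ℂ :=
  deriv (theta τ) 0 * theta τ (ξ + α) / (theta τ ξ * theta τ α)

/-- The function `α ↦ α F(ξ,α,τ)`, holomorphically extended to `α = 0`
(`dslope (theta τ) 0 α` is `θ(α)/α` for `α ≠ 0` and `θ'(0)` for `α = 0`);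
see `kroneckerF_eq` below. -/
def kroneckerReg (ξ : ℂ) (τ : UpperHalfPlane) (α : ℂ) : ℂ :=
  deriv (theta τ) 0 * theta τ (ξ + α) / (theta τ ξ * dslope (theta τ) 0 α)

theorem theta_neg (τ : UpperHalfPlane) (ξ : ℂ) : theta τ (-ξ) = -theta τ ξ := by
  unfold theta
  rw [← tsum_neg, ← (Equiv.subLeft (-1 : ℤ)).tsum_eq]
  refine tsum_congr fun n => ?_
  have h1 : (-1 : ℂ) ^ (-1 - n : ℤ) = -(-1 : ℂ) ^ n := by
    rw [zpow_sub₀ (by norm_num)]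
    rcases Int.even_or_odd n with h | h
    · simp [h.neg_one_zpow]
    · simp [h.neg_one_zpow]
  simp only [Equiv.subLeft_apply]
  rw [h1]
  have h2 : (((-1 - n : ℤ) : ℂ) + 1 / 2) = -((n : ℂ) + 1 / 2) := by push_cast; ring
  rw [h2, neg_sq, neg_mul_neg]
  ring

theorem theta_zero (τ : UpperHalfPlane) : theta τ 0 = 0 := by
  have h := theta_neg τ 0
  rw [neg_zero] at h
  exact self_eq_neg.mp h

theorem kroneckerF_eq (ξ α : ℂ) (τ : UpperHalfPlane) (hα : α ≠ 0) :
    kroneckerF ξ α τ = kroneckerReg ξ τ α / α := by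
  unfold kroneckerF kroneckerReg
  rw [dslope_of_ne _ hα, slope_def_field, theta_zero, sub_zero, sub_zero]
  field_simp

/-- The coefficients of the Kronecker function,
`F(ξ,α,τ) = ∑_{n ≥ 0} f_n(ξ,τ) (2πi α)^(n-1)`. -/
def f (n : ℕ) (ξ : ℂ) (τ : UpperHalfPlane) : ℂ :=
  2 * Real.pi * I * (iteratedDeriv n (kroneckerReg ξ τ) 0 / n.factorial) / (2 * Real.pi * I) ^ n

/-- `r_τ(ξ) = Im ξ / Im τ`. -/
def rCoord (τ : UpperHalfPlane) (ξ : ℂ) : ℝ := ξ.im / τ.im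

/-- `s_τ(ξ)`, the real number with `ξ = r_τ(ξ) τ + s_τ(ξ)`. -/
def sCoord (τ : UpperHalfPlane) (ξ : ℂ) : ℝ := ξ.re - rCoord τ ξ * τ.re

/-- The coefficients of `Ω(ξ,α,τ) = e(r_τ(ξ) α) F(ξ,α,τ) = ∑_{n ≥ 0} ω_n(ξ,τ) (2πi α)^(n-1)`. -/
def omega (n : ℕ) (ξ : ℂ) (τ : UpperHalfPlane) : ℂ :=
  ∑ k ∈ Finset.range (n + 1), (rCoord τ ξ : ℂ) ^ k / k.factorial * f (n - k) ξ τ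

/-! ### A-elliptic multiple zeta values -/

/-- The iterated integral
`∫_{b ≥ t₁ ≥ ⋯ ≥ t_r ≥ a} g₁(t₁) ⋯ g_r(t_r) dt₁ ⋯ dt_r` of a list `[g₁, …, g_r]`. -/
def iterInt : List (ℝ → ℂ) → ℝ → ℝ → ℂ
  | [], _, _ => 1
  | g :: gs, a, b => ∫ t in a..b, g t * iterInt gs a t

/-- `c₀` is the constant term of an expansion
`g(ε) = O(ε^ν) + ∑_{k=0}^r c_k log(-2πi ε)^k`, `ν > 0`, as `ε → 0⁺`. -/
def IsRegularizedValue (g : ℝ → ℂ) (r : ℕ) (c₀ : ℂ) : Prop :=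
  ∃ c : ℕ → ℂ, c 0 = c₀ ∧ ∃ ν : ℝ, 0 < ν ∧
    (fun ε : ℝ => g ε - ∑ k ∈ Finset.range (r + 1),
      c k * Complex.log (-(2 * Real.pi * I * ε)) ^ k) =O[𝓝[>] (0 : ℝ)] fun ε : ℝ => ε ^ ν

open Classical in
/-- The constant term of such an expansion (it is unique when it exists). -/
def regularizedValue (g : ℝ → ℂ) (r : ℕ) : ℂ :=
  if h : ∃ c₀, IsRegularizedValue g r c₀ then h.choose else 0

/-- The (regularized) A-elliptic multiple zeta value `A(n₁, …, n_r; τ)`. -/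
def ellMZV (ns : List ℕ) (τ : UpperHalfPlane) : ℂ :=
  regularizedValue
    (fun ε => iterInt (ns.map fun n => fun t : ℝ => omega n (t : ℂ) τ) ε (1 - ε)) ns.length

/-- `A_{n,r}(τ) = A(n, 0, …, 0; τ)` with `r - 1` zeros. -/
def A (n r : ℕ) (τ : UpperHalfPlane) : ℂ := ellMZV (n :: List.replicate (r - 1) 0) τ

/-- The constant term `A^∞_{n,r}` of the `q`-expansion of `A_{n,r}(τ)`, that is, its value at
`τ = i∞`. -/
def AInf (n r : ℕ) : ℂ := limUnder atImInfty (A n r)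

/-- The term of the depth one generating series
`∑_{n ≥ 0, r ≥ 1} a_{n,r} / (2πi)^(r-1) X^(n-1) Y^(r-1)` at `n = p.1`, `r = p.2 + 1`. -/
def genTerm (a : ℕ → ℕ → ℂ) (X Y : ℂ) (p : ℕ × ℕ) : ℂ :=
  a p.1 (p.2 + 1) / (2 * Real.pi * I) ^ p.2 * X ^ ((p.1 : ℤ) - 1) * Y ^ p.2

/-- The generating series `𝒜(X,Y;τ)` of the `A_{n,r}(τ)`. -/
def calA (X Y : ℂ) (τ : UpperHalfPlane) : ℂ := ∑' p, genTerm (fun n r => A n r τ) X Y p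

/-- The generating series `𝒜^∞(X,Y)` of the `A^∞_{n,r}`. -/
def calAInf (X Y : ℂ) : ℂ := ∑' p, genTerm AInf X Y p

/-- The part of `𝒜(X,Y;τ)` without pole at `X = 0`, i.e. the sum over `n ≥ 1`. -/
def calAPos (X Y : ℂ) (τ : UpperHalfPlane) : ℂ :=
  ∑' p : ℕ × ℕ, genTerm (fun n r => A n r τ) X Y (p.1 + 1, p.2)

/-- The part of `𝒜^∞(X,Y)` without pole at `X = 0`, i.e. the sum over `n ≥ 1`. -/
def calAInfPos (X Y : ℂ) : ℂ := ∑' p : ℕ × ℕ, genTerm AInf X Y (p.1 + 1, p.2)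

/-! ### Levin's elliptic polylogarithms -/

/-- The polylogarithm `Li_k(e(ξ))` as a function of `ξ`: the analytic continuation of
`∑_{m ≥ 1} e(mξ) / m^k` from the upper half-plane to `ℂ` minus the real half-lines `(-∞,0]` and
`[1,∞)`. It is the iterated integral `Li_0(e(ξ)) = e(ξ)/(1-e(ξ))`,
`Li_{k+1}(e(ξ)) = 2πi ∫_{i∞}^{ξ} Li_k(e(z)) dz`, taken along the vertical line from
`1/2 + i∞` to `1/2` and then along the segment from `1/2` to `ξ`. -/
def polylog : ℕ → ℂ → ℂ
  | 0, ξ => e ξ / (1 - e ξ)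
  | k + 1, ξ =>
      2 * Real.pi * (∫ y in Set.Ioi (0 : ℝ), polylog k (1 / 2 + y * I))
        + 2 * Real.pi * I * (ξ - 1 / 2)
          * ∫ t in (0 : ℝ)..1, polylog k (1 / 2 + t * (ξ - 1 / 2))

/-- The generating series of Debye polylogarithms
`Λ(u,β) = u^(-β) ∑_{k ≥ 1} Li_k(u) β^(k-1)` at `u = e(ξ)`. -/
def debye (ξ β : ℂ) : ℂ := e (-(ξ * β)) * ∑' k : ℕ, polylog (k + 1) ξ * β ^ k

/-- The term `v^n Λ(q^n u, β)`, with `u = e(ξ)`, `v = e(α)`, `q = e(τ)`. -/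
def avgTerm (ξ α β : ℂ) (τ : UpperHalfPlane) (n : ℤ) : ℂ :=
  e (n * α) * debye (ξ + n * τ) β

/-- The averaged series `E(ξ,α,β,τ) = ∑_{n ∈ ℤ} v^n Λ(q^n u, β)`. -/
def E (ξ α β : ℂ) (τ : UpperHalfPlane) : ℂ := ∑' n : ℤ, avgTerm ξ α β τ n

/-- The domain of absolute convergence of the average: `1 < |v|` and
`1 < |v q^(-β)| < |q|⁻¹`, where `v = e(α)` and `q^(-β) = e(-τβ)`. -/
def InAnnulus (τ : UpperHalfPlane) (α β : ℂ) : Prop :=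
  1 < ‖e α‖ ∧ 1 < ‖e (α - τ * β)‖ ∧ ‖e (α - τ * β)‖ < ‖e τ‖⁻¹

/-- The nonzero points `rτ + s`, `r, s ∈ [0,1)`, of the fundamental parallelogram. -/
def punctured (τ : UpperHalfPlane) : Set ℂ :=
  {ξ | ξ ≠ 0 ∧ rCoord τ ξ ∈ Set.Ico (0 : ℝ) 1 ∧ sCoord τ ξ ∈ Set.Ico (0 : ℝ) 1}

/-- Levin's generating series
`Ξ(ξ,X,Y,τ) = -(1/2πi) exp(rX + sY) E(ξ, X/2πi, Y/2πi, τ)`. -/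
def Xi (ξ X Y : ℂ) (τ : UpperHalfPlane) : ℂ :=
  -(1 / (2 * Real.pi * I)) * Complex.exp (rCoord τ ξ * X + sCoord τ ξ * Y)
    * E ξ (X / (2 * Real.pi * I)) (Y / (2 * Real.pi * I)) τ

/-- The regularized generating series of elliptic Debye polylogarithms. -/
def EReg (ξ α β : ℂ) (τ : UpperHalfPlane) : ℂ :=
  E ξ α β τ - e (-(ξ * β)) / (2 * Real.pi * I * β * (α - τ * β)) - 1 / (α * (1 - e β))

/-- `c m n` are the coefficients of the expansion of `EReg ξ α β τ` at `(α,β) = (0,0)`. Such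
coefficients are unique, as a power series that vanishes on a nonempty open set is zero. -/
def IsEllipticPolylog (ξ : ℂ) (τ : UpperHalfPlane) (c : ℕ → ℕ → ℂ) : Prop :=
  ∃ δ : ℝ, 0 < δ ∧ ∀ α β : ℂ, ‖α‖ < δ → ‖β‖ < δ → β ≠ 0 → InAnnulus τ α β →
    HasSum (fun p : ℕ × ℕ => c p.1 p.2 * α ^ p.1 * β ^ p.2) (EReg ξ α β τ)

open Classical in
/-- The elliptic polylogarithms `Λ_{m,n}(ξ,τ)`, defined by
`EReg ξ α β τ = ∑_{m,n ≥ 0} Λ_{m,n}(ξ,τ) α^m β^n`. -/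
def ellipticPolylog (m n : ℕ) (ξ : ℂ) (τ : UpperHalfPlane) : ℂ :=
  if h : ∃ c, IsEllipticPolylog ξ τ c then h.choose m n else 0

/-- `v` is the regularized special value at `ξ = 0` of `Λ_{m,n}(ξ,τ)`: the limit as `ξ → 0`, after
removing the logarithmic divergence `-log(-2πi ξ)` in the only divergent case `m = n = 0`. -/
def IsSpecialValue (m n : ℕ) (τ : UpperHalfPlane) (v : ℂ) : Prop :=
  Tendsto (fun ξ => ellipticPolylog m n ξ τ
      + if m = 0 ∧ n = 0 then Complex.log (-(2 * Real.pi * I * ξ)) else 0)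
    (𝓝[punctured τ] 0) (𝓝 v)

end

end EllPol

namespace EllPol

noncomputable section

/-! Write q = e(τ), X = 2πiα, Y = 2πiβ and w = e(α - τβ). Both sides of the identity in (1) are
computed in closed form, and their transcendental part is the same Lambert-type series: `lambertT q
1 w β`, the sum over m ≥ 1 of q^m w / ((1 - q^m w)(m - β)) + q^m w⁻¹ / ((1 - q^m w⁻¹)(m + β)).

The side of the multiple zeta values. For real t the Kronecker function is -2πi times the bilateral
series ∑ e(α)^n q^n u / (1 - q^n u) with u = e(t). Indeed, multiplication by θ(α) gives a series in
e(α) whose coefficients obey the same first-order recursion as those of θ(t + α)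
(`exists_theta_mul_eq`), and the identity theorem carries the result from the strip of convergence
to α = 0 (`kroneckerReg_eventuallyEq`). Consequently all singularities in t sit in one function
`kap`, which occurs only in f_1 and does not involve τ. Since ω_0 = 2πi is constant on the real
line, a depth one iterated integral is a single integral against a polynomial weight, and its
regularization is elementary (`ellMZV_depth_one`). Summing over n and r produces the regularized
integral of F(t,α) e(-βt) over [0,1]; integrating e((±m - β)t) creates the denominators m ∓ β, hence
`lambertT` (`hasSum_aCoef_eq`). The contribution `rhoGen` of `kap` depends on β alone, so it cancels
between the series at τ and the series at the cusp; the latter is the case q = 0, where `lambertT`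
vanishes.

The side of the polylogarithms. The Debye series Λ(e(ξ),β) has the elementary derivative 2πi e(-ξβ)
Li_0(e(ξ)). Hence it is e(-ξβ) ∑ e(mξ)/(m - β) in the upper half-plane, and in the lower half-plane
a similar series plus an explicit connection constant (`debye_of_im_neg`). Splitting the average
over n by the sign of n and interchanging summations gives a closed formula for E containing
`lambertT q u w β` with u = e(ξ) (`hasSum_avgTerm`). As ξ → 0 only the term n = 0 is singular, and Λ
+ log(-2πiξ) tends to ∑ ζ(k) β^(k-1), k ≥ 2. Comparing the two closed forms is then algebra
(`generating_series_at_origin`).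

For (2), the regularized generating series times β is the function `levinN`, holomorphic on a bidisc
around the origin and zero for β = 0. The Λ_{m,n} are therefore Cauchy integrals over a fixed torus
and converge as ξ → 0 once the logarithm is removed (`isSpecialValue_torusCoef`). By the closed
forms, the part n ≥ 1 of the generating series of the A_{n,r} is built from series independent of τ
and from `levinN` at ξ = 0, evaluated at (α + τβ, β) (`genValue_eq`). Comparing coefficients, the
binomial expansion of (α + τβ)^m supplies the polynomials in τ (`isPolyComb_posCoef`). -/

theorem hasSum_of_eq {ι : Type*} {f g : ι → ℂ} {a b : ℂ} (h : HasSum f a)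
    (hfg : ∀ i, g i = f i) (hab : b = a) : HasSum g b := by
  rw [hab, funext hfg]; exact h

/-! ### The normalized exponential -/

theorem e_add (x y : ℂ) : e (x + y) = e x * e y := by
  rw [e, e, e, ← Complex.exp_add]; ring_nf

theorem e_zero : e 0 = 1 := by simp [e]

theorem e_ne_zero (x : ℂ) : e x ≠ 0 := Complex.exp_ne_zero _

theorem e_neg (x : ℂ) : e (-x) = (e x)⁻¹ := by
  rw [e, e, ← Complex.exp_neg]; ring_nf

theorem e_int (n : ℤ) : e n = 1 := by
  rw [e, Complex.exp_eq_one_iff]; exact ⟨n, by ring⟩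

theorem e_one : e 1 = 1 := by simpa using e_int 1

theorem e_int_mul (n : ℤ) (x : ℂ) : e (n * x) = e x ^ n := by
  rw [e, e, ← Complex.exp_int_mul]; ring_nf

theorem e_nat_mul (n : ℕ) (x : ℂ) : e (n * x) = e x ^ n := by
  simpa using e_int_mul n x

theorem e_eq_one_iff {x : ℂ} : e x = 1 ↔ ∃ n : ℤ, x = n := by
  rw [e, Complex.exp_eq_one_iff]
  refine exists_congr fun n => ⟨fun h => ?_, fun h => by rw [h]; ring⟩
  have := Complex.two_pi_I_ne_zero
  apply mul_left_cancel₀ this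
  rw [h]; ring

theorem norm_e (x : ℂ) : ‖e x‖ = Real.exp (-(2 * Real.pi * x.im)) := by
  rw [e, Complex.norm_exp]
  congr 1
  simp

theorem norm_e_ofReal (t : ℝ) : ‖e t‖ = 1 := by simp [norm_e]

theorem norm_e_lt_one_iff {x : ℂ} : ‖e x‖ < 1 ↔ 0 < x.im := by
  rw [norm_e, Real.exp_lt_one_iff, neg_lt_zero, mul_pos_iff_of_pos_left (by positivity)]

theorem one_lt_norm_e_iff {x : ℂ} : 1 < ‖e x‖ ↔ x.im < 0 := by
  rw [norm_e, Real.one_lt_exp_iff, ← mul_neg, mul_pos_iff_of_pos_left (by positivity), neg_pos]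

theorem norm_e_le_one_iff {x : ℂ} : ‖e x‖ ≤ 1 ↔ 0 ≤ x.im := by
  rw [← not_lt, one_lt_norm_e_iff, not_lt]

theorem hasDerivAt_e (x : ℂ) : HasDerivAt e (2 * Real.pi * I * e x) x := by
  have h := ((hasDerivAt_id x).const_mul (2 * Real.pi * I)).cexp
  refine h.congr_deriv ?_
  rw [e, id]; ring

@[fun_prop]
theorem differentiable_e : Differentiable ℂ e := fun x => (hasDerivAt_e x).differentiableAt

@[fun_prop]
theorem continuous_e : Continuous e := differentiable_e.continuous

theorem norm_e_tau_lt_one (τ : UpperHalfPlane) : ‖e τ‖ < 1 := norm_e_lt_one_iff.2 τ.im_pos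

/-- The entire function `(e(z) - 1) / z`. -/
def expSlope (z : ℂ) : ℂ := dslope e 0 z

theorem mul_expSlope (z : ℂ) : z * expSlope z = e z - 1 := by
  have := sub_smul_dslope e 0 z
  simpa [expSlope, e_zero] using this

theorem expSlope_zero : expSlope 0 = 2 * Real.pi * I := by
  rw [expSlope, dslope_same, (hasDerivAt_e 0).deriv, e_zero, mul_one]

@[fun_prop]
theorem differentiable_expSlope : Differentiable ℂ expSlope := fun z => by
  have : DifferentiableOn ℂ (dslope e 0) Set.univ :=
    (Complex.differentiableOn_dslope univ_mem).2 differentiable_e.differentiableOn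
  exact (this z (Set.mem_univ z)).differentiableAt univ_mem

@[fun_prop]
theorem continuous_expSlope : Continuous expSlope := differentiable_expSlope.continuous

theorem e_ne_one {z : ℂ} (h : ‖z‖ < 1) (h0 : z ≠ 0) : e z ≠ 1 := by
  intro h1
  obtain ⟨n, rfl⟩ := e_eq_one_iff.1 h1
  rw [Complex.norm_intCast] at h
  have : |n| < 1 := by exact_mod_cast h
  rw [Int.abs_lt_one_iff] at this
  simp [this] at h0

theorem expSlope_ne_zero {z : ℂ} (h : ‖z‖ < 1) : expSlope z ≠ 0 := by
  by_cases h0 : z = 0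
  · rw [h0, expSlope_zero]; exact two_pi_I_ne_zero
  · intro h1
    have := mul_expSlope z
    rw [h1, mul_zero] at this
    exact e_ne_one h h0 (sub_eq_zero.1 this.symm)

/-! ### Lambert series -/

/-- The Lambert term `q^m w / (1 - q^m w)`. -/
def lambert (q w : ℂ) (m : ℕ) : ℂ := q ^ m * w / (1 - q ^ m * w)

theorem lambert_norm_le {q w : ℂ} {c : ℝ} (hc : 0 < c) {m : ℕ} (h : c ≤ ‖1 - q ^ m * w‖) :
    ‖lambert q w m‖ ≤ ‖q‖ ^ m * (‖w‖ / c) := by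
  rw [lambert, norm_div, norm_mul, norm_pow, ← mul_div_assoc]
  gcongr

theorem one_sub_le_norm {q w : ℂ} (hq : ‖q‖ < 1) (m : ℕ) :
    1 - ‖q * w‖ ≤ ‖1 - q ^ (m + 1) * w‖ := by
  have h1 : ‖q ^ (m + 1) * w‖ ≤ ‖q * w‖ := by
    rw [pow_succ, mul_assoc, norm_mul, norm_pow]
    exact mul_le_of_le_one_left (norm_nonneg _) (pow_le_one₀ (norm_nonneg _) hq.le)
  have := norm_sub_norm_le (1 : ℂ) (q ^ (m + 1) * w)
  rw [norm_one] at this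
  linarith

/-- Interchange of the summations in a double geometric series. -/
theorem hasSum_lambert {q w u : ℂ} (hq : ‖q‖ < 1) (hw : ‖q * w‖ < 1) (hu : ‖q * u‖ < 1)
    {g : ℕ → ℂ} {G : ℝ} (hg : ∀ m, ‖g m‖ ≤ G) :
    HasSum (fun n : ℕ => w ^ (n + 1) * ∑' m : ℕ, (q ^ (n + 1) * u) ^ (m + 1) * g m)
      (∑' m : ℕ, u ^ (m + 1) * lambert q w (m + 1) * g m) := by
  have hF : Summable fun p : ℕ × ℕ =>
      w ^ (p.1 + 1) * ((q ^ (p.1 + 1) * u) ^ (p.2 + 1) * g p.2) := by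
    have h1 := (summable_geometric_of_lt_one (norm_nonneg _) hw).mul_of_nonneg
      (summable_geometric_of_lt_one (norm_nonneg _) hu) (fun _ => by positivity)
      (fun _ => by positivity)
    refine Summable.of_norm_bounded (h1.mul_left (‖q * w * u‖ * G)) fun p => ?_
    -- The factor q^((n+1)(m+1)) is shared out as q · q^n · q^m · q^(nm), so that only |qw| < 1 and
    -- |qu| < 1 are needed, not |w| < 1 or |u| < 1.
    have : w ^ (p.1 + 1) * ((q ^ (p.1 + 1) * u) ^ (p.2 + 1) * g p.2) =
      (q * w * u) * ((q * w) ^ p.1 * (q * u) ^ p.2) * (q ^ (p.1 * p.2) * g p.2) := by ring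
    rw [this, norm_mul, norm_mul, norm_mul ((q * w) ^ p.1), norm_pow, norm_pow]
    have h2 : ‖q ^ (p.1 * p.2) * g p.2‖ ≤ G := by
      rw [norm_mul, norm_pow]
      exact (mul_le_of_le_one_left (norm_nonneg _) (pow_le_one₀ (norm_nonneg _) hq.le)).trans (hg _)
    calc _ ≤ ‖q * w * u‖ * (‖q * w‖ ^ p.1 * ‖q * u‖ ^ p.2) * G := by gcongr
      _ = _ := by ring
  have hcol : ∀ m : ℕ, HasSum (fun n : ℕ => w ^ (n + 1) * ((q ^ (n + 1) * u) ^ (m + 1) * g m))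
      (u ^ (m + 1) * lambert q w (m + 1) * g m) := fun m => by
    have hlt : ‖q ^ (m + 1) * w‖ < 1 := by
      rw [pow_succ, mul_assoc, norm_mul, norm_pow]
      exact (mul_le_of_le_one_left (norm_nonneg _)
        (pow_le_one₀ (norm_nonneg _) hq.le)).trans_lt hw
    have := (hasSum_geometric_of_norm_lt_one hlt).mul_left (q ^ (m + 1) * w * u ^ (m + 1) * g m)
    refine hasSum_of_eq this (fun n => by ring) ?_
    rw [lambert, div_eq_mul_inv]; ring
  have hrow : ∀ n : ℕ, HasSum (fun m : ℕ => w ^ (n + 1) * ((q ^ (n + 1) * u) ^ (m + 1) * g m))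
      (w ^ (n + 1) * ∑' m : ℕ, (q ^ (n + 1) * u) ^ (m + 1) * g m) := fun n => by
    rw [← tsum_mul_left]
    exact (hF.prod_factor n).hasSum
  have h1 := hF.hasSum.prod_fiberwise hrow
  have h2 := ((Equiv.prodComm ℕ ℕ).hasSum_iff.2 hF.hasSum).prod_fiberwise (fun m => hcol m)
  rwa [h2.tsum_eq]

/-- The regular part `∑_{m ≥ 1} (u^m q^m w / (1 - q^m w) - u^(-m) q^m w⁻¹ / (1 - q^m w⁻¹))` of the
Kronecker function. -/
def lambertQ (q u w : ℂ) : ℂ :=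
  ∑' m : ℕ, (u ^ (m + 1) * lambert q w (m + 1) - u⁻¹ ^ (m + 1) * lambert q w⁻¹ (m + 1))

/-- Uniform bounds on `U` for `w = e(α)`, `w⁻¹` and the denominators of the Lambert terms. -/
def LambertBound (q : ℂ) (U : Set ℂ) (c W : ℝ) : Prop :=
  0 < c ∧ ∀ α ∈ U, ‖e α‖ ≤ W ∧ ‖(e α)⁻¹‖ ≤ W ∧
    ∀ m : ℕ, c ≤ ‖1 - q ^ (m + 1) * e α‖ ∧ c ≤ ‖1 - q ^ (m + 1) * (e α)⁻¹‖

/-- Since q^m → 0, all but finitely many denominators stay above 1/2 as soon as w and w⁻¹ are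
bounded; the finitely many others are nonzero at α₀, and continuity keeps them away from zero
nearby. -/
theorem exists_lambertBound_nhds {q : ℂ} (hq : ‖q‖ < 1) {α₀ : ℂ}
    (h : ∀ m : ℕ, q ^ (m + 1) * e α₀ ≠ 1 ∧ q ^ (m + 1) * (e α₀)⁻¹ ≠ 1) :
    ∃ U ∈ 𝓝 α₀, ∃ c W : ℝ, LambertBound q U c W := by
  have hinv : Continuous fun α => (e α)⁻¹ := continuous_e.inv₀ e_ne_zero
  set W := max (‖e α₀‖ + 1) (‖(e α₀)⁻¹‖ + 1) with hW
  have h1 : ∀ᶠ α in 𝓝 α₀, ‖e α‖ < W :=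
    continuous_e.norm.continuousAt.eventually_lt continuousAt_const
      (by simp [hW])
  have h2 : ∀ᶠ α in 𝓝 α₀, ‖(e α)⁻¹‖ < W :=
    hinv.norm.continuousAt.eventually_lt continuousAt_const
      (by simp only [hW, lt_max_iff]; right; linarith)
  have hfin : ∀ N : ℕ, ∃ c : ℝ, 0 < c ∧ ∀ᶠ α in 𝓝 α₀, ∀ m < N,
      c ≤ ‖1 - q ^ (m + 1) * e α‖ ∧ c ≤ ‖1 - q ^ (m + 1) * (e α)⁻¹‖ := by
    intro N
    induction N with
    | zero => exact ⟨1, one_pos, by simp⟩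
    | succ N ih =>
      obtain ⟨c, hc, hc'⟩ := ih
      have p1 : 0 < ‖1 - q ^ (N + 1) * e α₀‖ :=
        norm_pos_iff.2 (sub_ne_zero.2 (h N).1.symm)
      have p2 : 0 < ‖1 - q ^ (N + 1) * (e α₀)⁻¹‖ :=
        norm_pos_iff.2 (sub_ne_zero.2 (h N).2.symm)
      obtain ⟨d, hd, hd'⟩ := exists_between (lt_min hc (lt_min p1 p2))
      have q1 : ∀ᶠ α in 𝓝 α₀, d < ‖1 - q ^ (N + 1) * e α‖ :=
        continuousAt_const.eventually_lt
          (continuous_const.sub (continuous_const.mul continuous_e)).norm.continuousAt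
          (by simp at hd'; exact hd'.2.1)
      have q2 : ∀ᶠ α in 𝓝 α₀, d < ‖1 - q ^ (N + 1) * (e α)⁻¹‖ :=
        continuousAt_const.eventually_lt
          (continuous_const.sub (continuous_const.mul hinv)).norm.continuousAt
          (by simp only [lt_min_iff] at hd'; exact hd'.2.2)
      refine ⟨d, hd, ?_⟩
      filter_upwards [hc', q1, q2] with α a1 a2 a3 m hm
      rcases Nat.lt_succ_iff_lt_or_eq.1 hm with hm | rfl
      · have := a1 m hm
        have hdc := (lt_min_iff.1 hd').1.le
        exact ⟨hdc.trans this.1, hdc.trans this.2⟩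
      · exact ⟨a2.le, a3.le⟩
  have hlim : Tendsto (fun m : ℕ => ‖q‖ ^ (m + 1) * W) atTop (𝓝 (0 * W)) :=
    ((tendsto_pow_atTop_nhds_zero_of_lt_one (norm_nonneg q) hq).comp
      (tendsto_add_atTop_nat 1)).mul_const W
  rw [zero_mul] at hlim
  obtain ⟨N, hN⟩ := eventually_atTop.1 (hlim.eventually_lt_const (show (0 : ℝ) < 1 / 2 by norm_num))
  obtain ⟨c, hc, hc'⟩ := hfin N
  refine ⟨_, (h1.and (h2.and hc')), min c (1 / 2), W, by positivity, fun α hα => ?_⟩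
  obtain ⟨b1, b2, b3⟩ := hα
  refine ⟨b1.le, b2.le, fun m => ?_⟩
  by_cases hm : m < N
  · exact ⟨(min_le_left _ _).trans (b3 m hm).1, (min_le_left _ _).trans (b3 m hm).2⟩
  · have key : ∀ w : ℂ, ‖w‖ ≤ W → min c (1 / 2) ≤ ‖1 - q ^ (m + 1) * w‖ := fun w hw => by
      have hb : ‖q ^ (m + 1) * w‖ ≤ 1 / 2 := by
        rw [norm_mul, norm_pow]
        exact (mul_le_mul_of_nonneg_left hw (by positivity)).trans (hN m (not_lt.1 hm)).le
      have := norm_sub_norm_le (1 : ℂ) (q ^ (m + 1) * w)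
      rw [norm_one] at this
      exact (min_le_right _ _).trans (by linarith)
    exact ⟨key _ b1.le, key _ b2.le⟩

theorem exists_lambertBound_of_isCompact {q : ℂ} (hq : ‖q‖ < 1) {K : Set ℂ} (hK : IsCompact K)
    (h : ∀ α ∈ K, ∀ m : ℕ, q ^ (m + 1) * e α ≠ 1 ∧ q ^ (m + 1) * (e α)⁻¹ ≠ 1) :
    ∃ U, IsOpen U ∧ K ⊆ U ∧ ∃ c W : ℝ, LambertBound q U c W := by
  refine hK.induction_on (p := fun s => ∃ U, IsOpen U ∧ s ⊆ U ∧ ∃ c W : ℝ, LambertBound q U c W)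
    ⟨∅, isOpen_empty, subset_rfl, 1, 1, one_pos, by simp⟩ ?_ ?_ ?_
  · rintro s t hst ⟨U, hU, htU, r⟩
    exact ⟨U, hU, hst.trans htU, r⟩
  · rintro s t ⟨U, hU, hsU, c, W, hc, hb⟩ ⟨V, hV, htV, d, X, hd, hb'⟩
    refine ⟨U ∪ V, hU.union hV, Set.union_subset_union hsU htV, min c d, max W X,
      lt_min hc hd, ?_⟩
    rintro α (hα | hα)
    · obtain ⟨b1, b2, b3⟩ := hb α hα
      exact ⟨b1.trans (le_max_left _ _), b2.trans (le_max_left _ _), fun m =>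
        ⟨(min_le_left _ _).trans (b3 m).1, (min_le_left _ _).trans (b3 m).2⟩⟩
    · obtain ⟨b1, b2, b3⟩ := hb' α hα
      exact ⟨b1.trans (le_max_right _ _), b2.trans (le_max_right _ _), fun m =>
        ⟨(min_le_right _ _).trans (b3 m).1, (min_le_right _ _).trans (b3 m).2⟩⟩
  · intro α hα
    obtain ⟨U, hU, c, W, hb⟩ := exists_lambertBound_nhds hq (h α hα)
    obtain ⟨V, hVU, hV, hαV⟩ := mem_nhds_iff.1 hU
    exact ⟨V, mem_nhdsWithin_of_mem_nhds (hV.mem_nhds hαV), V, hV, subset_rfl, c, W, hb.1,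
      fun β hβ => hb.2 β (hVU hβ)⟩

/-- The gain is a radius strictly larger than a: Taylor series at 0 then converge absolutely at
points of norm a. The bound R < 1 keeps `expSlope` free of zeros on the ball. -/
theorem exists_lambertBound_ball {q : ℂ} (hq : ‖q‖ < 1) {a : ℝ} (ha : 0 ≤ a) (ha1 : a < 1)
    (h : ∀ α ∈ Metric.closedBall (0 : ℂ) a, ∀ m : ℕ,
      q ^ (m + 1) * e α ≠ 1 ∧ q ^ (m + 1) * (e α)⁻¹ ≠ 1) :
    ∃ R : ℝ, a < R ∧ R < 1 ∧ ∃ c W : ℝ, LambertBound q (Metric.ball 0 R) c W := by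
  obtain ⟨U, hU, hKU, c, W, hb⟩ :=
    exists_lambertBound_of_isCompact hq (isCompact_closedBall 0 a) h
  obtain ⟨δ, hδ, hδU⟩ := (isCompact_closedBall (0 : ℂ) a).exists_thickening_subset_open hU hKU
  rw [thickening_closedBall hδ ha] at hδU
  obtain ⟨R, hR, hR'⟩ := exists_between (lt_min (show a < δ + a by linarith) ha1)
  obtain ⟨hR1, hR2⟩ := lt_min_iff.1 hR'
  exact ⟨R, hR, hR2, c, W, hb.1, fun α hα =>
    hb.2 α (hδU (Metric.ball_subset_ball hR1.le hα))⟩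

theorem exists_lambertBound_zero {q : ℂ} (hq : ‖q‖ < 1) :
    ∃ R : ℝ, 0 < R ∧ R < 1 ∧ ∃ c W : ℝ, LambertBound q (Metric.ball 0 R) c W := by
  refine exists_lambertBound_ball hq le_rfl one_pos fun α hα m => ?_
  have h0 : α = 0 := by simpa using hα
  have h1 : q ^ (m + 1) ≠ 1 := fun h => by
    have := congrArg norm h
    rw [norm_pow, norm_one] at this
    exact (pow_lt_one₀ (norm_nonneg q) hq (Nat.succ_ne_zero m)).ne this
  simp [h0, e_zero, h1]

theorem LambertBound.mono {q : ℂ} {U V : Set ℂ} {c W : ℝ} (h : LambertBound q U c W)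
    (hV : V ⊆ U) : LambertBound q V c W := ⟨h.1, fun α hα => h.2 α (hV hα)⟩

theorem LambertBound.norm_lambert_le {q : ℂ} {U : Set ℂ} {c W : ℝ} (h : LambertBound q U c W)
    {α : ℂ} (hα : α ∈ U) (m : ℕ) :
    ‖lambert q (e α) (m + 1)‖ ≤ ‖q‖ ^ (m + 1) * (W / c) ∧
      ‖lambert q (e α)⁻¹ (m + 1)‖ ≤ ‖q‖ ^ (m + 1) * (W / c) := by
  obtain ⟨h1, h2, h3⟩ := h.2 α hα
  have hc := h.1
  constructor
  · refine (lambert_norm_le h.1 (h3 m).1).trans ?_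
    gcongr
  · refine (lambert_norm_le h.1 (h3 m).2).trans ?_
    gcongr

theorem summable_pow_succ_mul {q : ℂ} (hq : ‖q‖ < 1) (K : ℝ) :
    Summable fun m : ℕ => ‖q‖ ^ (m + 1) * K :=
  (((summable_nat_add_iff 1).2 (summable_geometric_of_lt_one (norm_nonneg q) hq))).mul_right K

theorem LambertBound.norm_term_le {q : ℂ} {U : Set ℂ} {c W : ℝ} (h : LambertBound q U c W)
    {α u : ℂ} (hα : α ∈ U) (hu : ‖u‖ = 1) (m : ℕ) :
    ‖u ^ (m + 1) * lambert q (e α) (m + 1) - u⁻¹ ^ (m + 1) * lambert q (e α)⁻¹ (m + 1)‖ ≤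
      ‖q‖ ^ (m + 1) * (2 * (W / c)) := by
  obtain ⟨h1, h2⟩ := h.norm_lambert_le hα m
  refine (norm_sub_le _ _).trans ?_
  rw [norm_mul, norm_mul, norm_pow, norm_pow, norm_inv, hu, inv_one, one_pow, one_mul, one_mul]
  linarith

theorem differentiableOn_lambert {q : ℂ} {U : Set ℂ} {c W : ℝ} (h : LambertBound q U c W) (m : ℕ) :
    DifferentiableOn ℂ (fun α => lambert q (e α) (m + 1)) U ∧
      DifferentiableOn ℂ (fun α => lambert q (e α)⁻¹ (m + 1)) U := by
  have hi : Differentiable ℂ fun α => (e α)⁻¹ := differentiable_e.inv e_ne_zero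
  have key : ∀ w : ℂ → ℂ, Differentiable ℂ w → (∀ α ∈ U, c ≤ ‖1 - q ^ (m + 1) * w α‖) →
      DifferentiableOn ℂ (fun α => lambert q (w α) (m + 1)) U := fun w hw hb => by
    refine DifferentiableOn.div (by fun_prop) (by fun_prop) fun α hα => ?_
    exact norm_pos_iff.1 (h.1.trans_le (hb α hα))
  exact ⟨key _ differentiable_e fun α hα => ((h.2 α hα).2.2 m).1,
    key _ hi fun α hα => ((h.2 α hα).2.2 m).2⟩

theorem differentiableOn_lambertQ {q u : ℂ} (hq : ‖q‖ < 1) (hu : ‖u‖ = 1) {U : Set ℂ}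
    (hU : IsOpen U) {c W : ℝ} (h : LambertBound q U c W) :
    DifferentiableOn ℂ (fun α => lambertQ q u (e α)) U := by
  refine differentiableOn_tsum_of_summable_norm (summable_pow_succ_mul hq (2 * (W / c)))
    (fun m => ?_) hU fun m α hα => h.norm_term_le hα hu m
  obtain ⟨h1, h2⟩ := differentiableOn_lambert h m
  exact (h1.const_mul _).sub (h2.const_mul _)

/-- The regular part of `α ↦ α F(t,α)`. -/
def kroneckerB (q : ℂ) (t : ℝ) (α : ℂ) : ℂ :=
  2 * Real.pi * I * (e α / expSlope α) - 2 * Real.pi * I * α * lambertQ q (e t) (e α)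

/-- The part of the Kronecker function that does not depend on `α` and `τ`. -/
def kap (t : ℝ) : ℂ := -(2 * Real.pi * I) / (1 - e t)

theorem kroneckerB_zero (q : ℂ) (t : ℝ) : kroneckerB q t 0 = 1 := by
  have := two_pi_I_ne_zero
  rw [kroneckerB, e_zero, expSlope_zero, mul_zero, zero_mul, sub_zero, mul_one_div_cancel this]

theorem differentiableOn_kroneckerB {q : ℂ} (hq : ‖q‖ < 1) (t : ℝ) {R : ℝ} (hR : R ≤ 1) {c W : ℝ}
    (h : LambertBound q (Metric.ball 0 R) c W) :
    DifferentiableOn ℂ (kroneckerB q t) (Metric.ball 0 R) := by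
  have h1 := differentiableOn_lambertQ hq (norm_e_ofReal t) Metric.isOpen_ball h
  have h2 : DifferentiableOn ℂ (fun α => e α / expSlope α) (Metric.ball 0 R) := by
    refine DifferentiableOn.div (by fun_prop) (by fun_prop) fun α hα => expSlope_ne_zero ?_
    rw [mem_ball_zero_iff] at hα
    linarith
  unfold kroneckerB
  fun_prop

/-! ### The theta function -/

/-- The Fourier coefficient `(-1)^n q^((n + 1/2)² / 2)` of the theta function. -/
def thetaCoef (τ : UpperHalfPlane) (n : ℤ) : ℂ :=
  (-1 : ℂ) ^ n * e (((n : ℂ) + 1 / 2) ^ 2 / 2 * τ)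

theorem thetaCoef_ne_zero (τ : UpperHalfPlane) (n : ℤ) : thetaCoef τ n ≠ 0 :=
  mul_ne_zero (zpow_ne_zero _ (by norm_num)) (e_ne_zero _)

theorem thetaCoef_add_one (τ : UpperHalfPlane) (n : ℤ) :
    thetaCoef τ (n + 1) = -(e τ ^ (n + 1) * thetaCoef τ n) := by
  have h : ((((n + 1 : ℤ) : ℂ)) + 1 / 2) ^ 2 / 2 * (τ : ℂ) =
      ((n + 1 : ℤ) : ℂ) * τ + ((n : ℂ) + 1 / 2) ^ 2 / 2 * τ := by
    push_cast; ring
  rw [thetaCoef, thetaCoef, h, e_add, e_int_mul, zpow_add_one₀ (by norm_num : (-1 : ℂ) ≠ 0)]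
  ring

theorem theta_term_eq (τ : UpperHalfPlane) (ξ : ℂ) (n : ℤ) :
    thetaCoef τ n * e (((n : ℂ) + 1 / 2) * ξ) =
      e (τ / 8 + ξ / 2) * jacobiTheta₂_term n (ξ + τ / 2 + 1 / 2) τ := by
  have h : (-1 : ℂ) ^ n = Complex.exp (Real.pi * I * n) := by
    rw [mul_comm, Complex.exp_int_mul, Complex.exp_pi_mul_I]
  rw [thetaCoef, h, jacobiTheta₂_term, e, e, e, ← Complex.exp_add, ← Complex.exp_add,
    ← Complex.exp_add]
  congr 1
  ring

theorem hasSum_theta (τ : UpperHalfPlane) (ξ : ℂ) :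
    HasSum (fun n : ℤ => thetaCoef τ n * e (((n : ℂ) + 1 / 2) * ξ)) (theta τ ξ) := by
  have : Summable (fun n : ℤ => thetaCoef τ n * e (((n : ℂ) + 1 / 2) * ξ)) := by
    simp_rw [theta_term_eq]
    exact (((summable_jacobiTheta₂_term_iff _ _).2 τ.im_pos).mul_left _)
  exact this.hasSum

theorem theta_eq_jacobiTheta₂ (τ : UpperHalfPlane) (ξ : ℂ) :
    theta τ ξ = e (τ / 8 + ξ / 2) * jacobiTheta₂ (ξ + τ / 2 + 1 / 2) τ := by
  rw [← (hasSum_theta τ ξ).tsum_eq, jacobiTheta₂, ← tsum_mul_left]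
  exact tsum_congr fun n => theta_term_eq τ ξ n

theorem differentiable_theta (τ : UpperHalfPlane) : Differentiable ℂ (theta τ) := by
  have h : theta τ = fun ξ => e (τ / 8 + ξ / 2) * jacobiTheta₂ (ξ + τ / 2 + 1 / 2) τ :=
    funext (theta_eq_jacobiTheta₂ τ)
  rw [h]
  intro ξ
  have h1 := differentiableAt_jacobiTheta₂_fst (ξ + τ / 2 + 1 / 2) τ.im_pos
  have h2 : DifferentiableAt ℂ (fun ξ : ℂ => jacobiTheta₂ (ξ + τ / 2 + 1 / 2) τ) ξ :=
    DifferentiableAt.comp ξ (g := fun z => jacobiTheta₂ z τ) h1 (by fun_prop)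
  fun_prop

/-! ### Termwise integration and non-vanishing of the theta function -/

theorem hasSum_intervalIntegral {ι : Type*} [Countable ι] {F : ι → ℝ → ℂ}
    (hF : ∀ i, Continuous (F i)) {b : ι → ℝ} (hb : Summable b)
    (h : ∀ i, ∀ t ∈ Set.Icc (0 : ℝ) 1, ‖F i t‖ ≤ b i) :
    HasSum (fun i => ∫ t in (0 : ℝ)..1, F i t) (∫ t in (0 : ℝ)..1, ∑' i, F i t) := by
  have hsub : ∀ t ∈ Set.uIoc (0 : ℝ) 1, t ∈ Set.Icc (0 : ℝ) 1 := fun t ht => by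
    rw [Set.uIoc_of_le zero_le_one] at ht
    exact ⟨ht.1.le, ht.2⟩
  refine intervalIntegral.hasSum_integral_of_dominated_convergence (fun i _ => b i)
    (fun i => (hF i).aestronglyMeasurable) (fun i => ?_) ?_ intervalIntegrable_const ?_
  · exact Eventually.of_forall fun t ht => h i t (hsub t ht)
  · exact Eventually.of_forall fun t _ => hb
  · exact Eventually.of_forall fun t ht =>
      (Summable.of_norm_bounded hb fun i => h i t (hsub t ht)).hasSum

theorem integral_e_mul {c : ℂ} (hc : c ≠ 0) :
    ∫ t in (0 : ℝ)..1, e (c * t) = (e c - 1) / (2 * Real.pi * I * c) := by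
  have h := integral_exp_mul_complex (a := 0) (b := 1)
    (c := 2 * Real.pi * I * c) (mul_ne_zero two_pi_I_ne_zero hc)
  simp only [e, ← mul_assoc]
  rw [h]
  simp

/-- Accumulating zeros would make θ vanish identically, and with it the Fourier coefficients of t ↦
e(-t/2) θ(t); but the zeroth one is `thetaCoef τ 0`, an exponential. -/
theorem theta_ne_zero_of_frequently (τ : UpperHalfPlane) {z : ℂ}
    (h : ∃ᶠ x in 𝓝[≠] z, theta τ x = 0) : False := by
  have h0 : ∀ x, theta τ x = 0 := fun x =>
    ((differentiable_theta τ).differentiableOn.analyticOnNhd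
      isOpen_univ).eqOn_zero_of_preconnected_of_frequently_eq_zero isPreconnected_univ
      (Set.mem_univ z) h (Set.mem_univ x)
  -- The factor e(-t/2) turns the half-integral frequencies into integral ones, which are orthogonal
  -- on [0,1].
  have hsum : ∀ t : ℝ, HasSum (fun n : ℤ => thetaCoef τ n * e ((n : ℂ) * t)) 0 := fun t => by
    have := (hasSum_theta τ t).mul_right (e (-(1 / 2 * t)))
    rw [h0, zero_mul] at this
    refine hasSum_of_eq this (fun n => ?_) rfl
    rw [mul_assoc, ← e_add]
    ring_nf
  have hb : Summable fun n : ℤ => ‖thetaCoef τ n‖ := by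
    have := (hsum 0).summable.norm
    simpa [e_zero] using this
  have h1 := hasSum_intervalIntegral (F := fun (n : ℤ) (t : ℝ) => thetaCoef τ n * e ((n : ℂ) * t))
    (fun n => by fun_prop) hb (fun n t _ => by
      have := norm_e_ofReal (n * t)
      push_cast at this
      rw [norm_mul, this, mul_one])
  simp_rw [fun t : ℝ => (hsum t).tsum_eq] at h1
  have h2 : ∀ n : ℤ, ∫ t in (0 : ℝ)..1, thetaCoef τ n * e ((n : ℂ) * t) =
      if n = 0 then thetaCoef τ 0 else 0 := fun n => by
    split_ifs with hn
    · simp [hn, e_zero]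
    · rw [intervalIntegral.integral_const_mul, integral_e_mul (Int.cast_ne_zero.2 hn), e_int]
      simp
  simp_rw [h2] at h1
  have h3 := (hasSum_ite_eq (0 : ℤ) (thetaCoef τ 0)).unique h1
  simp only [intervalIntegral.integral_zero] at h3
  exact thetaCoef_ne_zero τ 0 h3

/-! ### The expansion of the Kronecker function -/

theorem hasSum_lambert_pos {q w u : ℂ} (hq : ‖q‖ < 1) (hw : ‖q * w‖ < 1) (hu : ‖q * u‖ < 1) :
    HasSum (fun n : ℕ => w ^ (n + 1) * (q ^ (n + 1) * u / (1 - q ^ (n + 1) * u)))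
      (∑' m : ℕ, u ^ (m + 1) * lambert q w (m + 1)) := by
  have h := hasSum_lambert hq hw hu (g := fun _ => 1) (G := 1) (by simp)
  refine hasSum_of_eq h (fun n => ?_) (by simp)
  have hlt : ‖q ^ (n + 1) * u‖ < 1 := by
    rw [pow_succ, mul_assoc, norm_mul, norm_pow]
    exact (mul_le_of_le_one_left (norm_nonneg _)
      (pow_le_one₀ (norm_nonneg _) hq.le)).trans_lt hu
  have := (hasSum_geometric_of_norm_lt_one hlt).mul_left (q ^ (n + 1) * u)
  simp_rw [← pow_succ'] at this
  simp only [mul_one]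
  rw [this.tsum_eq, div_eq_mul_inv]

theorem summable_lambert {q w u : ℂ} (hq : ‖q‖ < 1) (hw : ‖q * w‖ < 1) (hu : ‖q * u‖ < 1)
    {g : ℕ → ℂ} {G : ℝ} (hg : ∀ m, ‖g m‖ ≤ G) :
    Summable fun m : ℕ => u ^ (m + 1) * lambert q w (m + 1) * g m := by
  have hc : 0 < 1 - ‖q * w‖ := by linarith
  have h1 := ((summable_nat_add_iff 1).2 (summable_geometric_of_lt_one (norm_nonneg _) hu)).mul_right
    (‖w‖ / (1 - ‖q * w‖) * G)
  refine Summable.of_norm_bounded h1 fun m => ?_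
  rw [norm_mul, norm_mul, norm_pow]
  have h2 := lambert_norm_le hc (one_sub_le_norm (q := q) (w := w) hq m)
  calc _ ≤ ‖u‖ ^ (m + 1) * (‖q‖ ^ (m + 1) * (‖w‖ / (1 - ‖q * w‖))) * G := by
        gcongr; exact hg m
    _ = _ := by rw [norm_mul q u, mul_pow]; ring

theorem inv_mul_div_one_sub_inv_mul {a u : ℂ} (ha : a ≠ 0) (hu : u ≠ 0) (h : a ≠ u) :
    a⁻¹ * u / (1 - a⁻¹ * u) = -(1 + a * u⁻¹ / (1 - a * u⁻¹)) := by
  have h1 : 1 - a⁻¹ * u = (a - u) / a := by field_simp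
  have h2 : 1 - a * u⁻¹ = -(a - u) / u := by field_simp; ring
  have h3 : a - u ≠ 0 := sub_ne_zero.2 h
  rw [h1, h2]
  field_simp
  ring

theorem hasSum_kronecker_pos {q w u : ℂ} (hq : ‖q‖ < 1) (hw' : ‖q * w‖ < 1)
    (hqu : ‖q * u‖ < 1) :
    HasSum (fun n : ℕ => w ^ n * (q ^ n * u / (1 - q ^ n * u)))
      (u / (1 - u) + ∑' m : ℕ, u ^ (m + 1) * lambert q w (m + 1)) := by
  rw [← hasSum_nat_add_iff' 1, Finset.sum_range_one, pow_zero, pow_zero, one_mul, one_mul,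
    add_sub_cancel_left]
  exact hasSum_lambert_pos hq hw' hqu

theorem hasSum_inv_pow_succ {w : ℂ} (hw : 1 < ‖w‖) :
    HasSum (fun n : ℕ => w⁻¹ ^ (n + 1)) (1 / (w - 1)) := by
  have hw0 : w ≠ 0 := norm_pos_iff.1 (one_pos.trans hw)
  have hwi : ‖w⁻¹‖ < 1 := by rw [norm_inv]; exact inv_lt_one_of_one_lt₀ hw
  refine hasSum_of_eq ((hasSum_geometric_of_norm_lt_one hwi).mul_left w⁻¹)
    (fun n => pow_succ' _ _) ?_
  rw [← mul_inv, mul_sub, mul_one, mul_inv_cancel₀ hw0, one_div]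

/-- The terms of negative index are reflected by x/(1-x) = -(1 + x⁻¹/(1-x⁻¹)). The constant 1 leaves
a geometric series in w⁻¹, which is where |w| > 1 is used, and the rest is the Lambert series in u⁻¹
and w⁻¹. -/
theorem hasSum_kronecker_neg {q w u : ℂ} (hq0 : q ≠ 0) (hq : ‖q‖ < 1) (hu : ‖u‖ = 1)
    (hw : 1 < ‖w‖) (hqwi : ‖q * w⁻¹‖ < 1) (hqu' : ‖q * u⁻¹‖ < 1) :
    HasSum (fun n : ℕ => w ^ (-((n : ℤ) + 1)) *
      (q ^ (-((n : ℤ) + 1)) * u / (1 - q ^ (-((n : ℤ) + 1)) * u)))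
      (-(1 / (w - 1) + ∑' m : ℕ, u⁻¹ ^ (m + 1) * lambert q w⁻¹ (m + 1))) := by
  have hu0 : u ≠ 0 := by rintro rfl; simp at hu
  refine hasSum_of_eq ((hasSum_inv_pow_succ hw).add (hasSum_lambert_pos hq hqwi hqu')).neg
    (fun n => ?_) rfl
  have hz : ∀ x : ℂ, x ^ (-((n : ℤ) + 1)) = (x ^ (n + 1))⁻¹ := fun x => by
    rw [zpow_neg]; norm_cast
  have hne : ‖q ^ (n + 1)‖ < 1 := by
    rw [norm_pow]; exact pow_lt_one₀ (norm_nonneg q) hq (Nat.succ_ne_zero n)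
  rw [hz, hz, inv_pow, inv_mul_div_one_sub_inv_mul (pow_ne_zero _ hq0) hu0
    (fun h => by rw [h, hu] at hne; simp at hne)]
  ring

theorem hasSum_kronecker {q w u : ℂ} (hq0 : q ≠ 0) (hq : ‖q‖ < 1) (hu : ‖u‖ = 1)
    (hw : 1 < ‖w‖) (hw' : ‖q * w‖ < 1) :
    HasSum (fun n : ℤ => w ^ n * (q ^ n * u / (1 - q ^ n * u)))
      (u / (1 - u) - 1 / (w - 1) + lambertQ q u w) := by
  have hqu : ‖q * u‖ < 1 := by rwa [norm_mul, hu, mul_one]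
  have hqu' : ‖q * u⁻¹‖ < 1 := by rwa [norm_mul, norm_inv, hu, inv_one, mul_one]
  have hqwi : ‖q * w⁻¹‖ < 1 := by
    rw [norm_mul, norm_inv]
    exact mul_lt_one_of_nonneg_of_lt_one_left (norm_nonneg _) hq (inv_le_one_of_one_le₀ hw.le)
  have h1 := hasSum_kronecker_pos (w := w) (u := u) hq hw' hqu
  have h2 := hasSum_kronecker_neg hq0 hq hu hw hqwi hqu'
  have h3 := HasSum.of_nat_of_neg_add_one
    (f := fun n : ℤ => w ^ n * (q ^ n * u / (1 - q ^ n * u))) (by simpa only [zpow_natCast]) h2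
  refine hasSum_of_eq h3 (fun _ => rfl) ?_
  have s1 := summable_lambert hq hw' hqu (g := fun _ => 1) (G := 1) (by simp)
  have s2 := summable_lambert hq hqwi hqu' (g := fun _ => 1) (G := 1) (by simp)
  simp only [mul_one] at s1 s2
  rw [lambertQ, s1.tsum_sub s2]
  ring

/-- The bilateral series `∑_{n ∈ ℤ} w^n q^n u / (1 - q^n u)` times `θ(α)`, `w = e(α)`, is
proportional to `θ(ξ + α)`. -/
theorem exists_theta_mul_eq (τ : UpperHalfPlane) (ξ : ℂ) (hne : ∀ n : ℤ, e τ ^ n * e ξ ≠ 1) :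
    ∃ C : ℂ, ∀ α Φ : ℂ,
      HasSum (fun n : ℤ => e α ^ n * (e τ ^ n * e ξ / (1 - e τ ^ n * e ξ))) Φ →
        theta τ α * Φ = C * theta τ (ξ + α) := by
  obtain ⟨q, hq⟩ : ∃ q, q = e τ := ⟨_, rfl⟩
  obtain ⟨u, hu⟩ : ∃ u, u = e ξ := ⟨_, rfl⟩
  obtain ⟨a, ha⟩ : ∃ a, a = thetaCoef τ := ⟨_, rfl⟩
  obtain ⟨ℓ, hℓ⟩ : ∃ ℓ : ℤ → ℂ, ℓ = fun n => q ^ n * u / (1 - q ^ n * u) := ⟨_, rfl⟩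
  obtain ⟨c, hc⟩ : ∃ c : ℤ → ℂ, c = fun k => ∑' n : ℤ, a (k - n) * ℓ n := ⟨_, rfl⟩
  have hq0 : q ≠ 0 := hq ▸ e_ne_zero _
  have hu0 : u ≠ 0 := hu ▸ e_ne_zero _
  have haq : ∀ n, a (n + 1) = -(q ^ (n + 1) * a n) := by rw [ha, hq]; exact thetaCoef_add_one τ
  have hth : ∀ ξ, HasSum (fun n : ℤ => a n * e (((n : ℂ) + 1 / 2) * ξ)) (theta τ ξ) := by
    rw [ha]; exact hasSum_theta τ
  rw [← hq, ← hu] at hne ⊢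
  change ∃ C : ℂ, ∀ α Φ : ℂ, HasSum (fun n : ℤ => e α ^ n * (fun n => q ^ n * u / (1 - q ^ n * u)) n) Φ →
        theta τ α * Φ = C * theta τ (ξ + α)
  rw [← hℓ]
  have key : ∀ α Φ : ℂ, HasSum (fun n : ℤ => e α ^ n * ℓ n) Φ →
      (∀ k, Summable fun n => a (k - n) * ℓ n) ∧
      HasSum (fun k : ℤ => c k * e (((k : ℂ) + 1 / 2) * α)) (theta τ α * Φ) := by
    intro α Φ hΦ
    have hs := summable_mul_of_summable_norm (hth α).summable.norm hΦ.summable.norm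
    have hprod := (hth α).mul hΦ hs
    let E : ℤ × ℤ ≃ ℤ × ℤ :=
      { toFun := fun p => (p.1 - p.2, p.2)
        invFun := fun p => (p.1 + p.2, p.2)
        left_inv := fun p => by simp
        right_inv := fun p => by simp }
    have h1 := E.hasSum_iff.2 hprod
    have h2 : HasSum (fun p : ℤ × ℤ => a (p.1 - p.2) * ℓ p.2 * e (((p.1 : ℂ) + 1 / 2) * α))
        (theta τ α * Φ) := by
      refine hasSum_of_eq h1 (fun p => ?_) rfl
      simp only [Function.comp, E, Equiv.coe_fn_mk]
      rw [← e_int_mul]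
      have : ((p.1 : ℂ) + 1 / 2) * α = (((p.1 - p.2 : ℤ) : ℂ) + 1 / 2) * α + (p.2 : ℂ) * α := by
        push_cast; ring
      rw [this, e_add]
      ring
    have hsm : ∀ k, Summable fun n => a (k - n) * ℓ n := fun k => by
      have := (h2.summable.prod_factor k).mul_right (e (((k : ℂ) + 1 / 2) * α))⁻¹
      refine this.congr fun n => ?_
      rw [mul_assoc, mul_inv_cancel₀ (e_ne_zero _), mul_one]
    refine ⟨hsm, h2.prod_fiberwise fun k => ?_⟩
    rw [hc]; exact (hsm k).hasSum.mul_right _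
  -- The convolution coefficients c do not involve α, so convergence at a single α suffices to
  -- analyse them. If there is no such α, the assertion is vacuous.
  by_cases hex : ∃ α Φ : ℂ, HasSum (fun n : ℤ => e α ^ n * ℓ n) Φ
  swap
  · exact ⟨0, fun α Φ h => absurd ⟨α, Φ, h⟩ hex⟩
  obtain ⟨α₀, Φ₀, h₀⟩ := hex
  have hsm := (key α₀ Φ₀ h₀).1
  -- The recursions of a and ℓ give a(k+1-n) ℓ(n) + q^(k+1) u a(k-n) ℓ(n) = -q^(k+1) u a(k-n).
  -- Summed over n the right side is a multiple of ∑ a = θ(0) = 0, so the recursion for c is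
  -- homogeneous.
  have hsum0 : HasSum a 0 := by
    have := hth 0
    rw [theta_zero] at this
    simpa [e_zero] using this
  have hrec : ∀ k, c (k + 1) = -(q ^ (k + 1) * u * c k) := fun k => by
    have e1 : HasSum (fun n => a (k + 1 - n) * ℓ n) (c (k + 1)) := by
      rw [hc]; exact (hsm (k + 1)).hasSum
    have e2 : HasSum (fun n => q ^ (k + 1) * u * (a (k - n) * ℓ n)) (q ^ (k + 1) * u * c k) := by
      rw [hc]; exact (hsm k).hasSum.mul_left _
    have e3 : HasSum (fun n => q ^ (k + 1) * u * a (k - n)) (q ^ (k + 1) * u * 0) :=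
      ((Equiv.subLeft k).hasSum_iff.2 hsum0).mul_left _
    have e4 := hasSum_of_eq (e1.add e2) (g := fun n => -(q ^ (k + 1) * u * a (k - n)))
      (fun n => ?_) rfl
    · have := e4.unique e3.neg
      rw [mul_zero, neg_zero] at this
      linear_combination this
    · have h1 : a (k + 1 - n) = -(q ^ (k + 1 - n) * a (k - n)) := by
        rw [show k + 1 - n = k - n + 1 by ring]; exact haq (k - n)
      have h2 : 1 - q ^ n * u ≠ 0 := sub_ne_zero.2 (hne n).symm
      have h3 : q ^ (k + 1 - n) * q ^ n = q ^ (k + 1) := by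
        rw [← zpow_add₀ hq0]; ring_nf
      rw [h1, hℓ, ← h3]
      field_simp
      ring
  -- The sequence a(k) u^k satisfies the same first-order recursion as c, and a(0) ≠ 0; the two are
  -- therefore proportional.
  have hconst : ∀ k, c k = c 0 / a 0 * (a k * u ^ k) := by
    have ha0 : a 0 ≠ 0 := ha ▸ thetaCoef_ne_zero τ 0
    intro k
    induction k using Int.induction_on with
    | zero => rw [zpow_zero, mul_one, div_mul_cancel₀ _ ha0]
    | succ k ih =>
      rw [hrec, ih, haq k, zpow_add_one₀ hu0]
      ring
    | pred k ih =>
      have h1 := hrec (-(k : ℤ) - 1)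
      have h2 := haq (-(k : ℤ) - 1)
      rw [sub_add_cancel] at h1 h2
      have hne' : q ^ (-(k : ℤ)) * u ≠ 0 := mul_ne_zero (zpow_ne_zero _ hq0) hu0
      apply mul_left_cancel₀ hne'
      have h3 : u ^ (-(k : ℤ)) = u ^ (-(k : ℤ) - 1) * u := by
        rw [← zpow_add_one₀ hu0, sub_add_cancel]
      have h4 : q ^ (-(k : ℤ)) * u * c (-(k : ℤ) - 1) = - c (-k) := by rw [h1]; ring
      rw [h4, ih, h3, h2]
      ring
  refine ⟨c 0 / a 0 * e (-(ξ / 2)), fun α Φ h => (key α Φ h).2.unique ?_⟩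
  have := (hth (ξ + α)).mul_left (c 0 / a 0 * e (-(ξ / 2)))
  refine hasSum_of_eq this (fun k => ?_) rfl
  have h1 : ((k : ℂ) + 1 / 2) * (ξ + α) = (k : ℂ) * ξ + ξ / 2 + ((k : ℂ) + 1 / 2) * α := by ring
  rw [hconst, h1, e_add, e_add, e_int_mul, e_neg, ← hu]
  have := e_ne_zero (ξ / 2)
  field_simp

/-- Rewriting u/(1-u) as 1/(1-u) - 1 isolates the pole in t, and the leftover -1 joins 1/(e(α)-1) to
form e(α)/(e(α)-1), which is regular in t. -/
theorem mul_kap_add_kroneckerB (q : ℂ) {t : ℝ} (ht : e t ≠ 1) {α : ℂ} (hα : e α ≠ 1) :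
    α * kap t + kroneckerB q t α = -(2 * Real.pi * I) * α *
      (e t / (1 - e t) - 1 / (e α - 1) + lambertQ q (e t) (e α)) := by
  have h1 : 1 - e t ≠ 0 := sub_ne_zero.2 ht.symm
  have h2 : e α - 1 ≠ 0 := sub_ne_zero.2 hα
  have h4 := mul_expSlope α
  have h3 : expSlope α ≠ 0 := fun h => h2 (by rw [← h4, h, mul_zero])
  have h5 : α ≠ 0 := fun h => h2 (by rw [← h4, h, zero_mul])
  have h6 : e α / expSlope α = α * (e α / (e α - 1)) := by rw [← h4]; field_simp
  have h7 : e t / (1 - e t) = 1 / (1 - e t) - 1 := by field_simp; ring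
  have h8 : e α / (e α - 1) = 1 + 1 / (e α - 1) := by field_simp; ring
  rw [kap, kroneckerB, h6, h7, h8]
  ring

theorem e_tau_zpow_mul_ne_one (τ : UpperHalfPlane) {t : ℝ} (ht : e t ≠ 1) (n : ℤ) :
    e τ ^ n * e t ≠ 1 := by
  rw [← e_int_mul, ← e_add]
  intro h
  have h1 := congrArg norm h
  rw [norm_e, norm_one, Real.exp_eq_one_iff, neg_eq_zero] at h1
  have h2 : (n : ℝ) * τ.im = 0 := by
    have := (mul_eq_zero.1 h1).resolve_left (by positivity)
    simpa using this
  have h3 : n = 0 := by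
    have := (mul_eq_zero.1 h2).resolve_right τ.im_pos.ne'
    exact_mod_cast this
  rw [h3] at h
  simp at h
  exact ht h

/-- The bilateral series converges only for -Im τ < Im α < 0, a strip with 0 on its boundary. Both
sides below are analytic on a full ball around 0, so the identity theorem extends the relation to α
= 0, where the Taylor coefficients are taken. -/
theorem exists_dslope_theta_mul_eq (τ : UpperHalfPlane) {t : ℝ} (ht : e t ≠ 1) :
    ∃ C : ℂ, ∀ᶠ α in 𝓝 (0 : ℂ),
      dslope (theta τ) 0 α * (α * kap t + kroneckerB (e τ) t α) = C * theta τ (t + α) := by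
  obtain ⟨C, hC⟩ := exists_theta_mul_eq τ t (e_tau_zpow_mul_ne_one τ ht)
  obtain ⟨R, hR, hR1, c, W, hb⟩ := exists_lambertBound_zero (norm_e_tau_lt_one τ)
  refine ⟨-(2 * Real.pi * I) * C, ?_⟩
  have hstrip : ∀ α : ℂ, α.im < 0 → -τ.im < α.im → ‖α‖ < 1 →
      dslope (theta τ) 0 α * (α * kap t + kroneckerB (e τ) t α) =
        -(2 * Real.pi * I) * C * theta τ (t + α) := fun α h1 h2 h3 => by
    have h0 : α ≠ 0 := by rintro rfl; simp at h1
    have hs := hasSum_kronecker (e_ne_zero τ) (norm_e_tau_lt_one τ) (norm_e_ofReal t)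
      (one_lt_norm_e_iff.2 h1) (by
        rw [← e_add, norm_e_lt_one_iff, Complex.add_im]
        have : (τ : ℂ).im = τ.im := rfl
        linarith)
    rw [mul_kap_add_kroneckerB _ ht (e_ne_one h3 h0), mul_assoc _ C, ← hC α _ hs,
      dslope_of_ne _ h0, slope_def_field, theta_zero, sub_zero, sub_zero]
    field_simp
  have hdθ : Differentiable ℂ (dslope (theta τ) 0) := fun z =>
    (((Complex.differentiableOn_dslope univ_mem).2
      (differentiable_theta τ).differentiableOn) z (Set.mem_univ z)).differentiableAt univ_mem
  have hB := differentiableOn_kroneckerB (norm_e_tau_lt_one τ) t hR1.le hb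
  have a1 : AnalyticOnNhd ℂ (fun α => dslope (theta τ) 0 α *
      (α * kap t + kroneckerB (e τ) t α)) (Metric.ball 0 R) := by
    refine DifferentiableOn.analyticOnNhd ?_ Metric.isOpen_ball
    exact hdθ.differentiableOn.mul ((differentiableOn_id.mul_const _).add hB)
  have a2 : AnalyticOnNhd ℂ (fun α => -(2 * Real.pi * I) * C * theta τ (t + α))
      (Metric.ball 0 R) := by
    refine DifferentiableOn.analyticOnNhd ?_ Metric.isOpen_ball
    have := differentiable_theta τ
    fun_prop
  -- The point -iy lies both in the ball of radius R and in the strip of convergence.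
  set y := min R τ.im / 2 with hy
  have hypos : 0 < min R τ.im := lt_min hR τ.im_pos
  have hy0 : 0 < y := by positivity
  have hyR : y < R := by have := min_le_left R τ.im; linarith
  have hyτ : y < τ.im := by have := min_le_right R τ.im; linarith
  have hnorm : ‖-(y * I)‖ = y := by simp [abs_of_pos hy0]
  have hz : -(y * I) ∈ Metric.ball (0 : ℂ) R := by rwa [mem_ball_zero_iff, hnorm]
  have hev : ∀ᶠ α in 𝓝 (-(y * I) : ℂ), dslope (theta τ) 0 α *
      (α * kap t + kroneckerB (e τ) t α) = -(2 * Real.pi * I) * C * theta τ (t + α) := by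
    have e1 : ∀ᶠ α : ℂ in 𝓝 (-(y * I) : ℂ), α.im < 0 :=
      Complex.continuous_im.continuousAt.eventually_lt continuousAt_const (by simpa using hy0)
    have e2 : ∀ᶠ α : ℂ in 𝓝 (-(y * I) : ℂ), -τ.im < α.im :=
      continuousAt_const.eventually_lt Complex.continuous_im.continuousAt (by simpa using hyτ)
    have e3 : ∀ᶠ α : ℂ in 𝓝 (-(y * I) : ℂ), ‖α‖ < 1 :=
      continuous_norm.continuousAt.eventually_lt continuousAt_const (by rw [hnorm]; linarith)
    filter_upwards [e1, e2, e3] with α h1 h2 h3 using hstrip α h1 h2 h3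
  have heq := a1.eqOn_of_preconnected_of_eventuallyEq a2
    (convex_ball (0 : ℂ) R).isPreconnected hz hev
  filter_upwards [Metric.ball_mem_nhds (0 : ℂ) hR] with α hα using heq hα

/-- If θ'(0) were 0, the previous relation at α = 0 would read C θ(t) = 0; a t with θ(t) ≠ 0 forces
C = 0. The factor α `kap t` + `kroneckerB` tends to 1, so θ(α)/α, and hence θ, would vanish near 0.
-/
theorem deriv_theta_zero_ne_zero (τ : UpperHalfPlane) : deriv (theta τ) 0 ≠ 0 := by
  intro h0
  obtain ⟨t, ht, hθ⟩ : ∃ t : ℝ, e t ≠ 1 ∧ theta τ t ≠ 0 := by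
    by_contra! hcon
    refine theta_ne_zero_of_frequently τ (z := ((1 / 2 : ℝ) : ℂ)) ?_
    have h1 : Tendsto (fun t : ℝ => (t : ℂ)) (𝓝[≠] (1 / 2)) (𝓝[≠] ((1 / 2 : ℝ) : ℂ)) :=
      Complex.continuous_ofReal.continuousWithinAt.tendsto_nhdsWithin fun x hx => by
        simpa only [Set.mem_compl_iff, Set.mem_singleton_iff, Complex.ofReal_inj] using hx
    refine h1.frequently (Eventually.frequently ?_)
    have h2 : ∀ᶠ t : ℝ in 𝓝 (1 / 2), t ∈ Set.Ioo (0 : ℝ) 1 :=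
      Ioo_mem_nhds (by norm_num) (by norm_num)
    filter_upwards [h2.filter_mono nhdsWithin_le_nhds] with t ht
    refine hcon t (e_ne_one ?_ ?_)
    · rw [Complex.norm_real, Real.norm_eq_abs, abs_of_pos ht.1]; exact ht.2
    · exact_mod_cast ht.1.ne'
  obtain ⟨C, hC⟩ := exists_dslope_theta_mul_eq τ ht
  have h1 := hC.self_of_nhds
  rw [dslope_same, h0, zero_mul, add_zero] at h1
  have hC0 : C = 0 := (mul_eq_zero.1 h1.symm).resolve_right hθ
  obtain ⟨R, hR, hR1, c, W, hb⟩ := exists_lambertBound_zero (norm_e_tau_lt_one τ)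
  have hB : ContinuousAt (kroneckerB (e τ) t) 0 :=
    ((differentiableOn_kroneckerB (norm_e_tau_lt_one τ) t hR1.le hb).continuousOn).continuousAt
      (Metric.ball_mem_nhds _ hR)
  have h2 : ∀ᶠ α in 𝓝 (0 : ℂ), α * kap t + kroneckerB (e τ) t α ≠ 0 := by
    have : ContinuousAt (fun α => α * kap t + kroneckerB (e τ) t α) 0 :=
      (continuousAt_id.mul continuousAt_const).add hB
    refine this.eventually_ne ?_
    simp [kroneckerB_zero]
  refine theta_ne_zero_of_frequently τ (z := 0) (Eventually.frequently ?_)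
  have h3 : ∀ᶠ α in 𝓝[≠] (0 : ℂ), α ≠ 0 := eventually_mem_nhdsWithin
  filter_upwards [h3, (hC.and h2).filter_mono nhdsWithin_le_nhds] with α hα h
  obtain ⟨h4, h5⟩ := h
  rw [hC0, zero_mul] at h4
  have h6 := (mul_eq_zero.1 h4).resolve_right h5
  have h7 := sub_smul_dslope (theta τ) 0 α
  rw [h6, theta_zero, smul_zero, sub_zero] at h7
  exact h7.symm

/-- The expansion of the Kronecker function at `α = 0` for real non-integral `t`. -/
theorem kroneckerReg_eventuallyEq (τ : UpperHalfPlane) {t : ℝ} (ht : e t ≠ 1) :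
    kroneckerReg t τ =ᶠ[𝓝 0] fun α => α * kap t + kroneckerB (e τ) t α := by
  obtain ⟨C, hC⟩ := exists_dslope_theta_mul_eq τ ht
  have h0 := deriv_theta_zero_ne_zero τ
  -- At α = 0 the relation becomes θ'(0) = C θ(t), which identifies the constant with the one in the
  -- Kronecker function and shows θ(t) ≠ 0.
  have h1 := hC.self_of_nhds
  rw [dslope_same, kroneckerB_zero, zero_mul, zero_add, mul_one, add_zero] at h1
  have hθ : theta τ t ≠ 0 := fun h => h0 (by rw [h1, h, mul_zero])
  have hne : ∀ᶠ α in 𝓝 (0 : ℂ), dslope (theta τ) 0 α ≠ 0 := by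
    have : ContinuousAt (dslope (theta τ) 0) 0 :=
      continuousAt_dslope_same.2 (differentiable_theta τ 0)
    exact this.eventually_ne (by rwa [dslope_same])
  filter_upwards [hC, hne] with α h2 h3
  rw [kroneckerReg, h1, div_eq_iff (mul_ne_zero hθ h3)]
  linear_combination (-theta τ t) * h2

/-- The Taylor coefficients of `kroneckerB` at `α = 0`. -/
def kroneckerCoef (q : ℂ) (n : ℕ) (t : ℝ) : ℂ :=
  iteratedDeriv n (kroneckerB q t) 0 / n.factorial

/-- The polar part α `kap t` is linear in α, so it is seen by the coefficient n = 1 only. All other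
f_n extend continuously to [0,1] and need no regularization. -/
theorem f_eq (τ : UpperHalfPlane) {t : ℝ} (ht : e t ≠ 1) (n : ℕ) :
    f n t τ = 2 * Real.pi * I / (2 * Real.pi * I) ^ n *
      (kroneckerCoef (e τ) n t + if n = 1 then kap t else 0) := by
  obtain ⟨R, hR, hR1, c, W, hb⟩ := exists_lambertBound_zero (norm_e_tau_lt_one τ)
  have hB : ContDiffAt ℂ n (kroneckerB (e τ) t) 0 :=
    ((differentiableOn_kroneckerB (norm_e_tau_lt_one τ) t hR1.le hb).analyticAt
      (Metric.ball_mem_nhds _ hR)).contDiffAt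
  have h1 : iteratedDeriv n (kroneckerReg t τ) 0 =
      iteratedDeriv n (fun α => α * kap t + kroneckerB (e τ) t α) 0 :=
    (kroneckerReg_eventuallyEq τ ht).iteratedDeriv_eq n
  have h2 : iteratedDeriv n (fun α => α * kap t + kroneckerB (e τ) t α) 0 =
      iteratedDeriv n (fun α : ℂ => α * kap t) 0 + iteratedDeriv n (kroneckerB (e τ) t) 0 :=
    iteratedDeriv_fun_add (by fun_prop) hB
  have h3 : iteratedDeriv n (fun α : ℂ => α * kap t) 0 = if n = 1 then kap t else 0 := by
    match n with
    | 0 => simp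
    | 1 => simp [iteratedDeriv_one]
    | n + 2 =>
      have hd : deriv (fun α : ℂ => α * kap t) = fun _ => kap t := by
        ext z; simp
      rw [iteratedDeriv_succ', hd, iteratedDeriv_const]
      simp
  rw [f, h1, h2, h3, kroneckerCoef]
  by_cases hn : n = 1
  · simp only [hn, if_true, Nat.factorial_one]; push_cast; ring
  · simp only [hn, if_false]; ring

theorem rCoord_ofReal (τ : UpperHalfPlane) (t : ℝ) : rCoord τ t = 0 := by simp [rCoord]

theorem omega_ofReal (τ : UpperHalfPlane) (n : ℕ) (t : ℝ) : omega n t τ = f n t τ := by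
  rw [omega, rCoord_ofReal, Finset.sum_eq_single 0]
  · simp
  · intro k _ hk; simp [hk]
  · simp

theorem omega_zero_ofReal (τ : UpperHalfPlane) {t : ℝ} (ht : e t ≠ 1) :
    omega 0 t τ = 2 * Real.pi * I := by
  rw [omega_ofReal, f_eq τ ht]
  simp [kroneckerCoef, kroneckerB_zero]

theorem e_ofReal_ne_one {t : ℝ} (ht : t ∈ Set.Ioo (0 : ℝ) 1) : e t ≠ 1 := by
  refine e_ne_one ?_ (by exact_mod_cast ht.1.ne')
  rw [Complex.norm_real, Real.norm_eq_abs, abs_of_pos ht.1]; exact ht.2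

/-! ### The Taylor coefficients of the Kronecker function -/

theorem norm_taylorCoef_le {h : ℂ → ℂ} {R C : ℝ}
    (hh : DifferentiableOn ℂ h (Metric.ball 0 R)) (hC : ∀ z ∈ Metric.ball (0 : ℂ) R, ‖h z‖ ≤ C)
    {r : ℝ} (hr : 0 < r) (hrR : r < R) (n : ℕ) :
    ‖iteratedDeriv n h 0 / n.factorial‖ ≤ C / r ^ n := by
  have hsub : Metric.closedBall (0 : ℂ) r ⊆ Metric.ball 0 R :=
    Metric.closedBall_subset_ball hrR
  have hd : DiffContOnCl ℂ h (Metric.ball 0 r) :=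
    (hh.mono (by rwa [closure_ball _ hr.ne'])).diffContOnCl
  have := Complex.norm_iteratedDeriv_le_of_forall_mem_sphere_norm_le n hr hd
    (fun z hz => hC z (hsub (Metric.sphere_subset_closedBall hz)))
  have hn : (0 : ℝ) < n.factorial := by exact_mod_cast n.factorial_pos
  rw [norm_div, Complex.norm_natCast, div_le_iff₀ hn]
  calc _ ≤ _ := this
    _ = _ := by ring

theorem taylorCoef_sub {h k : ℂ → ℂ} {R : ℝ} (hR : 0 < R)
    (hh : DifferentiableOn ℂ h (Metric.ball 0 R)) (hk : DifferentiableOn ℂ k (Metric.ball 0 R))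
    (n : ℕ) :
    iteratedDeriv n h 0 / n.factorial - iteratedDeriv n k 0 / n.factorial =
      iteratedDeriv n (h - k) 0 / n.factorial := by
  have h1 : ContDiffAt ℂ n h 0 := (hh.analyticAt (Metric.ball_mem_nhds _ hR)).contDiffAt
  have h2 : ContDiffAt ℂ n k 0 := (hk.analyticAt (Metric.ball_mem_nhds _ hR)).contDiffAt
  rw [iteratedDeriv_sub h1 h2]
  ring

/-- The bound is uniform in α, depends continuously on s and vanishes for s = t; through Cauchy's
estimate it yields continuity in t of every Taylor coefficient. -/
theorem norm_kroneckerB_sub_le {q : ℂ} (hq : ‖q‖ < 1) {R c W : ℝ} (hR : R ≤ 1)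
    (h : LambertBound q (Metric.ball 0 R) c W) (s t : ℝ) {α : ℂ} (hα : α ∈ Metric.ball (0 : ℂ) R) :
    ‖kroneckerB q s α - kroneckerB q t α‖ ≤ 2 * Real.pi * ∑' m : ℕ, ‖q‖ ^ (m + 1) * (W / c) *
      (‖e s ^ (m + 1) - e t ^ (m + 1)‖ + ‖(e s)⁻¹ ^ (m + 1) - (e t)⁻¹ ^ (m + 1)‖) := by
  have hsum : ∀ t : ℝ, Summable fun m : ℕ => e t ^ (m + 1) * lambert q (e α) (m + 1) -
      (e t)⁻¹ ^ (m + 1) * lambert q (e α)⁻¹ (m + 1) := fun t =>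
    Summable.of_norm_bounded (summable_pow_succ_mul hq _)
      fun m => h.norm_term_le hα (norm_e_ofReal t) m
  have h1 : kroneckerB q s α - kroneckerB q t α =
      -(2 * Real.pi * I * α) * ∑' m : ℕ, ((e s ^ (m + 1) * lambert q (e α) (m + 1) -
      (e s)⁻¹ ^ (m + 1) * lambert q (e α)⁻¹ (m + 1)) - (e t ^ (m + 1) * lambert q (e α) (m + 1) -
      (e t)⁻¹ ^ (m + 1) * lambert q (e α)⁻¹ (m + 1))) := by
    rw [(hsum s).tsum_sub (hsum t), kroneckerB, kroneckerB, lambertQ, lambertQ]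
    ring
  have h2 : ‖-(2 * Real.pi * I * α)‖ ≤ 2 * Real.pi := by
    have : ‖α‖ ≤ 1 := by rw [mem_ball_zero_iff] at hα; linarith
    rw [norm_neg, norm_mul]
    have h3 : ‖(2 * Real.pi * I : ℂ)‖ = 2 * Real.pi := by
      simp [abs_of_pos Real.pi_pos]
    rw [h3]
    exact mul_le_of_le_one_right (by positivity) this
  have hWc : 0 ≤ W / c := div_nonneg ((norm_nonneg _).trans (h.2 α hα).1) h.1.le
  have hb : ∀ m : ℕ, ‖(e s ^ (m + 1) * lambert q (e α) (m + 1) -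
      (e s)⁻¹ ^ (m + 1) * lambert q (e α)⁻¹ (m + 1)) - (e t ^ (m + 1) * lambert q (e α) (m + 1) -
      (e t)⁻¹ ^ (m + 1) * lambert q (e α)⁻¹ (m + 1))‖ ≤ ‖q‖ ^ (m + 1) * (W / c) *
      (‖e s ^ (m + 1) - e t ^ (m + 1)‖ + ‖(e s)⁻¹ ^ (m + 1) - (e t)⁻¹ ^ (m + 1)‖) := fun m => by
    obtain ⟨k1, k2⟩ := h.norm_lambert_le hα m
    have : (e s ^ (m + 1) * lambert q (e α) (m + 1) -
      (e s)⁻¹ ^ (m + 1) * lambert q (e α)⁻¹ (m + 1)) - (e t ^ (m + 1) * lambert q (e α) (m + 1) -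
      (e t)⁻¹ ^ (m + 1) * lambert q (e α)⁻¹ (m + 1)) =
      lambert q (e α) (m + 1) * (e s ^ (m + 1) - e t ^ (m + 1)) -
      lambert q (e α)⁻¹ (m + 1) * ((e s)⁻¹ ^ (m + 1) - (e t)⁻¹ ^ (m + 1)) := by ring
    rw [this, mul_add]
    refine (norm_sub_le _ _).trans ?_
    rw [norm_mul, norm_mul]
    gcongr
  have hd : ∀ m : ℕ, ‖‖q‖ ^ (m + 1) * (W / c) *
      (‖e s ^ (m + 1) - e t ^ (m + 1)‖ + ‖(e s)⁻¹ ^ (m + 1) - (e t)⁻¹ ^ (m + 1)‖)‖ ≤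
      ‖q‖ ^ (m + 1) * (W / c * 4) := fun m => by
    have e1 : ‖e s ^ (m + 1) - e t ^ (m + 1)‖ ≤ 2 := by
      refine (norm_sub_le _ _).trans ?_
      rw [norm_pow, norm_pow, norm_e_ofReal, norm_e_ofReal]; norm_num
    have e2 : ‖(e s)⁻¹ ^ (m + 1) - (e t)⁻¹ ^ (m + 1)‖ ≤ 2 := by
      refine (norm_sub_le _ _).trans ?_
      rw [norm_pow, norm_pow, norm_inv, norm_inv, norm_e_ofReal, norm_e_ofReal]; norm_num
    rw [Real.norm_of_nonneg (by positivity), mul_assoc]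
    gcongr
    linarith
  rw [h1, norm_mul]
  refine mul_le_mul h2 (tsum_of_norm_bounded
    (Summable.of_norm_bounded (summable_pow_succ_mul hq _) hd).hasSum hb)
    (norm_nonneg _) (by positivity)

theorem continuous_kroneckerCoef {q : ℂ} (hq : ‖q‖ < 1) (n : ℕ) :
    Continuous (kroneckerCoef q n) := by
  obtain ⟨R, hR, hR1, c, W, hb⟩ := exists_lambertBound_zero hq
  rw [continuous_iff_continuousAt]
  intro t
  have hWc : 0 ≤ W / c := div_nonneg ((norm_nonneg _).trans
    (hb.2 0 (Metric.mem_ball_self hR)).1) hb.1.le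
  have hη : Continuous fun s : ℝ => 2 * Real.pi * ∑' m : ℕ, ‖q‖ ^ (m + 1) * (W / c) *
      (‖e s ^ (m + 1) - e t ^ (m + 1)‖ + ‖(e s)⁻¹ ^ (m + 1) - (e t)⁻¹ ^ (m + 1)‖) := by
    refine continuous_const.mul (continuous_tsum (u := fun m => ‖q‖ ^ (m + 1) * (W / c * 4))
      (fun m => ?_) (summable_pow_succ_mul hq _) fun m s => ?_)
    · have : Continuous fun s : ℝ => (e s)⁻¹ :=
        (continuous_e.comp Complex.continuous_ofReal).inv₀ fun s => e_ne_zero _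
      fun_prop
    · have e1 : ‖e s ^ (m + 1) - e t ^ (m + 1)‖ ≤ 2 := by
        refine (norm_sub_le _ _).trans ?_
        rw [norm_pow, norm_pow, norm_e_ofReal, norm_e_ofReal]; norm_num
      have e2 : ‖(e s)⁻¹ ^ (m + 1) - (e t)⁻¹ ^ (m + 1)‖ ≤ 2 := by
        refine (norm_sub_le _ _).trans ?_
        rw [norm_pow, norm_pow, norm_inv, norm_inv, norm_e_ofReal, norm_e_ofReal]; norm_num
      rw [Real.norm_of_nonneg (by positivity), mul_assoc]
      gcongr
      linarith
  have h0 := (hη.tendsto t).div_const ((R / 2) ^ n)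
  simp only [sub_self, norm_zero, add_zero, mul_zero, tsum_zero, zero_div] at h0
  rw [ContinuousAt, tendsto_iff_norm_sub_tendsto_zero]
  refine squeeze_zero (fun _ => norm_nonneg _) (fun s => ?_) h0
  have d1 := differentiableOn_kroneckerB hq s hR1.le hb
  have d2 := differentiableOn_kroneckerB hq t hR1.le hb
  rw [kroneckerCoef, kroneckerCoef, taylorCoef_sub hR d1 d2]
  exact norm_taylorCoef_le (d1.sub d2)
    (fun z hz => norm_kroneckerB_sub_le hq hR1.le hb s t hz) (by positivity) (by linarith) n

/-! ### Iterated integrals with constant forms -/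

theorem iterInt_replicate {g₀ : ℝ → ℂ} {c : ℂ} {a b : ℝ} (hg : ∀ t ∈ Set.Icc a b, g₀ t = c)
    (r : ℕ) : ∀ t ∈ Set.Icc a b,
      iterInt (List.replicate r g₀) a t = (c * (t - a)) ^ r / r.factorial := by
  induction r with
  | zero => intro t _; simp [iterInt]
  | succ r ih =>
    intro t ht
    rw [List.replicate_succ, iterInt]
    have h1 : ∫ x in a..t, g₀ x * iterInt (List.replicate r g₀) a x =
        ∫ x in a..t, c * ((c * (x - a)) ^ r / r.factorial) := by
      refine intervalIntegral.integral_congr fun x hx => ?_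
      rw [Set.uIcc_of_le ht.1] at hx
      have hx' : x ∈ Set.Icc a b := ⟨hx.1, hx.2.trans ht.2⟩
      simp only [hg x hx', ih x hx']
    rw [h1]
    have hr : (r.factorial : ℂ) ≠ 0 := by exact_mod_cast r.factorial_ne_zero
    have hd : ∀ x ∈ Set.uIcc a t, HasDerivAt
        (fun x : ℝ => (c * (x - a)) ^ (r + 1) / (r + 1).factorial)
        (c * ((c * (x - a)) ^ r / r.factorial)) x := fun x _ => by
      have h := ((((hasDerivAt_id x).ofReal_comp.sub_const (a : ℂ)).const_mul c).pow
        (r + 1)).div_const ((r + 1).factorial : ℂ)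
      refine h.congr_deriv ?_
      have : ((r : ℂ) + 1) ≠ 0 := by exact_mod_cast r.succ_ne_zero
      rw [Nat.factorial_succ]
      push_cast
      simp only [id]
      field_simp
    rw [intervalIntegral.integral_eq_sub_of_hasDerivAt hd
      (Continuous.intervalIntegrable (by fun_prop) _ _)]
    simp

/-- Cauchy's formula for repeated integration: each additional constant form is absorbed by an
integration by parts, which raises the exponent of the kernel c(t - x) by one. -/
theorem iterInt_replicate_append {g₀ : ℝ → ℂ} {c : ℂ} {a b : ℝ}
    (hg : ∀ t ∈ Set.Icc a b, g₀ t = c) (s : ℕ) : ∀ (L : List (ℝ → ℂ)) (h : ℝ → ℂ),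
      Continuous h → (∀ t ∈ Set.Icc a b, iterInt L a t = ∫ x in a..t, h x) →
      ∀ t ∈ Set.Icc a b, iterInt (List.replicate s g₀ ++ L) a t =
        ∫ x in a..t, h x * ((c * (t - x)) ^ s / s.factorial) := by
  induction s with
  | zero => intro L h _ hL t ht; simpa using hL t ht
  | succ s ih =>
    intro L h hh hL t ht
    have hU : ∀ x, HasDerivAt (fun x => ∫ y in a..x, h y) (h x) x := fun x =>
      (hh.integral_hasStrictDerivAt a x).hasDerivAt
    have hUc : Continuous fun x => ∫ y in a..x, h y :=
      continuous_iff_continuousAt.2 fun x => (hU x).continuousAt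
    -- The innermost of the constant forms is moved to L, so the induction hypothesis is used for
    -- the longer list `g₀ :: L`, with c times the primitive of h in place of h.
    rw [List.replicate_succ', List.append_assoc, List.singleton_append]
    rw [ih (g₀ :: L) (fun x => c * ∫ y in a..x, h y) (continuous_const.mul hUc) ?_ t ht]
    · have hs : (s.factorial : ℂ) ≠ 0 := by exact_mod_cast s.factorial_ne_zero
      have hV : ∀ x : ℝ, HasDerivAt
          (fun x : ℝ => (c * (t - x)) ^ (s + 1) / (s + 1).factorial)
          (-c * ((c * (t - x)) ^ s / s.factorial)) x := fun x => by
        have h := ((((hasDerivAt_id x).ofReal_comp.const_sub (t : ℂ)).const_mul c).pow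
          (s + 1)).div_const ((s + 1).factorial : ℂ)
        refine h.congr_deriv ?_
        have : ((s : ℂ) + 1) ≠ 0 := by exact_mod_cast s.succ_ne_zero
        rw [Nat.factorial_succ]
        push_cast
        simp only [id]
        field_simp
      have hp := intervalIntegral.integral_mul_deriv_eq_deriv_mul (a := a) (b := t)
        (fun x _ => hU x) (fun x _ => hV x) (hh.intervalIntegrable _ _)
        (Continuous.intervalIntegrable (by fun_prop) _ _)
      simp only [sub_self, mul_zero, intervalIntegral.integral_same, zero_mul,
        ne_eq, Nat.succ_ne_zero, not_false_eq_true, zero_pow, zero_div, zero_sub] at hp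
      rw [← neg_eq_iff_eq_neg, ← intervalIntegral.integral_neg] at hp
      rw [← hp]
      refine intervalIntegral.integral_congr fun x _ => ?_
      ring
    · intro x hx
      rw [iterInt]
      refine intervalIntegral.integral_congr fun y hy => ?_
      rw [Set.uIcc_of_le hx.1] at hy
      have hy' : y ∈ Set.Icc a b := ⟨hy.1, hy.2.trans hx.2⟩
      simp only [hg y hy', hL y hy']

theorem iterInt_depth_one {g₀ g : ℝ → ℂ} {c : ℂ} {a b : ℝ} (hab : a ≤ b)
    (hg₀ : ∀ t ∈ Set.Icc a b, g₀ t = c) (hg : ContinuousOn g (Set.Icc a b)) (s r : ℕ) :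
    iterInt (List.replicate s g₀ ++ g :: List.replicate r g₀) a b =
      c ^ (r + s) / (r.factorial * s.factorial) *
        ∫ t in a..b, g t * ((t - a) ^ r * (b - t) ^ s : ℝ) := by
  -- A continuous extension of g to the whole line, since differentiability of the primitives at the
  -- endpoints requires continuity beyond [a,b].
  set G : ℝ → ℂ := Set.IccExtend hab ((Set.Icc a b).domRestrict g) with hG
  have hGc : Continuous G := (continuousOn_iff_continuous_domRestrict.1 hg).Icc_extend'
  have hGg : ∀ t ∈ Set.Icc a b, G t = g t := fun t ht => by
    rw [hG, Set.IccExtend_of_mem hab _ ht]; rfl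
  have h1 := iterInt_replicate_append hg₀ s (g :: List.replicate r g₀)
    (fun x => G x * ((c * (x - a)) ^ r / r.factorial)) (by fun_prop) (fun t ht => by
      rw [iterInt]
      refine intervalIntegral.integral_congr fun x hx => ?_
      rw [Set.uIcc_of_le ht.1] at hx
      have hx' : x ∈ Set.Icc a b := ⟨hx.1, hx.2.trans ht.2⟩
      simp only [hGg x hx', iterInt_replicate hg₀ r x hx']) b ⟨hab, le_rfl⟩
  rw [h1, ← intervalIntegral.integral_const_mul]
  refine intervalIntegral.integral_congr fun x hx => ?_
  rw [Set.uIcc_of_le hab] at hx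
  simp only [hGg x hx]
  push_cast
  rw [mul_pow, mul_pow]
  ring

/-! ### Uniqueness of regularized values -/

theorem log_neg_two_pi_I_mul {ε : ℝ} (hε : 0 < ε) :
    Complex.log (-(2 * Real.pi * I * ε)) = Real.log ε + Complex.log (-(2 * Real.pi * I)) := by
  rw [← Complex.log_ofReal_mul hε (neg_ne_zero.2 two_pi_I_ne_zero)]
  congr 1; ring

theorem tendsto_norm_log_atTop :
    Tendsto (fun ε : ℝ => ‖Complex.log (-(2 * Real.pi * I * ε))‖) (𝓝[>] 0) atTop := by
  have h1 : Tendsto (fun ε : ℝ => ‖(Real.log ε : ℂ) + Complex.log (-(2 * Real.pi * I))‖)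
      (𝓝[>] 0) atTop := by
    have h2 : Tendsto (fun ε : ℝ => |Real.log ε| - ‖Complex.log (-(2 * Real.pi * I))‖)
        (𝓝[>] 0) atTop :=
      tendsto_atTop_add_const_right _ _ (tendsto_abs_atBot_atTop.comp Real.tendsto_log_nhdsGT_zero)
    refine tendsto_atTop_mono (fun ε => ?_) h2
    have := norm_sub_le_norm_add (Real.log ε : ℂ) (Complex.log (-(2 * Real.pi * I)))
    rwa [Complex.norm_real, Real.norm_eq_abs] at this
  refine h1.congr' ?_
  filter_upwards [self_mem_nhdsWithin] with ε hε
  rw [log_neg_two_pi_I_mul hε]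

theorem tendsto_rpow_nhdsGT_zero {ν : ℝ} (hν : 0 < ν) :
    Tendsto (fun ε : ℝ => ε ^ ν) (𝓝[>] 0) (𝓝 0) := by
  have := (Real.continuousAt_rpow_const 0 ν (Or.inr hν.le)).tendsto
  rw [Real.zero_rpow hν.ne'] at this
  exact this.mono_left nhdsWithin_le_nhds

/-- The difference of two expansions is a polynomial in log(-2πiε) tending to 0. As |log(-2πiε)| →
∞, the polynomial is constant, and the constant is 0. -/
theorem IsRegularizedValue.unique {g : ℝ → ℂ} {r : ℕ} {c₀ d₀ : ℂ}
    (hc : IsRegularizedValue g r c₀) (hd : IsRegularizedValue g r d₀) : c₀ = d₀ := by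
  obtain ⟨c, rfl, ν, hν, hc⟩ := hc
  obtain ⟨d, rfl, μ, hμ, hd⟩ := hd
  have h1 := hc.trans_tendsto (tendsto_rpow_nhdsGT_zero hν)
  have h2 := hd.trans_tendsto (tendsto_rpow_nhdsGT_zero hμ)
  have h3 := h2.sub h1
  set P : Polynomial ℂ := ∑ k ∈ Finset.range (r + 1), Polynomial.C (c k - d k) * Polynomial.X ^ k
    with hP
  have hev : ∀ z, P.eval z = ∑ k ∈ Finset.range (r + 1), (c k - d k) * z ^ k := fun z => by
    simp [hP, Polynomial.eval_finsetSum]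
  have h4 : Tendsto (fun ε : ℝ => P.eval (Complex.log (-(2 * Real.pi * I * ε))))
      (𝓝[>] 0) (𝓝 0) := by
    rw [sub_zero] at h3
    refine h3.congr fun ε => ?_
    rw [hev]
    simp_rw [sub_mul, Finset.sum_sub_distrib]
    ring
  by_cases hdeg : 0 < P.degree
  · have := P.tendsto_norm_atTop hdeg tendsto_norm_log_atTop
    exact absurd (tendsto_zero_iff_norm_tendsto_zero.1 h4) (not_tendsto_nhds_of_tendsto_atTop this 0)
  · have h5 := Polynomial.eq_C_of_degree_le_zero (not_lt.1 hdeg)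
    have h6 : P.coeff 0 = c 0 - d 0 := by
      simp [hP, Polynomial.coeff_X_pow]
    rw [h5, h6] at h4
    simp only [Polynomial.eval_C] at h4
    exact sub_eq_zero.1 (tendsto_nhds_unique tendsto_const_nhds h4)

theorem regularizedValue_eq {g : ℝ → ℂ} {r : ℕ} {c₀ : ℂ} (h : IsRegularizedValue g r c₀) :
    regularizedValue g r = c₀ := by
  have hex : ∃ c₀, IsRegularizedValue g r c₀ := ⟨c₀, h⟩
  rw [regularizedValue, dif_pos hex]
  exact hex.choose_spec.unique h

/-! ### Expansions with a simple logarithm -/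

/-- `g ε = c₀ + c₁ log(-2πi ε) + O(ε^(1/2))`. -/
def HasLogExpansion (g : ℝ → ℂ) (c₁ c₀ : ℂ) : Prop :=
  (fun ε : ℝ => g ε - (c₀ + c₁ * Complex.log (-(2 * Real.pi * I * ε))))
    =O[𝓝[>] (0 : ℝ)] fun ε : ℝ => ε ^ (1 / 2 : ℝ)

theorem HasLogExpansion.add {g h : ℝ → ℂ} {c₁ c₀ d₁ d₀ : ℂ} (hg : HasLogExpansion g c₁ c₀)
    (hh : HasLogExpansion h d₁ d₀) :
    HasLogExpansion (fun ε => g ε + h ε) (c₁ + d₁) (c₀ + d₀) := by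
  refine (IsBigO.add hg hh).congr_left fun ε => ?_
  ring

theorem HasLogExpansion.const_mul {g : ℝ → ℂ} {c₁ c₀ : ℂ} (hg : HasLogExpansion g c₁ c₀)
    (a : ℂ) : HasLogExpansion (fun ε => a * g ε) (a * c₁) (a * c₀) := by
  refine (IsBigO.const_mul_left hg a).congr_left fun ε => ?_
  ring

theorem HasLogExpansion.congr {g h : ℝ → ℂ} {c₁ c₀ : ℂ} (hg : HasLogExpansion g c₁ c₀)
    (h' : ∀ᶠ ε in 𝓝[>] (0 : ℝ), h ε = g ε) : HasLogExpansion h c₁ c₀ := by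
  refine IsBigO.congr' hg ?_ EventuallyEq.rfl
  filter_upwards [h'] with ε hε
  rw [hε]

theorem HasLogExpansion.sum {ι : Type*} (s : Finset ι) {g : ι → ℝ → ℂ} {c₁ c₀ : ι → ℂ}
    (h : ∀ i ∈ s, HasLogExpansion (g i) (c₁ i) (c₀ i)) :
    HasLogExpansion (fun ε => ∑ i ∈ s, g i ε) (∑ i ∈ s, c₁ i) (∑ i ∈ s, c₀ i) := by
  refine (IsBigO.sum h).congr_left fun ε => ?_
  rw [Finset.sum_mul, ← Finset.sum_add_distrib, ← Finset.sum_sub_distrib, Finset.sum_apply]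

theorem HasLogExpansion.isRegularizedValue {g : ℝ → ℂ} {c₁ c₀ : ℂ} (h : HasLogExpansion g c₁ c₀)
    {r : ℕ} (hr : 1 ≤ r) : IsRegularizedValue g r c₀ := by
  refine ⟨fun k => if k = 0 then c₀ else if k = 1 then c₁ else 0, by simp, 1 / 2, by norm_num, ?_⟩
  refine IsBigO.congr_left h fun ε => ?_
  congr 1
  obtain ⟨r, rfl⟩ := Nat.exists_eq_add_of_le' hr
  rw [Finset.sum_range_succ', Finset.sum_range_succ']
  simp [add_comm]

theorem isBigO_of_norm_le {g : ℝ → ℂ} (K : ℝ)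
    (h : ∀ ε : ℝ, 0 < ε → ε < 1 / 2 → ‖g ε‖ ≤ K * ε) :
    g =O[𝓝[>] (0 : ℝ)] fun ε : ℝ => ε ^ (1 / 2 : ℝ) := by
  refine IsBigO.of_bound |K| ?_
  filter_upwards [Ioo_mem_nhdsGT (show (0 : ℝ) < 1 / 2 by norm_num)] with ε hε
  refine (h ε hε.1 hε.2).trans ?_
  have h1 : ε ≤ ε ^ (1 / 2 : ℝ) := by
    have := Real.rpow_le_rpow_of_exponent_ge hε.1 (by linarith [hε.2] : ε ≤ 1)
      (show (1 / 2 : ℝ) ≤ 1 by norm_num)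
    rwa [Real.rpow_one] at this
  rw [Real.norm_of_nonneg (by have := hε.1; positivity)]
  calc K * ε ≤ |K| * ε := mul_le_mul_of_nonneg_right (le_abs_self K) hε.1.le
    _ ≤ _ := by gcongr

theorem isBigO_of_norm_le_log {g : ℝ → ℂ} (K : ℝ) (hK : 0 ≤ K)
    (h : ∀ ε : ℝ, 0 < ε → ε < 1 / 2 → ‖g ε‖ ≤ K * (ε * Real.log ((1 - ε) / ε))) :
    g =O[𝓝[>] (0 : ℝ)] fun ε : ℝ => ε ^ (1 / 2 : ℝ) := by
  -- The factor 2 is the bound |log ε| ε^(1/2) < 1/(1/2) for 0 < ε ≤ 1.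
  refine IsBigO.of_bound (K * 2) ?_
  filter_upwards [Ioo_mem_nhdsGT (show (0 : ℝ) < 1 / 2 by norm_num)] with ε hε
  refine (h ε hε.1 hε.2).trans ?_
  have hε0 := hε.1
  have h1 : Real.log ((1 - ε) / ε) ≤ |Real.log ε| := by
    rw [Real.log_div (by linarith [hε.2]) hε0.ne']
    have := Real.log_nonpos (by linarith [hε.2] : (0 : ℝ) ≤ 1 - ε) (by linarith)
    have := neg_le_abs (Real.log ε)
    linarith
  have h2 := Real.abs_log_mul_self_rpow_lt ε (1 / 2) hε0 (by linarith [hε.2]) (by norm_num)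
  rw [abs_mul, abs_of_pos (Real.rpow_pos_of_pos hε0 _)] at h2
  have h3 : ε = ε ^ (1 / 2 : ℝ) * ε ^ (1 / 2 : ℝ) := by
    rw [← Real.rpow_add hε0]; norm_num
  rw [Real.norm_of_nonneg (by positivity), mul_assoc]
  refine mul_le_mul_of_nonneg_left ?_ hK
  calc ε * Real.log ((1 - ε) / ε) ≤ ε * |Real.log ε| := by gcongr
    _ = ε ^ (1 / 2 : ℝ) * (|Real.log ε| * ε ^ (1 / 2 : ℝ)) := by
        nth_rewrite 1 [h3]; ring
    _ ≤ ε ^ (1 / 2 : ℝ) * 2 := by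
        gcongr
        refine h2.le.trans ?_
        norm_num
    _ = _ := by ring

theorem hasLogExpansion_integral {k : ℝ → ℂ} (hk : ContinuousOn k (Set.Icc 0 1)) :
    HasLogExpansion (fun ε => ∫ t in ε..(1 - ε), k t) 0 (∫ t in (0 : ℝ)..1, k t) := by
  obtain ⟨M, hM⟩ := isCompact_Icc.exists_bound_of_continuousOn hk
  refine isBigO_of_norm_le (2 * M) fun ε h0 h1 => ?_
  have hi : ∀ a ∈ Set.Icc (0 : ℝ) 1, ∀ b ∈ Set.Icc (0 : ℝ) 1,
      IntervalIntegrable k MeasureTheory.volume a b := fun a ha b hb =>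
    (hk.mono (Set.uIcc_subset_Icc ha hb)).intervalIntegrable
  have m0 : (0 : ℝ) ∈ Set.Icc (0 : ℝ) 1 := by simp
  have m1 : (1 : ℝ) ∈ Set.Icc (0 : ℝ) 1 := by simp
  have mε : ε ∈ Set.Icc (0 : ℝ) 1 := ⟨h0.le, by linarith⟩
  have mε' : 1 - ε ∈ Set.Icc (0 : ℝ) 1 := ⟨by linarith, by linarith⟩
  have e1 := intervalIntegral.integral_add_adjacent_intervals (hi 0 m0 ε mε) (hi ε mε _ mε')
  have e2 := intervalIntegral.integral_add_adjacent_intervals (hi 0 m0 _ mε') (hi _ mε' 1 m1)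
  have b1 : ‖∫ t in (0 : ℝ)..ε, k t‖ ≤ M * |ε - 0| := by
    refine intervalIntegral.norm_integral_le_of_norm_le_const fun x hx => hM x ?_
    rw [Set.uIoc_of_le h0.le] at hx
    exact ⟨hx.1.le, hx.2.trans mε.2⟩
  have b2 : ‖∫ t in (1 - ε)..1, k t‖ ≤ M * |1 - (1 - ε)| := by
    refine intervalIntegral.norm_integral_le_of_norm_le_const fun x hx => hM x ?_
    rw [Set.uIoc_of_le (by linarith)] at hx
    exact ⟨mε'.1.trans hx.1.le, hx.2⟩
  rw [sub_zero, abs_of_pos h0] at b1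
  rw [sub_sub_cancel, abs_of_pos h0] at b2
  have : (∫ t in ε..(1 - ε), k t) - ((∫ t in (0 : ℝ)..1, k t) +
      0 * Complex.log (-(2 * Real.pi * I * ε))) =
      -((∫ t in (0 : ℝ)..ε, k t) + ∫ t in (1 - ε)..1, k t) := by
    rw [← e2, ← e1]; ring
  rw [this, norm_neg]
  exact (norm_add_le _ _).trans (by linarith)

theorem integral_inv_symm {ε : ℝ} (h0 : 0 < ε) (h1 : ε < 1 / 2) :
    (∫ t in ε..(1 - ε), t⁻¹) = Real.log ((1 - ε) / ε) ∧
      (∫ t in ε..(1 - ε), (1 - t)⁻¹) = Real.log ((1 - ε) / ε) := by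
  have h : (∫ t in ε..(1 - ε), t⁻¹) = Real.log ((1 - ε) / ε) :=
    integral_inv_of_pos h0 (by linarith)
  refine ⟨h, ?_⟩
  rw [intervalIntegral.integral_comp_sub_left (fun x => x⁻¹) 1, sub_sub_cancel, h]

/-! ### The pole part of the Kronecker function -/

/-- The entire function `(e(z) - 1) / (z (z - 1))`. -/
def expSlope₂ (z : ℂ) : ℂ := dslope expSlope 1 z

theorem differentiable_expSlope₂ : Differentiable ℂ expSlope₂ := fun z =>
  (((Complex.differentiableOn_dslope univ_mem).2
    differentiable_expSlope.differentiableOn) z (Set.mem_univ z)).differentiableAt univ_mem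

theorem expSlope_one : expSlope 1 = 0 := by
  have := mul_expSlope 1
  rwa [one_mul, e_one, sub_self] at this

theorem mul_expSlope₂ (z : ℂ) : z * (z - 1) * expSlope₂ z = e z - 1 := by
  have := sub_smul_dslope expSlope 1 z
  rw [expSlope_one, sub_zero, smul_eq_mul] at this
  rw [mul_assoc, expSlope₂, this, mul_expSlope]

theorem expSlope₂_zero : expSlope₂ 0 = -(2 * Real.pi * I) := by
  have := sub_smul_dslope expSlope 1 0
  rw [expSlope_one, sub_zero, smul_eq_mul, expSlope_zero] at this
  rw [expSlope₂, ← this]; ring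

theorem expSlope₂_one : expSlope₂ 1 = 2 * Real.pi * I := by
  have h1 : HasDerivAt (fun z => z * expSlope z) (1 * expSlope 1 + 1 * deriv expSlope 1) 1 :=
    (hasDerivAt_id (1 : ℂ)).mul (differentiable_expSlope 1).hasDerivAt
  have h2 : HasDerivAt (fun z => z * expSlope z) (2 * Real.pi * I * e 1) 1 := by
    have : (fun z => z * expSlope z) = fun z => e z - 1 := funext mul_expSlope
    rw [this]
    exact (hasDerivAt_e 1).sub_const 1
  have h3 := h1.unique h2
  rw [expSlope_one, e_one] at h3
  rw [expSlope₂, dslope_same]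
  linear_combination h3

/-- The function `2πi z (z - 1) / (e(z) - 1)`. -/
def chi (z : ℂ) : ℂ := 2 * Real.pi * I / expSlope₂ z

theorem expSlope₂_ne_zero {t : ℝ} (ht : t ∈ Set.Icc (0 : ℝ) 1) : expSlope₂ t ≠ 0 := by
  by_cases h0 : t = 0
  · rw [h0, Complex.ofReal_zero, expSlope₂_zero]; exact neg_ne_zero.2 two_pi_I_ne_zero
  by_cases h1 : t = 1
  · rw [h1, Complex.ofReal_one, expSlope₂_one]; exact two_pi_I_ne_zero
  intro h
  have := mul_expSlope₂ t
  rw [h, mul_zero] at this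
  exact e_ofReal_ne_one ⟨lt_of_le_of_ne ht.1 (Ne.symm h0), lt_of_le_of_ne ht.2 h1⟩
    (sub_eq_zero.1 this.symm)

theorem chi_zero : chi 0 = -1 := by
  rw [chi, expSlope₂_zero, div_neg, div_self two_pi_I_ne_zero]

theorem chi_one : chi 1 = 1 := by
  rw [chi, expSlope₂_one, div_self two_pi_I_ne_zero]

theorem kap_eq {t : ℝ} (ht : t ∈ Set.Ioo (0 : ℝ) 1) : kap t = chi t / (t * (t - 1)) := by
  have h1 := e_ofReal_ne_one ht
  have h2 := mul_expSlope₂ t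
  have h3 := expSlope₂_ne_zero ⟨ht.1.le, ht.2.le⟩
  have h4 : (t : ℂ) ≠ 0 := by exact_mod_cast ht.1.ne'
  have h5 : (t : ℂ) - 1 ≠ 0 := sub_ne_zero.2 (by exact_mod_cast ht.2.ne)
  have h6 : (1 : ℂ) - e t = -(t * (t - 1) * expSlope₂ t) := by rw [h2]; ring
  rw [kap, chi, h6]
  field_simp

theorem isOpen_expSlope₂_ne : IsOpen {z | expSlope₂ z ≠ 0} :=
  isOpen_ne_fun differentiable_expSlope₂.continuous continuous_const

theorem differentiableOn_chi : DifferentiableOn ℂ chi {z | expSlope₂ z ≠ 0} :=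
  (differentiableOn_const _).div differentiable_expSlope₂.differentiableOn fun _ hz => hz

theorem continuousOn_dslope_chi {a : ℝ} (ha : a ∈ Set.Icc (0 : ℝ) 1) :
    ContinuousOn (fun t : ℝ => dslope chi a t) (Set.Icc 0 1) := by
  have h1 : ContinuousOn (dslope chi a) {z | expSlope₂ z ≠ 0} := by
    have hm : {z | expSlope₂ z ≠ 0} ∈ 𝓝 (a : ℂ) :=
      isOpen_expSlope₂_ne.mem_nhds (expSlope₂_ne_zero ha)
    exact (continuousOn_dslope hm).2
      ⟨differentiableOn_chi.continuousOn, differentiableOn_chi.differentiableAt hm⟩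
  exact h1.comp Complex.continuous_ofReal.continuousOn fun t ht => expSlope₂_ne_zero ht

theorem continuousOn_chi : ContinuousOn (fun t : ℝ => chi t) (Set.Icc 0 1) :=
  differentiableOn_chi.continuousOn.comp Complex.continuous_ofReal.continuousOn
    fun _ ht => expSlope₂_ne_zero ht

/-- The function `t^j kap(t)` without its poles at `0` and `1`. -/
def regKernel : ℕ → ℝ → ℂ
  | 0, t => dslope chi 1 t - dslope chi 0 t
  | j + 1, t => t ^ (j + 1) * dslope chi 1 t + ∑ i ∈ Finset.range (j + 1), (t : ℂ) ^ i - chi t * t ^ j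

theorem continuousOn_regKernel (j : ℕ) : ContinuousOn (regKernel j) (Set.Icc 0 1) := by
  have h0 := continuousOn_dslope_chi (a := 0) (by simp)
  have h1 := continuousOn_dslope_chi (a := 1) (by simp)
  have h2 := continuousOn_chi
  rw [Complex.ofReal_zero] at h0
  rw [Complex.ofReal_one] at h1
  cases j with
  | zero => exact h1.sub h0
  | succ j =>
    have e1 : Continuous fun t : ℝ => (t : ℂ) ^ (j + 1) := by fun_prop
    have e2 : Continuous fun t : ℝ => ∑ i ∈ Finset.range (j + 1), (t : ℂ) ^ i := by fun_prop
    have e3 : Continuous fun t : ℝ => (t : ℂ) ^ j := by fun_prop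
    exact ((e1.continuousOn.mul h1).add e2.continuousOn).sub (h2.mul e3.continuousOn)

/-- Growth that is linear in j, caused by the geometric sum in `regKernel`, is harmless against the
factorials in the exponential generating series `rhoGen`. -/
theorem exists_norm_regKernel_le :
    ∃ K : ℝ, 0 ≤ K ∧ ∀ j : ℕ, ∀ t ∈ Set.Icc (0 : ℝ) 1, ‖regKernel j t‖ ≤ K * (j + 1) := by
  obtain ⟨M₀, h₀⟩ := isCompact_Icc.exists_bound_of_continuousOn
    (continuousOn_dslope_chi (a := 0) (by simp))
  obtain ⟨M₁, h₁⟩ := isCompact_Icc.exists_bound_of_continuousOn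
    (continuousOn_dslope_chi (a := 1) (by simp))
  obtain ⟨M₂, h₂⟩ := isCompact_Icc.exists_bound_of_continuousOn continuousOn_chi
  rw [Complex.ofReal_zero] at h₀
  rw [Complex.ofReal_one] at h₁
  have m0 : (0 : ℝ) ∈ Set.Icc (0 : ℝ) 1 := by simp
  have p0 : 0 ≤ M₀ := (norm_nonneg _).trans (h₀ 0 m0)
  have p1 : 0 ≤ M₁ := (norm_nonneg _).trans (h₁ 0 m0)
  have p2 : 0 ≤ M₂ := (norm_nonneg _).trans (h₂ 0 m0)
  refine ⟨M₀ + M₁ + M₂ + 1, by positivity, fun j t ht => ?_⟩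
  have ht1 : ∀ i : ℕ, ‖(t : ℂ) ^ i‖ ≤ 1 := fun i => by
    rw [norm_pow, Complex.norm_real, Real.norm_of_nonneg ht.1]
    exact pow_le_one₀ ht.1 ht.2
  cases j with
  | zero =>
    have := (norm_sub_le _ _).trans (add_le_add (h₁ t ht) (h₀ t ht))
    simp only [regKernel, Nat.cast_zero]
    linarith
  | succ j =>
    have a1 : ‖(t : ℂ) ^ (j + 1) * dslope chi 1 t‖ ≤ 1 * M₁ := by
      rw [norm_mul]; exact mul_le_mul (ht1 _) (h₁ t ht) (norm_nonneg _) zero_le_one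
    have a2 : ‖∑ i ∈ Finset.range (j + 1), (t : ℂ) ^ i‖ ≤ (j + 1 : ℕ) := by
      refine (norm_sum_le_of_le _ fun i _ => ht1 i).trans ?_
      simp
    have a3 : ‖chi t * (t : ℂ) ^ j‖ ≤ M₂ * 1 := by
      rw [norm_mul]; exact mul_le_mul (h₂ t ht) (ht1 _) (norm_nonneg _) p2
    have := (norm_sub_le _ _).trans (add_le_add ((norm_add_le _ _).trans (add_le_add a1 a2)) a3)
    simp only [regKernel]
    push_cast at this ⊢
    have hj : (0 : ℝ) ≤ j := j.cast_nonneg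
    nlinarith

/-- Here `kap t` = χ(t)/(t(t-1)) with χ(0) = -1 and χ(1) = 1. Partial fractions give the poles 1/t
and -1/(1-t), and a factor t^j with j ≥ 1 removes the first of them; the difference quotients of χ
form the remainder. -/
theorem kap_mul_pow {t : ℝ} (ht : t ∈ Set.Ioo (0 : ℝ) 1) (j : ℕ) :
    kap t * t ^ j = (if j = 0 then 1 else 0) * ((t⁻¹ : ℝ) : ℂ) - ((1 - t)⁻¹ : ℝ) + regKernel j t := by
  have h4 : (t : ℂ) ≠ 0 := by exact_mod_cast ht.1.ne'
  have h4' : (t : ℂ) ≠ 1 := by exact_mod_cast ht.2.ne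
  have h5 : (t : ℂ) - 1 ≠ 0 := sub_ne_zero.2 h4'
  have h6 : (1 : ℂ) - t ≠ 0 := sub_ne_zero.2 h4'.symm
  have h7 : (1 : ℂ) - t = -(t - 1) := by ring
  rw [kap_eq ht]
  push_cast
  cases j with
  | zero =>
    simp only [if_true, regKernel]
    rw [dslope_of_ne _ h4, dslope_of_ne _ h4', slope_def_field, slope_def_field, chi_zero, chi_one,
      h7]
    field_simp
    ring
  | succ j =>
    simp only [Nat.succ_ne_zero, if_false, regKernel]
    rw [dslope_of_ne _ h4', slope_def_field, chi_one, geom_sum_eq h4', h7]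
    field_simp
    ring

/-- The regularized integral of `t^j kap(t)` over `[0,1]`. -/
def rho (j : ℕ) : ℂ :=
  (∫ t in (0 : ℝ)..1, regKernel j t) +
    ((if j = 0 then 1 else 0) - 1) * Complex.log (-(2 * Real.pi * I))

theorem exists_norm_rho_le : ∃ K : ℝ, 0 ≤ K ∧ ∀ j : ℕ, ‖rho j‖ ≤ K * (j + 1) := by
  obtain ⟨K, hK, hb⟩ := exists_norm_regKernel_le
  refine ⟨K + ‖Complex.log (-(2 * Real.pi * I))‖, by positivity, fun j => ?_⟩
  have h1 : ‖∫ t in (0 : ℝ)..1, regKernel j t‖ ≤ K * (j + 1) := by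
    have := intervalIntegral.norm_integral_le_of_norm_le_const (a := (0 : ℝ)) (b := 1)
      (f := regKernel j) (C := K * (j + 1)) fun t ht => hb j t (by
        rw [Set.uIoc_of_le zero_le_one] at ht; exact ⟨ht.1.le, ht.2⟩)
    simpa using this
  have h2 : ‖((if j = 0 then 1 else 0) - 1 : ℂ) * Complex.log (-(2 * Real.pi * I))‖ ≤
      ‖Complex.log (-(2 * Real.pi * I))‖ * (j + 1) := by
    rw [norm_mul, mul_comm]
    refine mul_le_mul_of_nonneg_left ?_ (norm_nonneg _)
    have hj : (0 : ℝ) ≤ j := j.cast_nonneg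
    split_ifs with h
    · simp only [sub_self, norm_zero]; linarith
    · simp only [zero_sub, norm_neg, norm_one]; linarith
  rw [rho, add_mul]
  exact (norm_add_le _ _).trans (add_le_add h1 h2)

theorem intervalIntegrable_inv_symm {ε : ℝ} (h0 : 0 < ε) (h1 : ε < 1 / 2) :
    IntervalIntegrable (fun t : ℝ => t⁻¹) MeasureTheory.volume ε (1 - ε) ∧
      IntervalIntegrable (fun t : ℝ => (1 - t)⁻¹) MeasureTheory.volume ε (1 - ε) := by
  have hle : ε ≤ 1 - ε := by linarith
  constructor
  · refine ContinuousOn.intervalIntegrable (continuousOn_id.inv₀ fun t ht => ?_)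
    rw [Set.uIcc_of_le hle] at ht
    exact (h0.trans_le ht.1).ne'
  · refine ContinuousOn.intervalIntegrable
      ((continuousOn_const.sub continuousOn_id).inv₀ fun t ht => ?_)
    rw [Set.uIcc_of_le hle] at ht
    have := ht.2
    intro h
    have h' : 1 - t = 0 := h
    linarith

/-- The integrals of 1/t and 1/(1-t) over [ε,1-ε] both equal log((1-ε)/ε). For j = 0 they cancel;
for j ≥ 1 there remains log ε up to O(ε), and log ε = log(-2πiε) - log(-2πi) explains the logarithm
in `rho`. -/
theorem hasLogExpansion_kap_mul_pow (j : ℕ) :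
    HasLogExpansion (fun ε => ∫ t in ε..(1 - ε), kap t * t ^ j)
      (1 - if j = 0 then 1 else 0) (rho j) := by
  set p : ℂ := if j = 0 then 1 else 0 with hp
  have h1 := hasLogExpansion_integral (continuousOn_regKernel j)
  have h2 : (fun ε : ℝ => (p - 1) * (Real.log (1 - ε) : ℂ)) =O[𝓝[>] (0 : ℝ)]
      fun ε : ℝ => ε ^ (1 / 2 : ℝ) := by
    refine isBigO_of_norm_le (‖p - 1‖ * 2) fun ε h0 h1 => ?_
    rw [norm_mul, mul_assoc, Complex.norm_real, Real.norm_eq_abs]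
    gcongr
    have l1 : Real.log (1 - ε) ≤ 0 := Real.log_nonpos (by linarith) (by linarith)
    have l2 := Real.one_sub_inv_le_log_of_pos (show 0 < 1 - ε by linarith)
    rw [abs_of_nonpos l1]
    have l3 : (1 - ε)⁻¹ ≤ 1 + 2 * ε := by
      rw [inv_le_iff_one_le_mul₀ (by linarith)]
      nlinarith
    linarith
  have h3 := IsBigO.add h1 h2
  refine IsBigO.congr' h3 ?_ EventuallyEq.rfl
  filter_upwards [Ioo_mem_nhdsGT (show (0 : ℝ) < 1 / 2 by norm_num)] with ε hε
  obtain ⟨h0, h1⟩ := hε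
  have hle : ε ≤ 1 - ε := by linarith
  obtain ⟨i1, i2⟩ := intervalIntegrable_inv_symm h0 h1
  obtain ⟨v1, v2⟩ := integral_inv_symm h0 h1
  have i3 : IntervalIntegrable (regKernel j) MeasureTheory.volume ε (1 - ε) := by
    refine ((continuousOn_regKernel j).mono ?_).intervalIntegrable
    exact Set.uIcc_subset_Icc ⟨h0.le, by linarith⟩ ⟨by linarith, by linarith⟩
  have hint : ∫ t in ε..(1 - ε), kap t * t ^ j =
      ∫ t in ε..(1 - ε), (p * ((t⁻¹ : ℝ) : ℂ) - ((1 - t)⁻¹ : ℝ) + regKernel j t) := by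
    refine intervalIntegral.integral_congr fun t ht => ?_
    rw [Set.uIcc_of_le hle] at ht
    exact kap_mul_pow ⟨h0.trans_le ht.1, ht.2.trans_lt (by linarith)⟩ j
  have i1' : IntervalIntegrable (fun t : ℝ => p * ((t⁻¹ : ℝ) : ℂ)) MeasureTheory.volume ε (1 - ε) :=
    IntervalIntegrable.const_mul ⟨i1.1.ofReal, i1.2.ofReal⟩ p
  have i2' : IntervalIntegrable (fun t : ℝ => (((1 - t)⁻¹ : ℝ) : ℂ))
    MeasureTheory.volume ε (1 - ε) := ⟨i2.1.ofReal, i2.2.ofReal⟩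
  rw [hint, intervalIntegral.integral_add (i1'.sub i2') i3,
    intervalIntegral.integral_sub i1' i2', intervalIntegral.integral_const_mul,
    intervalIntegral.integral_ofReal, intervalIntegral.integral_ofReal, v1, v2,
    log_neg_two_pi_I_mul h0, Real.log_div (by linarith) h0.ne', rho, ← hp]
  push_cast
  ring

/-! ### Depth one A-elliptic multiple zeta values -/

/-- The regularized integral of `t^j` against the `n`-th coefficient of the Kronecker function. -/
def aCoef (q : ℂ) (n j : ℕ) : ℂ :=
  (∫ t in (0 : ℝ)..1, kroneckerCoef q n t * t ^ j) + (if n = 1 then 1 else 0) * rho j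

theorem continuousOn_kap : ContinuousOn kap (Set.Ioo 0 1) := by
  unfold kap
  refine ContinuousOn.div continuousOn_const (by fun_prop) fun t ht => ?_
  exact sub_ne_zero.2 (e_ofReal_ne_one ht).symm

theorem abs_weight_sub_le {ε t : ℝ} (h0 : 0 ≤ ε) (h1 : ε ≤ t) (h2 : t ≤ 1 - ε) (r s : ℕ) :
    |(t - ε) ^ r * (1 - ε - t) ^ s - t ^ r * (1 - t) ^ s| ≤ (r + s) * ε := by
  have key : ∀ (n : ℕ) (x : ℝ), ε ≤ x → x ≤ 1 → |(x - ε) ^ n - x ^ n| ≤ n * ε := by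
    intro n x hx hx1
    have hx0 : 0 ≤ x := h0.trans hx
    have hxe : 0 ≤ x - ε := by linarith
    induction n with
    | zero => simp
    | succ n ih =>
      have e1 : (x - ε) ^ (n + 1) - x ^ (n + 1) = ((x - ε) ^ n - x ^ n) * x - (x - ε) ^ n * ε := by
        ring
      have b1 : |((x - ε) ^ n - x ^ n) * x| ≤ n * ε := by
        rw [abs_mul, abs_of_nonneg hx0]
        exact (mul_le_of_le_one_right (abs_nonneg _) hx1).trans ih
      have b2 : |(x - ε) ^ n * ε| ≤ ε := by
        rw [abs_of_nonneg (by positivity)]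
        exact mul_le_of_le_one_left h0 (pow_le_one₀ hxe (by linarith))
      rw [e1]
      refine (abs_sub _ _).trans ?_
      push_cast
      linarith
  have ht0 : 0 ≤ t := h0.trans h1
  have k1 := key r t h1 (by linarith)
  have k2 := key s (1 - t) (by linarith) (by linarith)
  have e1 : (t - ε) ^ r * (1 - ε - t) ^ s - t ^ r * (1 - t) ^ s =
      ((t - ε) ^ r - t ^ r) * (1 - t - ε) ^ s + t ^ r * ((1 - t - ε) ^ s - (1 - t) ^ s) := by
    rw [show 1 - ε - t = 1 - t - ε by ring]; ring
  have b1 : |((t - ε) ^ r - t ^ r) * (1 - t - ε) ^ s| ≤ r * ε := by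
    rw [abs_mul, abs_of_nonneg (pow_nonneg (by linarith : 0 ≤ 1 - t - ε) s)]
    exact (mul_le_of_le_one_right (abs_nonneg _)
      (pow_le_one₀ (by linarith) (by linarith))).trans k1
  have b2 : |t ^ r * ((1 - t - ε) ^ s - (1 - t) ^ s)| ≤ s * ε := by
    rw [abs_mul, abs_of_nonneg (pow_nonneg ht0 r)]
    exact (mul_le_of_le_one_left (abs_nonneg _) (pow_le_one₀ ht0 (by linarith))).trans k2
  rw [e1]
  refine (abs_add_le _ _).trans ?_
  linarith

theorem exists_norm_le_inv {b : ℝ → ℂ} (hb : Continuous b) (d : ℂ) :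
    ∃ K : ℝ, 0 ≤ K ∧ ∀ t ∈ Set.Ioo (0 : ℝ) 1, ‖b t + d * kap t‖ ≤ K * (t⁻¹ + (1 - t)⁻¹) := by
  obtain ⟨M, hM⟩ := isCompact_Icc.exists_bound_of_continuousOn (s := Set.Icc (0 : ℝ) 1)
    hb.continuousOn
  obtain ⟨N, hN⟩ := isCompact_Icc.exists_bound_of_continuousOn continuousOn_chi
  have m0 : (0 : ℝ) ∈ Set.Icc (0 : ℝ) 1 := by simp
  have pM : 0 ≤ M := (norm_nonneg _).trans (hM 0 m0)
  have pN : 0 ≤ N := (norm_nonneg _).trans (hN 0 m0)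
  refine ⟨M + ‖d‖ * N, by positivity, fun t ht => ?_⟩
  have ht' : t ∈ Set.Icc (0 : ℝ) 1 := ⟨ht.1.le, ht.2.le⟩
  have h1 : 0 < 1 - t := by linarith [ht.2]
  have h0 := ht.1
  have e1 : t⁻¹ + (1 - t)⁻¹ = (t * (1 - t))⁻¹ := by field_simp; ring
  have e2 : 1 ≤ (t * (1 - t))⁻¹ :=
    (one_le_inv₀ (by positivity)).2 (mul_le_one₀ ht.2.le h1.le (by linarith))
  have e3 : ‖kap t‖ ≤ N * (t * (1 - t))⁻¹ := by
    have : ‖((t : ℂ) * (t - 1))‖ = t * (1 - t) := by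
      rw [norm_mul, Complex.norm_real, Real.norm_of_nonneg h0.le, norm_sub_rev]
      have : ‖(1 : ℂ) - t‖ = 1 - t := by
        rw [← Complex.ofReal_one, ← Complex.ofReal_sub, Complex.norm_real, Real.norm_of_nonneg h1.le]
      rw [this]
    rw [kap_eq ht, norm_div, this, div_eq_mul_inv]
    exact mul_le_mul_of_nonneg_right (hN t ht') (by positivity)
  rw [e1]
  calc ‖b t + d * kap t‖ ≤ ‖b t‖ + ‖d‖ * ‖kap t‖ := by
        rw [← norm_mul]; exact norm_add_le _ _
    _ ≤ M * (t * (1 - t))⁻¹ + ‖d‖ * (N * (t * (1 - t))⁻¹) := by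
        gcongr
        exact (hM t ht').trans (le_mul_of_one_le_right pM e2)
    _ = _ := by ring

theorem hasLogExpansion_monomial {q : ℂ} (hq : ‖q‖ < 1) (n j : ℕ) :
    HasLogExpansion (fun ε => ∫ t in ε..(1 - ε),
        (kroneckerCoef q n t + (if n = 1 then 1 else 0) * kap t) * t ^ j)
      ((if n = 1 then 1 else 0) * (1 - if j = 0 then 1 else 0)) (aCoef q n j) := by
  have hb := continuous_kroneckerCoef hq n
  have h1 := hasLogExpansion_integral (k := fun t : ℝ => kroneckerCoef q n t * t ^ j)
    (by fun_prop)
  have h2 := (hasLogExpansion_kap_mul_pow j).const_mul (if n = 1 then 1 else 0)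
  have h3 := h1.add h2
  rw [zero_add] at h3
  refine h3.congr ?_
  filter_upwards [Ioo_mem_nhdsGT (show (0 : ℝ) < 1 / 2 by norm_num)] with ε hε
  obtain ⟨h0, h1⟩ := hε
  have hi1 : IntervalIntegrable (fun t : ℝ => kroneckerCoef q n t * t ^ j)
    MeasureTheory.volume ε (1 - ε) := Continuous.intervalIntegrable (by fun_prop) _ _
  have hi2 : IntervalIntegrable (fun t : ℝ => kap t * (t : ℂ) ^ j)
      MeasureTheory.volume ε (1 - ε) := by
    have h4 : ContinuousOn (fun t : ℝ => kap t * (t : ℂ) ^ j) (Set.Ioo 0 1) :=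
      continuousOn_kap.mul (by fun_prop)
    refine (h4.mono ?_).intervalIntegrable
    rw [Set.uIcc_of_le (by linarith)]
    exact fun t ht => ⟨h0.trans_le ht.1, ht.2.trans_lt (by linarith)⟩
  rw [← intervalIntegral.integral_const_mul, ← intervalIntegral.integral_add hi1 (hi2.const_mul _)]
  refine intervalIntegral.integral_congr fun t _ => ?_
  ring

theorem one_sub_pow_eq_sum (x : ℝ) (r s : ℕ) : (x : ℂ) ^ r * (1 - x) ^ s =
    ∑ k ∈ Finset.range (s + 1), (-1) ^ k * (s.choose k : ℂ) * x ^ (r + k) := by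
  have : (1 - x : ℂ) ^ s = (-x + 1) ^ s := by ring
  rw [this, add_pow, Finset.mul_sum]
  refine Finset.sum_congr rfl fun k _ => ?_
  rw [one_pow, neg_pow, pow_add]
  ring

/-- Replacing the weight (t-ε)^r (1-ε-t)^s by t^r (1-t)^s changes it by O(ε). Against an integrand
of size 1/t + 1/(1-t) this costs O(ε log(1/ε)), which does not affect the constant term. The power
(1-t)^s is then expanded binomially. -/
theorem exists_hasLogExpansion {q : ℂ} (hq : ‖q‖ < 1) (n r s : ℕ) :
    ∃ c₁ : ℂ, HasLogExpansion (fun ε => ∫ t in ε..(1 - ε),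
        (kroneckerCoef q n t + (if n = 1 then 1 else 0) * kap t) *
          ((t - ε) ^ r * (1 - ε - t) ^ s : ℝ))
      c₁ (∑ k ∈ Finset.range (s + 1), (-1) ^ k * (s.choose k : ℂ) * aCoef q n (r + k)) := by
  set d : ℂ := if n = 1 then 1 else 0 with hd
  have hb := continuous_kroneckerCoef hq n
  set G : ℝ → ℂ := fun t => kroneckerCoef q n t + d * kap t with hG
  have hGc : ContinuousOn G (Set.Ioo 0 1) :=
    hb.continuousOn.add (continuousOn_const.mul continuousOn_kap)
  have h1 := HasLogExpansion.sum (Finset.range (s + 1)) fun k _ =>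
    (hasLogExpansion_monomial hq n (r + k)).const_mul ((-1) ^ k * (s.choose k : ℂ))
  obtain ⟨K, hK, hKb⟩ := exists_norm_le_inv hb d
  have hii : ∀ ε : ℝ, 0 < ε → ε < 1 / 2 → ∀ p : ℝ → ℂ, Continuous p →
      IntervalIntegrable (fun t => G t * p t) MeasureTheory.volume ε (1 - ε) := by
    intro ε h0 h1 p hp
    refine ((hGc.mul hp.continuousOn).mono ?_).intervalIntegrable
    rw [Set.uIcc_of_le (by linarith)]
    exact fun t ht => ⟨h0.trans_le ht.1, ht.2.trans_lt (by linarith)⟩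
  have h2 : (fun ε : ℝ => ∫ t in ε..(1 - ε), G t *
      ((t - ε) ^ r * (1 - ε - t) ^ s - t ^ r * (1 - t) ^ s : ℝ)) =O[𝓝[>] (0 : ℝ)]
      fun ε : ℝ => ε ^ (1 / 2 : ℝ) := by
    refine isBigO_of_norm_le_log (K * (r + s) * 2) (by positivity) fun ε h0 h1 => ?_
    have hle : ε ≤ 1 - ε := by linarith
    obtain ⟨i1, i2⟩ := intervalIntegrable_inv_symm h0 h1
    obtain ⟨v1, v2⟩ := integral_inv_symm h0 h1
    have := intervalIntegral.norm_integral_le_of_norm_le (μ := MeasureTheory.volume)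
      (f := fun t => G t * ((t - ε) ^ r * (1 - ε - t) ^ s - t ^ r * (1 - t) ^ s : ℝ))
      (g := fun t => K * (r + s) * ε * (t⁻¹ + (1 - t)⁻¹)) hle
      (Eventually.of_forall fun t ht => ?_) ((i1.add i2).const_mul _)
    · refine this.trans (le_of_eq ?_)
      rw [intervalIntegral.integral_const_mul, intervalIntegral.integral_add i1 i2, v1, v2]
      ring
    · have ht' : t ∈ Set.Ioo (0 : ℝ) 1 := ⟨h0.trans ht.1, ht.2.trans_lt (by linarith)⟩
      rw [norm_mul, Complex.norm_real, Real.norm_eq_abs]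
      have w := abs_weight_sub_le h0.le ht.1.le ht.2 r s
      calc ‖G t‖ * _ ≤ K * (t⁻¹ + (1 - t)⁻¹) * ((r + s) * ε) :=
            mul_le_mul (hKb t ht') w (abs_nonneg _) ((norm_nonneg _).trans (hKb t ht'))
        _ = _ := by ring
  have h3 : HasLogExpansion (fun ε : ℝ => ∫ t in ε..(1 - ε), G t *
      ((t - ε) ^ r * (1 - ε - t) ^ s - t ^ r * (1 - t) ^ s : ℝ)) 0 0 :=
    IsBigO.congr_left h2 fun ε => by ring
  have h4 := h1.add h3
  rw [add_zero, add_zero] at h4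
  refine ⟨_, h4.congr ?_⟩
  filter_upwards [Ioo_mem_nhdsGT (show (0 : ℝ) < 1 / 2 by norm_num)] with ε hε
  obtain ⟨h0, h1⟩ := hε
  have e1 : ∑ k ∈ Finset.range (s + 1), (-1) ^ k * (s.choose k : ℂ) *
      ∫ t in ε..(1 - ε), G t * t ^ (r + k) = ∫ t in ε..(1 - ε), G t * (t ^ r * (1 - t) ^ s) := by
    simp_rw [← intervalIntegral.integral_const_mul]
    rw [← intervalIntegral.integral_finsetSum fun k _ =>
      (hii ε h0 h1 (fun t => (t : ℂ) ^ (r + k)) (by fun_prop)).const_mul _]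
    refine intervalIntegral.integral_congr fun t _ => ?_
    rw [one_sub_pow_eq_sum, Finset.mul_sum]
    exact Finset.sum_congr rfl fun k _ => by ring
  have e2 : ∫ t in ε..(1 - ε), G t * ((t - ε) ^ r * (1 - ε - t) ^ s : ℝ) =
      (∫ t in ε..(1 - ε), G t * (t ^ r * (1 - t) ^ s)) + ∫ t in ε..(1 - ε), G t *
      ((t - ε) ^ r * (1 - ε - t) ^ s - t ^ r * (1 - t) ^ s : ℝ) := by
    rw [← intervalIntegral.integral_add (hii ε h0 h1 (fun t => (t : ℂ) ^ r * (1 - t) ^ s)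
      (by fun_prop)) (hii ε h0 h1 (fun t => (((t - ε) ^ r * (1 - ε - t) ^ s -
        t ^ r * (1 - t) ^ s : ℝ) : ℂ)) (by fun_prop))]
    refine intervalIntegral.integral_congr fun t _ => ?_
    push_cast
    ring
  exact e2.trans (by rw [← e1])

/-- From here on, depth one values enter only through the numbers `aCoef q n j`, the regularized
moments of the Kronecker coefficients. -/
theorem ellMZV_depth_one (s n r : ℕ) (τ : UpperHalfPlane) :
    ellMZV (List.replicate s 0 ++ n :: List.replicate r 0) τ =
      (2 * Real.pi * I) ^ (r + s) / (r.factorial * s.factorial) *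
        (2 * Real.pi * I / (2 * Real.pi * I) ^ n) *
        ∑ k ∈ Finset.range (s + 1), (-1) ^ k * (s.choose k : ℂ) * aCoef (e τ) n (r + k) := by
  obtain ⟨c₁, h⟩ := exists_hasLogExpansion (norm_e_tau_lt_one τ) n r s
  have h1 := h.const_mul ((2 * Real.pi * I) ^ (r + s) / (r.factorial * s.factorial) *
        (2 * Real.pi * I / (2 * Real.pi * I) ^ n))
  rw [ellMZV]
  refine regularizedValue_eq (HasLogExpansion.isRegularizedValue (h1.congr ?_) (by simp; omega))
  filter_upwards [Ioo_mem_nhdsGT (show (0 : ℝ) < 1 / 2 by norm_num)] with ε hε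
  obtain ⟨h0, h1⟩ := hε
  have hIoo : ∀ t ∈ Set.Icc ε (1 - ε), t ∈ Set.Ioo (0 : ℝ) 1 := fun t ht =>
    ⟨h0.trans_le ht.1, ht.2.trans_lt (by linarith)⟩
  have hω : ∀ t ∈ Set.Icc ε (1 - ε), omega n t τ = 2 * Real.pi * I / (2 * Real.pi * I) ^ n *
      (kroneckerCoef (e τ) n t + (if n = 1 then 1 else 0) * kap t) := fun t ht => by
    rw [omega_ofReal, f_eq τ (e_ofReal_ne_one (hIoo t ht)), ite_mul, one_mul, zero_mul]
  have hcont : ContinuousOn (fun t : ℝ => omega n t τ) (Set.Icc ε (1 - ε)) := by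
    refine ContinuousOn.congr (f := fun t : ℝ => 2 * Real.pi * I / (2 * Real.pi * I) ^ n *
      (kroneckerCoef (e τ) n t + (if n = 1 then 1 else 0) * kap t)) ?_ hω
    have := (continuous_kroneckerCoef (norm_e_tau_lt_one τ) n).continuousOn
      (s := Set.Icc ε (1 - ε))
    exact continuousOn_const.mul (this.add (continuousOn_const.mul (continuousOn_kap.mono hIoo)))
  rw [List.map_append, List.map_cons, List.map_replicate, List.map_replicate,
    iterInt_depth_one (by linarith) (fun t ht => omega_zero_ofReal τ (e_ofReal_ne_one (hIoo t ht)))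
      hcont, mul_assoc ((2 * Real.pi * I) ^ (r + s) / (r.factorial * s.factorial) : ℂ), ← intervalIntegral.integral_const_mul (2 * Real.pi * I / _)]
  congr 1
  refine intervalIntegral.integral_congr fun t ht => ?_
  rw [Set.uIcc_of_le (by linarith)] at ht
  simp only [hω t ht]
  ring

theorem A_eq (n r : ℕ) (τ : UpperHalfPlane) :
    A n (r + 1) τ = (2 * Real.pi * I) ^ r / r.factorial *
      (2 * Real.pi * I / (2 * Real.pi * I) ^ n) * aCoef (e τ) n r := by
  have := ellMZV_depth_one 0 n r τ
  simpa [A] using this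

theorem hasSum_mul_of_summable {ι κ : Type*} {f : ι → ℂ} {g : κ → ℂ} {a b : ℂ} (hf : HasSum f a)
    (hg : HasSum g b) : HasSum (fun p : ι × κ => f p.1 * g p.2) (a * b) := by
  have h := summable_mul_of_summable_norm hf.summable.norm hg.summable.norm
  exact hf.mul hg h

/-! ### The generating series of depth one -/

/-- The exponential generating series of the regularized integrals `rho j`. -/
def rhoGen (y : ℂ) : ℂ := ∑' j : ℕ, rho j * (y ^ j / j.factorial)

theorem summable_norm_rhoGen (y : ℂ) :
    Summable fun j : ℕ => ‖rho j * (y ^ j / j.factorial)‖ := by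
  obtain ⟨K, hK, hb⟩ := exists_norm_rho_le
  refine Summable.of_nonneg_of_le (fun _ => norm_nonneg _) (fun j => ?_)
    ((Real.summable_pow_div_factorial (2 * ‖y‖)).mul_left K)
  have h1 : ((j : ℝ) + 1) ≤ 2 ^ j := by exact_mod_cast Nat.lt_two_pow_self
  rw [norm_mul, norm_div, norm_pow, Complex.norm_natCast, mul_pow]
  calc ‖rho j‖ * (‖y‖ ^ j / j.factorial) ≤ K * (j + 1) * (‖y‖ ^ j / j.factorial) := by
        gcongr; exact hb j
    _ ≤ K * 2 ^ j * (‖y‖ ^ j / j.factorial) := by gcongr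
    _ = _ := by ring

theorem exists_norm_kroneckerB_le {q : ℂ} (hq : ‖q‖ < 1) {R c W r : ℝ} (hR : R ≤ 1) (hr : r < R)
    (h : LambertBound q (Metric.ball 0 R) c W) :
    ∃ C : ℝ, ∀ t : ℝ, ∀ α ∈ Metric.ball (0 : ℂ) r, ‖kroneckerB q t α‖ ≤ C := by
  have hcont : ContinuousOn (fun α => 2 * Real.pi * I * (e α / expSlope α))
      (Metric.closedBall 0 r) := by
    refine continuousOn_const.mul (ContinuousOn.div (by fun_prop) (by fun_prop) fun α hα => ?_)
    rw [mem_closedBall_zero_iff] at hα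
    exact expSlope_ne_zero (by linarith)
  obtain ⟨M, hM⟩ := (isCompact_closedBall (0 : ℂ) r).exists_bound_of_continuousOn hcont
  refine ⟨M + 2 * Real.pi * ∑' m : ℕ, ‖q‖ ^ (m + 1) * (2 * (W / c)), fun t α hα => ?_⟩
  have hα' : α ∈ Metric.ball (0 : ℂ) R := Metric.ball_subset_ball hr.le hα
  have h1 : ‖lambertQ q (e t) (e α)‖ ≤ ∑' m : ℕ, ‖q‖ ^ (m + 1) * (2 * (W / c)) :=
    tsum_of_norm_bounded (summable_pow_succ_mul hq _).hasSum
      fun m => h.norm_term_le hα' (norm_e_ofReal t) m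
  have h2 : ‖2 * Real.pi * I * α‖ ≤ 2 * Real.pi := by
    have h3 : ‖(2 * Real.pi * I : ℂ)‖ = 2 * Real.pi := by simp [abs_of_pos Real.pi_pos]
    rw [norm_mul, h3]
    rw [mem_ball_zero_iff] at hα
    exact mul_le_of_le_one_right (by positivity) (by linarith)
  rw [kroneckerB]
  refine (norm_sub_le _ _).trans (add_le_add (hM α (Metric.ball_subset_closedBall hα)) ?_)
  rw [norm_mul]
  exact mul_le_mul h2 h1 (norm_nonneg _) (by positivity)

theorem hasSum_kroneckerCoef {q : ℂ} (hq : ‖q‖ < 1) {R c W : ℝ} (hR : R ≤ 1)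
    (h : LambertBound q (Metric.ball 0 R) c W) {α : ℂ} (hα : α ∈ Metric.ball (0 : ℂ) R) (t : ℝ) :
    HasSum (fun n : ℕ => kroneckerCoef q n t * α ^ n) (kroneckerB q t α) := by
  have := hasSum_taylorSeries_on_ball (differentiableOn_kroneckerB hq t hR h) hα
  refine hasSum_of_eq this (fun n => ?_) rfl
  rw [kroneckerCoef, sub_zero, smul_eq_mul, smul_eq_mul]
  ring

/-- Cauchy's estimate on a circle of radius r with |α| < r < R, uniform in t, bounds the series by a
geometric one in n times an exponential one in j, so it may be integrated term by term. -/
theorem hasSum_integral_kroneckerCoef {q : ℂ} (hq : ‖q‖ < 1) {R c W : ℝ} (hR : R ≤ 1)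
    (h : LambertBound q (Metric.ball 0 R) c W) {α : ℂ} (hα : α ∈ Metric.ball (0 : ℂ) R) (y : ℂ) :
    HasSum (fun p : ℕ × ℕ => (∫ t in (0 : ℝ)..1, kroneckerCoef q p.1 t * t ^ p.2) *
        (α ^ p.1 * (y ^ p.2 / p.2.factorial)))
      (∫ t in (0 : ℝ)..1, kroneckerB q t α * Complex.exp (y * t)) := by
  have hα1 := mem_ball_zero_iff.1 hα
  obtain ⟨r, hr, hr'⟩ := exists_between hα1
  obtain ⟨r', hr1, hr2⟩ := exists_between hr'
  have hr0 : 0 < r := (norm_nonneg α).trans_lt hr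
  obtain ⟨C, hC⟩ := exists_norm_kroneckerB_le hq hR hr2 h
  have hcoef : ∀ n t, ‖kroneckerCoef q n t‖ ≤ C / r ^ n := fun n t =>
    norm_taylorCoef_le ((differentiableOn_kroneckerB hq t hR h).mono
      (Metric.ball_subset_ball hr2.le)) (hC t) hr0 hr1 n
  have hC0 : 0 ≤ C := by
    have := (norm_nonneg _).trans (hcoef 0 0)
    simpa using this
  have hgeo : Summable fun n : ℕ => C * (‖α‖ / r) ^ n :=
    (summable_geometric_of_lt_one (by positivity) ((div_lt_one hr0).2 hr)).mul_left C
  have hexp := Real.summable_pow_div_factorial ‖y‖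
  have hbound := hgeo.mul_of_nonneg hexp (fun _ => by positivity) (fun _ => by positivity)
  have hle : ∀ p : ℕ × ℕ, ∀ t ∈ Set.Icc (0 : ℝ) 1, ‖kroneckerCoef q p.1 t * t ^ p.2 *
      (α ^ p.1 * (y ^ p.2 / p.2.factorial))‖ ≤
      C * (‖α‖ / r) ^ p.1 * (‖y‖ ^ p.2 / p.2.factorial) := fun p t ht => by
    rw [norm_mul, norm_mul, norm_mul, norm_div, norm_pow, norm_pow, norm_pow, Complex.norm_natCast,
      Complex.norm_real, Real.norm_of_nonneg ht.1, div_pow]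
    calc _ ≤ C / r ^ p.1 * 1 * (‖α‖ ^ p.1 * (‖y‖ ^ p.2 / p.2.factorial)) := by
          have h1 := hcoef p.1 t
          have h2 : t ^ p.2 ≤ 1 := pow_le_one₀ ht.1 ht.2
          have h3 : 0 ≤ t ^ p.2 := pow_nonneg ht.1 _
          gcongr
      _ = _ := by ring
  have hpt : ∀ t : ℝ, HasSum (fun p : ℕ × ℕ => kroneckerCoef q p.1 t * t ^ p.2 *
      (α ^ p.1 * (y ^ p.2 / p.2.factorial))) (kroneckerB q t α * Complex.exp (y * t)) := fun t => by
    have h1 := hasSum_kroneckerCoef hq hR h hα t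
    have h2 : HasSum (fun j : ℕ => (y * t) ^ j / j.factorial) (Complex.exp (y * t)) := by
      rw [Complex.exp_eq_exp_ℂ]
      exact NormedSpace.expSeries_div_hasSum_exp _
    refine hasSum_of_eq (hasSum_mul_of_summable h1 h2) (fun p => ?_) rfl
    rw [mul_pow]; ring
  have key := hasSum_intervalIntegral (fun p : ℕ × ℕ => ?_) hbound hle
  · refine hasSum_of_eq key (fun p => ?_) ?_
    · rw [intervalIntegral.integral_mul_const]
    · exact intervalIntegral.integral_congr fun t _ => ((hpt t).tsum_eq).symm
  · have := continuous_kroneckerCoef hq p.1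
    fun_prop

/-- The generating series of the regularized integrals `aCoef`. -/
theorem hasSum_aCoef {q : ℂ} (hq : ‖q‖ < 1) {R c W : ℝ} (hR : R ≤ 1)
    (h : LambertBound q (Metric.ball 0 R) c W) {α : ℂ} (hα : α ∈ Metric.ball (0 : ℂ) R)
    (hα0 : α ≠ 0) (y : ℂ) :
    HasSum (fun p : ℕ × ℕ => aCoef q p.1 p.2 * α ^ ((p.1 : ℤ) - 1) * (y ^ p.2 / p.2.factorial))
      (rhoGen y + ∫ t in (0 : ℝ)..1, kroneckerB q t α / α * Complex.exp (y * t)) := by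
  have h1 := (hasSum_integral_kroneckerCoef hq hR h hα y).div_const α
  have h2 : HasSum (fun n : ℕ => if n = 1 then (1 : ℂ) else 0) 1 := hasSum_ite_eq 1 1
  have h3 := hasSum_mul_of_summable h2 (summable_norm_rhoGen y).of_norm.hasSum
  rw [one_mul] at h3
  refine hasSum_of_eq (h3.add h1) (fun p => ?_) ?_
  · have hz : α ^ ((p.1 : ℤ) - 1) = α ^ p.1 / α := by
      rw [zpow_sub_one₀ hα0, zpow_natCast, div_eq_mul_inv]
    rw [aCoef, hz]
    by_cases hp : p.1 = 1
    · rw [hp]; simp only [if_true, pow_one]; field_simp; ring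
    · simp only [hp, if_false]; ring
  · rw [rhoGen, ← intervalIntegral.integral_div]
    congr 1
    exact intervalIntegral.integral_congr fun t _ => by ring

/-- The series `∑_{m ≥ 1} (u^m q^m w / ((1 - q^m w) (m - β)) + u^(-m) q^m w⁻¹ / ((1 - q^m w⁻¹) (m + β)))`. -/
def lambertT (q u w β : ℂ) : ℂ :=
  ∑' m : ℕ, (u ^ (m + 1) * lambert q w (m + 1) * ((m : ℂ) + 1 - β)⁻¹ +
    u⁻¹ ^ (m + 1) * lambert q w⁻¹ (m + 1) * ((m : ℂ) + 1 + β)⁻¹)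

theorem one_sub_norm_le (m : ℕ) (β : ℂ) :
    1 - ‖β‖ ≤ ‖(m : ℂ) + 1 - β‖ ∧ 1 - ‖β‖ ≤ ‖(m : ℂ) + 1 + β‖ := by
  have h0 : ‖(m : ℂ) + 1‖ = m + 1 := by
    have := Complex.norm_natCast (m + 1)
    push_cast at this
    exact this
  have h1 := norm_sub_norm_le ((m : ℂ) + 1) β
  have h2 := norm_sub_norm_le ((m : ℂ) + 1) (-β)
  rw [norm_neg, sub_neg_eq_add] at h2
  have hm : (0 : ℝ) ≤ m := m.cast_nonneg
  constructor <;> linarith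

theorem norm_inv_add_le {β : ℂ} (hβ : ‖β‖ < 1) (m : ℕ) :
    ‖((m : ℂ) + 1 - β)⁻¹‖ ≤ (1 - ‖β‖)⁻¹ ∧ ‖((m : ℂ) + 1 + β)⁻¹‖ ≤ (1 - ‖β‖)⁻¹ := by
  obtain ⟨h1, h2⟩ := one_sub_norm_le m β
  have : 0 < 1 - ‖β‖ := by linarith
  rw [norm_inv, norm_inv]
  exact ⟨inv_anti₀ this h1, inv_anti₀ this h2⟩

/-- The link between the two theories: as e(±m) = 1, the integral of e((±m - β)t) over [0,1] is
(e(-β) - 1)/(2πi(±m - β)). The resulting denominators m ∓ β are those of the Debye series, so the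
average of polylogarithms leads to the same `lambertT` at u = 1. -/
theorem integral_lambertQ {q : ℂ} (hq : ‖q‖ < 1) {U : Set ℂ} {c W : ℝ} (h : LambertBound q U c W)
    {α : ℂ} (hα : α ∈ U) {β : ℂ} (hβ : ‖β‖ < 1) :
    ∫ t in (0 : ℝ)..1, lambertQ q (e t) (e α) * e (-β * t) =
      (e (-β) - 1) / (2 * Real.pi * I) * lambertT q 1 (e α) β := by
  have hπ := two_pi_I_ne_zero
  obtain ⟨M, hM⟩ := isCompact_Icc.exists_bound_of_continuousOn (s := Set.Icc (0 : ℝ) 1)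
    (f := fun t : ℝ => e (-β * t)) (Continuous.continuousOn (by fun_prop))
  have hM0 : 0 ≤ M := (norm_nonneg _).trans (hM 0 (by simp))
  have hc : Continuous fun t : ℝ => (e t)⁻¹ :=
    (continuous_e.comp Complex.continuous_ofReal).inv₀ fun s => e_ne_zero _
  have key := hasSum_intervalIntegral (F := fun (m : ℕ) (t : ℝ) =>
      (e t ^ (m + 1) * lambert q (e α) (m + 1) - (e t)⁻¹ ^ (m + 1) * lambert q (e α)⁻¹ (m + 1)) *
        e (-β * t)) (fun m => by fun_prop)
    (summable_pow_succ_mul hq (2 * (W / c) * M)) (fun m t ht => by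
      rw [norm_mul, ← mul_assoc]
      exact mul_le_mul (h.norm_term_le hα (norm_e_ofReal t) m) (hM t ht) (norm_nonneg _)
        ((norm_nonneg _).trans (h.norm_term_le hα (norm_e_ofReal t) m)))
  simp_rw [tsum_mul_right] at key
  change HasSum _ (∫ t in (0 : ℝ)..1, lambertQ q (e t) (e α) * e (-β * t)) at key
  rw [← key.tsum_eq, lambertT, ← tsum_mul_left]
  refine tsum_congr fun m => ?_
  obtain ⟨n1, n2⟩ := one_sub_norm_le m β
  have k1 : (m : ℂ) + 1 - β ≠ 0 := norm_pos_iff.1 (by linarith)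
  have k2 : (m : ℂ) + 1 + β ≠ 0 := norm_pos_iff.1 (by linarith)
  have k2' : -((m : ℂ) + 1 + β) ≠ 0 := neg_ne_zero.2 k2
  have hper : ∀ k : ℤ, e (k - β) = e (-β) := fun k => by
    rw [sub_eq_add_neg, e_add, e_int, one_mul]
  have i1 := integral_e_mul k1
  have i2 := integral_e_mul k2'
  have p1 := hper (m + 1)
  have p2 := hper (-(m + 1))
  push_cast at p1 p2
  rw [p1] at i1
  rw [show -((m : ℂ) + 1 + β) = -((m : ℂ) + 1) - β by ring] at i2 k2'
  rw [p2] at i2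
  have e1 : ∀ t : ℝ, (e t ^ (m + 1) * lambert q (e α) (m + 1) -
      (e t)⁻¹ ^ (m + 1) * lambert q (e α)⁻¹ (m + 1)) * e (-β * t) =
      lambert q (e α) (m + 1) * e (((m : ℂ) + 1 - β) * t) -
      lambert q (e α)⁻¹ (m + 1) * e ((-((m : ℂ) + 1) - β) * t) := fun t => by
    have a1 : e (((m : ℂ) + 1 - β) * t) = e t ^ (m + 1) * e (-β * t) := by
      rw [← e_nat_mul, ← e_add]; congr 1; push_cast; ring
    have a2 : e ((-((m : ℂ) + 1) - β) * t) = (e t)⁻¹ ^ (m + 1) * e (-β * t) := by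
      rw [← e_neg, ← e_nat_mul, ← e_add]; congr 1; push_cast; ring
    rw [a1, a2]; ring
  simp_rw [e1]
  rw [intervalIntegral.integral_sub (Continuous.intervalIntegrable (by fun_prop) _ _)
    (Continuous.intervalIntegrable (by fun_prop) _ _), intervalIntegral.integral_const_mul,
    intervalIntegral.integral_const_mul, i1, i2, inv_one, one_pow, one_mul, one_mul,
    show -((m : ℂ) + 1) - β = -((m : ℂ) + 1 + β) by ring]
  rw [mul_neg, div_neg]
  field_simp
  ring

theorem hasSum_aCoef_eq {q : ℂ} (hq : ‖q‖ < 1) {R c W : ℝ} (hR : R ≤ 1)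
    (h : LambertBound q (Metric.ball 0 R) c W) {α : ℂ} (hα : α ∈ Metric.ball (0 : ℂ) R)
    (hα0 : α ≠ 0) {β : ℂ} (hβ : ‖β‖ < 1) (hβ0 : β ≠ 0) :
    HasSum (fun p : ℕ × ℕ => aCoef q p.1 p.2 * α ^ ((p.1 : ℤ) - 1) *
        ((-(2 * Real.pi * I * β)) ^ p.2 / p.2.factorial))
      (rhoGen (-(2 * Real.pi * I * β)) +
        (e (-β) - 1) * (e α / ((1 - e α) * β) - lambertT q 1 (e α) β)) := by
  have hπ := two_pi_I_ne_zero
  have hα1 : e α ≠ 1 := e_ne_one (by rw [mem_ball_zero_iff] at hα; linarith) hα0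
  have hes : expSlope α ≠ 0 := expSlope_ne_zero (by rw [mem_ball_zero_iff] at hα; linarith)
  refine hasSum_of_eq (hasSum_aCoef hq hR h hα hα0 (-(2 * Real.pi * I * β))) (fun _ => rfl) ?_
  congr 1
  have h1 : ∀ t : ℝ, kroneckerB q t α / α * Complex.exp (-(2 * Real.pi * I * β) * t) =
      2 * Real.pi * I * (e α / (e α - 1)) * e (-β * t) -
        2 * Real.pi * I * (lambertQ q (e t) (e α) * e (-β * t)) := fun t => by
    have a1 : Complex.exp (-(2 * Real.pi * I * β) * t) = e (-β * t) := by
      rw [e]; congr 1; ring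
    rw [a1, kroneckerB, ← mul_expSlope]
    field_simp
  have hQc : Continuous fun t : ℝ => lambertQ q (e t) (e α) := by
    have hc : Continuous fun t : ℝ => (e t)⁻¹ :=
      (continuous_e.comp Complex.continuous_ofReal).inv₀ fun s => e_ne_zero _
    exact continuous_tsum (fun m => by fun_prop) (summable_pow_succ_mul hq (2 * (W / c)))
      fun m t => h.norm_term_le hα (norm_e_ofReal t) m
  simp_rw [h1]
  rw [intervalIntegral.integral_sub (Continuous.intervalIntegrable (by fun_prop) _ _)
    (Continuous.intervalIntegrable (by fun_prop) _ _), intervalIntegral.integral_const_mul,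
    intervalIntegral.integral_const_mul, integral_lambertQ hq h hα hβ,
    integral_e_mul (neg_ne_zero.2 hβ0)]
  have k1 : e α - 1 ≠ 0 := sub_ne_zero.2 hα1
  have k2 : 1 - e α = -(e α - 1) := by ring
  rw [k2]
  generalize lambertT q 1 (e α) β = T
  field_simp

/-! ### The limit at the cusp -/

theorem lambertQ_zero (u w : ℂ) : lambertQ 0 u w = 0 := by simp [lambertQ, lambert]

/-- Uniformity in q is needed for q → 0. With |q| ≤ 1/4 and |e(±α)| < 2, all products q^m e(±α), m ≥
1, have norm at most 1/2. -/
theorem exists_lambertBound_uniform :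
    ∃ R : ℝ, 0 < R ∧ R < 1 ∧ ∀ q : ℂ, ‖q‖ ≤ 1 / 4 →
      LambertBound q (Metric.ball 0 R) (1 / 2) 2 := by
  have h1 : ∀ᶠ α in 𝓝 (0 : ℂ), ‖e α‖ < 2 :=
    continuous_e.norm.continuousAt.eventually_lt continuousAt_const (by simp [e_zero])
  have h2 : ∀ᶠ α in 𝓝 (0 : ℂ), ‖(e α)⁻¹‖ < 2 :=
    (continuous_e.inv₀ e_ne_zero).norm.continuousAt.eventually_lt continuousAt_const
      (by simp [e_zero])
  obtain ⟨ε, hε, hb⟩ := Metric.eventually_nhds_iff_ball.1 (h1.and h2)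
  refine ⟨min ε (1 / 2), by positivity, by
    have := min_le_right ε (1 / 2); linarith, fun q hq => ⟨by norm_num, fun α hα => ?_⟩⟩
  obtain ⟨b1, b2⟩ := hb α (Metric.ball_subset_ball (min_le_left _ _) hα)
  have key : ∀ w : ℂ, ‖w‖ < 2 → ∀ m : ℕ, 1 / 2 ≤ ‖1 - q ^ (m + 1) * w‖ := fun w hw m => by
    have := one_sub_le_norm (q := q) (w := w) (by linarith) m
    have h3 : ‖q * w‖ ≤ 1 / 4 * 2 := by
      rw [norm_mul]; exact mul_le_mul hq hw.le (norm_nonneg _) (by norm_num)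
    linarith
  exact ⟨b1.le, b2.le, fun m => ⟨key _ b1 m, key _ b2 m⟩⟩

theorem exists_norm_kroneckerCoef_sub_le (n : ℕ) :
    ∃ K : ℝ, ∀ q : ℂ, ‖q‖ ≤ 1 / 4 → ∀ t : ℝ,
      ‖kroneckerCoef q n t - kroneckerCoef 0 n t‖ ≤ K * ‖q‖ := by
  obtain ⟨R, hR, hR1, hb⟩ := exists_lambertBound_uniform
  refine ⟨2 * Real.pi * 16 / (R / 2) ^ n, fun q hq t => ?_⟩
  have hq1 : ‖q‖ < 1 := by linarith
  have d1 := differentiableOn_kroneckerB hq1 t hR1.le (hb q hq)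
  have d2 := differentiableOn_kroneckerB (q := 0) (by simp) t hR1.le (hb 0 (by simp))
  have hC : ∀ z ∈ Metric.ball (0 : ℂ) R, ‖(kroneckerB q t - kroneckerB 0 t) z‖ ≤
      2 * Real.pi * 16 * ‖q‖ := fun z hz => by
    have h1 : ‖lambertQ q (e t) (e z)‖ ≤ ∑' m : ℕ, ‖q‖ ^ (m + 1) * (2 * (2 / (1 / 2))) :=
      tsum_of_norm_bounded (summable_pow_succ_mul hq1 _).hasSum
        fun m => (hb q hq).norm_term_le hz (norm_e_ofReal t) m
    have h2 : ∑' m : ℕ, ‖q‖ ^ (m + 1) * (2 * (2 / (1 / 2)) : ℝ) ≤ 16 * ‖q‖ := by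
      rw [tsum_mul_right]
      simp_rw [pow_succ]
      rw [tsum_mul_right, tsum_geometric_of_lt_one (norm_nonneg q) hq1]
      have h3 : (1 - ‖q‖)⁻¹ ≤ 2 := by
        rw [inv_le_comm₀ (by linarith) (by norm_num)]; linarith
      have := norm_nonneg q
      nlinarith
    have h3 : (kroneckerB q t - kroneckerB 0 t) z =
        -(2 * Real.pi * I) * z * lambertQ q (e t) (e z) := by
      rw [Pi.sub_apply, kroneckerB, kroneckerB, lambertQ_zero]; ring
    have h4 : ‖-(2 * Real.pi * I) * z‖ ≤ 2 * Real.pi := by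
      have h5 : ‖-(2 * Real.pi * I : ℂ)‖ = 2 * Real.pi := by simp [abs_of_pos Real.pi_pos]
      rw [norm_mul, h5]
      rw [mem_ball_zero_iff] at hz
      exact mul_le_of_le_one_right (by positivity) (by linarith)
    rw [h3, norm_mul, mul_assoc (2 * Real.pi)]
    exact mul_le_mul h4 (h1.trans h2) (norm_nonneg _) (by positivity)
  rw [kroneckerCoef, kroneckerCoef, taylorCoef_sub hR d1 d2]
  refine (norm_taylorCoef_le (d1.sub d2) hC (by positivity : 0 < R / 2) (by linarith) n).trans
    (le_of_eq (by ring))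

/-- Only the Lambert series depends on q. It vanishes at q = 0 and is O(|q|) uniformly in t and in
small α, so the moments are O(|q|) close to those for q = 0, while the `rho` part cancels in the
difference. -/
theorem tendsto_aCoef (n j : ℕ) : Tendsto (fun q => aCoef q n j) (𝓝 0) (𝓝 (aCoef 0 n j)) := by
  obtain ⟨K, hK⟩ := exists_norm_kroneckerCoef_sub_le n
  rw [tendsto_iff_norm_sub_tendsto_zero]
  have h0 : Tendsto (fun q : ℂ => K * ‖q‖) (𝓝 0) (𝓝 0) := by
    have : Continuous fun q : ℂ => K * ‖q‖ := by fun_prop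
    simpa using this.tendsto 0
  refine squeeze_zero' (Eventually.of_forall fun _ => norm_nonneg _) ?_ h0
  have hq : ∀ᶠ q : ℂ in 𝓝 0, ‖q‖ < 1 / 4 :=
    continuous_norm.continuousAt.eventually_lt continuousAt_const (by simp)
  filter_upwards [hq] with q hq
  have c1 := continuous_kroneckerCoef (q := q) (by linarith) n
  have c2 := continuous_kroneckerCoef (q := 0) (by simp) n
  have h1 : aCoef q n j - aCoef 0 n j =
      ∫ t in (0 : ℝ)..1, (kroneckerCoef q n t - kroneckerCoef 0 n t) * t ^ j := by
    rw [aCoef, aCoef, add_sub_add_right_eq_sub, ← intervalIntegral.integral_sub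
      (Continuous.intervalIntegrable (by fun_prop) _ _)
      (Continuous.intervalIntegrable (by fun_prop) _ _)]
    exact intervalIntegral.integral_congr fun t _ => by ring
  rw [h1]
  have h2 := intervalIntegral.norm_integral_le_of_norm_le_const (a := (0 : ℝ)) (b := 1)
    (f := fun t : ℝ => (kroneckerCoef q n t - kroneckerCoef 0 n t) * t ^ j) (C := K * ‖q‖)
    fun t ht => by
      rw [Set.uIoc_of_le zero_le_one] at ht
      rw [norm_mul, norm_pow, Complex.norm_real, Real.norm_of_nonneg ht.1.le]
      exact (mul_le_of_le_one_right (norm_nonneg _) (pow_le_one₀ ht.1.le ht.2)).trans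
        (hK q hq.le t)
  simpa using h2

theorem tendsto_e_atImInfty : Tendsto (fun τ : UpperHalfPlane => e τ) atImInfty (𝓝 0) := by
  rw [tendsto_zero_iff_norm_tendsto_zero]
  have h1 : Tendsto (fun τ : UpperHalfPlane => 2 * Real.pi * τ.im) atImInfty atTop :=
    (tendsto_comap (f := UpperHalfPlane.im)).const_mul_atTop (by positivity)
  refine (Real.tendsto_exp_neg_atTop_nhds_zero.comp h1).congr fun τ => ?_
  rw [norm_e]; rfl

theorem tendsto_A (n r : ℕ) : Tendsto (A n (r + 1)) atImInfty
    (𝓝 ((2 * Real.pi * I) ^ r / r.factorial *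
      (2 * Real.pi * I / (2 * Real.pi * I) ^ n) * aCoef 0 n r)) := by
  rw [show A n (r + 1) = _ from funext (A_eq n r)]
  exact ((tendsto_aCoef n r).comp tendsto_e_atImInfty).const_mul _

theorem neBot_atImInfty : atImInfty.NeBot := by
  refine Filter.comap_neBot fun t ht => ?_
  obtain ⟨a, ha⟩ := mem_atTop_sets.1 ht
  have hp : 0 < max a 1 := lt_max_of_lt_right one_pos
  refine ⟨⟨(max a 1 : ℝ) * I, by simp [hp]⟩, ha _ ?_⟩
  change a ≤ ((max a 1 : ℝ) * I : ℂ).im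
  simp

theorem AInf_eq (n r : ℕ) : AInf n (r + 1) = (2 * Real.pi * I) ^ r / r.factorial *
      (2 * Real.pi * I / (2 * Real.pi * I) ^ n) * aCoef 0 n r := by
  have := neBot_atImInfty
  exact (tendsto_A n r).limUnder_eq

theorem tendsto_A_AInf (n r : ℕ) (hr : 1 ≤ r) : Tendsto (A n r) atImInfty (𝓝 (AInf n r)) := by
  obtain ⟨r, rfl⟩ := Nat.exists_eq_add_of_le' hr
  rw [AInf_eq]
  exact tendsto_A n r

/-! ### The generating series in terms of Lambert series -/

theorem genTerm_of_aCoef {a : ℕ → ℕ → ℂ} {q : ℂ}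
    (ha : ∀ n r, a n (r + 1) = (2 * Real.pi * I) ^ r / r.factorial *
      (2 * Real.pi * I / (2 * Real.pi * I) ^ n) * aCoef q n r) (α y : ℂ) (p : ℕ × ℕ) :
    genTerm a (2 * Real.pi * I * α) y p =
      aCoef q p.1 p.2 * α ^ ((p.1 : ℤ) - 1) * (y ^ p.2 / p.2.factorial) := by
  obtain ⟨c, hc⟩ : ∃ c : ℂ, c = 2 * Real.pi * I := ⟨_, rfl⟩
  have h0 : c ≠ 0 := hc ▸ two_pi_I_ne_zero
  rw [genTerm, ha, ← hc, mul_zpow]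
  have h1 : c ^ ((p.1 : ℤ) - 1) = c ^ p.1 / c := by
    rw [zpow_sub_one₀ h0, zpow_natCast, div_eq_mul_inv]
  have h2 : c ^ p.1 ≠ 0 := pow_ne_zero _ h0
  have h3 : c ^ p.2 ≠ 0 := pow_ne_zero _ h0
  rw [h1]
  field_simp

/-- The value of the generating series of depth one. -/
def genValue (q w β : ℂ) : ℂ :=
  rhoGen (-(2 * Real.pi * I * β)) + (e (-β) - 1) * (w / ((1 - w) * β) - lambertT q 1 w β)

/-- A denominator 1 - q^m e(±α), m ≥ 1, vanishes only if α is a nonzero point of the lattice ℤτ + ℤ.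
The lattice point 1 gives |α| < 1. -/
theorem exists_lambertBound_lattice (τ : UpperHalfPlane) {α : ℂ}
    (hα : ∀ m n : ℤ, (m, n) ≠ (0, 0) → ‖α‖ < ‖(m : ℂ) * τ + n‖) :
    ∃ R : ℝ, ‖α‖ < R ∧ R < 1 ∧ ∃ c W : ℝ, LambertBound (e τ) (Metric.ball 0 R) c W := by
  have h1 : ‖α‖ < 1 := by simpa using hα 0 1 (by simp)
  refine exists_lambertBound_ball (norm_e_tau_lt_one τ) (norm_nonneg α) h1 fun z hz m => ?_
  rw [mem_closedBall_zero_iff] at hz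
  have key : ∀ z : ℂ, ‖z‖ ≤ ‖α‖ → e τ ^ (m + 1) * e z ≠ 1 := fun z hz h => by
    rw [← e_nat_mul, ← e_add] at h
    obtain ⟨k, hk⟩ := e_eq_one_iff.1 h
    have h2 := hα (m + 1) (-k) (by
      intro h3
      have := congrArg Prod.fst h3
      simp only at this
      omega)
    have h3 : z = -((((m + 1 : ℤ)) : ℂ) * τ + ((-k : ℤ) : ℂ)) := by
      push_cast at hk ⊢
      linear_combination hk
    rw [h3, norm_neg] at hz
    linarith
  refine ⟨key z hz, ?_⟩
  rw [← e_neg]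
  exact key (-z) (by rwa [norm_neg])

theorem hasSum_genTerm_A (τ : UpperHalfPlane) {α β : ℂ} (hα0 : α ≠ 0)
    (hα : ∀ m n : ℤ, (m, n) ≠ (0, 0) → ‖α‖ < ‖(m : ℂ) * τ + n‖) (hβ : ‖β‖ < 1) (hβ0 : β ≠ 0) :
    HasSum (genTerm (fun n r => A n r τ) (2 * Real.pi * I * α) (-(2 * Real.pi * I * β)))
      (genValue (e τ) (e α) β) := by
  obtain ⟨R, hR, hR1, c, W, hb⟩ := exists_lambertBound_lattice τ hα
  exact hasSum_of_eq (hasSum_aCoef_eq (norm_e_tau_lt_one τ) hR1.le hb (mem_ball_zero_iff.2 hR) hα0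
    hβ hβ0) (fun p => genTerm_of_aCoef (fun n r => A_eq n r τ) _ _ p) rfl

theorem hasSum_genTerm_AInf {α β : ℂ} (hα0 : α ≠ 0) (hα : ‖α‖ < 1) (hβ : ‖β‖ < 1) (hβ0 : β ≠ 0) :
    HasSum (genTerm AInf (2 * Real.pi * I * α) (-(2 * Real.pi * I * β)))
      (genValue 0 (e α) β) := by
  obtain ⟨R, hR, hR1, c, W, hb⟩ := exists_lambertBound_ball (q := 0) (by simp)
    (norm_nonneg α) hα fun z _ m => by simp
  exact hasSum_of_eq (hasSum_aCoef_eq (by simp) hR1.le hb (mem_ball_zero_iff.2 hR) hα0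
    hβ hβ0) (fun p => genTerm_of_aCoef AInf_eq _ _ p) rfl

theorem lambertT_zero (u w β : ℂ) : lambertT 0 u w β = 0 := by simp [lambertT, lambert]

/-! ### Polylogarithms on the slit plane -/

/-- The plane without the real half-lines `(-∞,0]` and `[1,∞)`. -/
def slitDomain : Set ℂ := {ξ | ξ.im ≠ 0 ∨ (0 < ξ.re ∧ ξ.re < 1)}

theorem isOpen_slitDomain : IsOpen slitDomain :=
  (isOpen_ne_fun Complex.continuous_im continuous_const).union
    ((isOpen_lt continuous_const Complex.continuous_re).inter
      (isOpen_lt Complex.continuous_re continuous_const))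

/-- The slit domain is star-shaped about 1/2, which is why the polylogarithms are integrated along
segments from 1/2. -/
theorem segment_mem_slitDomain {ξ : ℂ} (hξ : ξ ∈ slitDomain) {t : ℝ} (ht : t ∈ Set.Icc (0 : ℝ) 1) :
    (1 / 2 + t * (ξ - 1 / 2) : ℂ) ∈ slitDomain := by
  have him : (1 / 2 + t * (ξ - 1 / 2) : ℂ).im = t * ξ.im := by simp
  have hre : (1 / 2 + t * (ξ - 1 / 2) : ℂ).re = 1 / 2 + t * (ξ.re - 1 / 2) := by simp
  rw [slitDomain, Set.mem_ofPred_eq, him, hre]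
  obtain ⟨h0, h1⟩ := ht
  rcases hξ with h | ⟨h2, h3⟩
  · rcases h0.eq_or_lt with h0 | h0
    · right; rw [← h0]; norm_num
    · left; exact mul_ne_zero h0.ne' h
  · right
    constructor <;> nlinarith

theorem exists_compact_cone {ξ₀ : ℂ} (hξ₀ : ξ₀ ∈ slitDomain) :
    ∃ r > 0, Metric.closedBall ξ₀ r ⊆ slitDomain ∧
      ∃ K, IsCompact K ∧ K ⊆ slitDomain ∧ ∀ ξ ∈ Metric.closedBall ξ₀ r, ∀ t ∈ Set.Icc (0 : ℝ) 1,
        (1 / 2 + t * (ξ - 1 / 2) : ℂ) ∈ K := by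
  obtain ⟨r, hr, hb⟩ := Metric.nhds_basis_closedBall.mem_iff.1 (isOpen_slitDomain.mem_nhds hξ₀)
  refine ⟨r, hr, hb, (fun p : ℂ × ℝ => (1 / 2 + p.2 * (p.1 - 1 / 2) : ℂ)) ''
    (Metric.closedBall ξ₀ r ×ˢ Set.Icc 0 1), ?_, ?_, ?_⟩
  · exact ((isCompact_closedBall _ _).prod isCompact_Icc).image (by fun_prop)
  · rintro _ ⟨⟨ξ, t⟩, ⟨h1, h2⟩, rfl⟩
    exact segment_mem_slitDomain (hb h1) h2
  · exact fun ξ hξ t ht => ⟨(ξ, t), ⟨hξ, ht⟩, rfl⟩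

/-- Primitives along segments from `1/2` on the slit domain. -/
theorem hasDerivAt_segment_integral {f : ℂ → ℂ} (hf : DifferentiableOn ℂ f slitDomain) {ξ₀ : ℂ}
    (hξ₀ : ξ₀ ∈ slitDomain) :
    HasDerivAt (fun ξ : ℂ => (ξ - 1 / 2) * ∫ t in (0 : ℝ)..1, f (1 / 2 + t * (ξ - 1 / 2)))
      (f ξ₀) ξ₀ := by
  obtain ⟨r, hr, hrD, K, hK, hKD, hcone⟩ := exists_compact_cone hξ₀
  have hf' : DifferentiableOn ℂ (deriv f) slitDomain := hf.deriv isOpen_slitDomain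
  obtain ⟨M, hM⟩ := hK.exists_bound_of_continuousOn (hf'.continuousOn.mono hKD)
  have hM0 : 0 ≤ M := (norm_nonneg _).trans
    (hM _ (hcone ξ₀ (Metric.mem_closedBall_self hr.le) 0 (by simp)))
  have hsub : ∀ t ∈ Set.uIoc (0 : ℝ) 1, t ∈ Set.Icc (0 : ℝ) 1 := fun t ht => by
    rw [Set.uIoc_of_le zero_le_one] at ht; exact ⟨ht.1.le, ht.2⟩
  have hcomp : ∀ g : ℂ → ℂ, ContinuousOn g slitDomain → ∀ ξ ∈ Metric.ball ξ₀ r,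
      ContinuousOn (fun t : ℝ => g (1 / 2 + t * (ξ - 1 / 2))) (Set.Icc 0 1) := fun g hg ξ hξ =>
    hg.comp (Continuous.continuousOn (by fun_prop)) fun t ht =>
      segment_mem_slitDomain (hrD (Metric.ball_subset_closedBall hξ)) ht
  have hint : ∀ g : ℂ → ℂ, ContinuousOn g slitDomain → ∀ ξ ∈ Metric.ball ξ₀ r,
      IntervalIntegrable (fun t : ℝ => g (1 / 2 + t * (ξ - 1 / 2))) MeasureTheory.volume 0 1 :=
    fun g hg ξ hξ => by
      refine ContinuousOn.intervalIntegrable ?_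
      rw [Set.uIcc_of_le zero_le_one]
      exact hcomp g hg ξ hξ
  have hmem := Metric.mem_ball_self (x := ξ₀) hr
  have hd : ∀ t ∈ Set.Icc (0 : ℝ) 1, ∀ ξ ∈ Metric.ball ξ₀ r,
      HasDerivAt f (deriv f (1 / 2 + t * (ξ - 1 / 2))) (1 / 2 + t * (ξ - 1 / 2)) :=
    fun t ht ξ hξ => (hf.differentiableAt (isOpen_slitDomain.mem_nhds
      (segment_mem_slitDomain (hrD (Metric.ball_subset_closedBall hξ)) ht))).hasDerivAt
  have hint' : IntervalIntegrable (fun t : ℝ => (t : ℂ) * deriv f (1 / 2 + t * (ξ₀ - 1 / 2)))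
      MeasureTheory.volume 0 1 := by
    refine ContinuousOn.intervalIntegrable ?_
    rw [Set.uIcc_of_le zero_le_one]
    exact (Continuous.continuousOn (by fun_prop)).mul (hcomp _ hf'.continuousOn ξ₀ hmem)
  have h1 := (intervalIntegral.hasDerivAt_integral_of_dominated_loc_of_deriv_le
    (F := fun (ξ : ℂ) (t : ℝ) => f (1 / 2 + t * (ξ - 1 / 2)))
    (F' := fun (ξ : ℂ) (t : ℝ) => (t : ℂ) * deriv f (1 / 2 + t * (ξ - 1 / 2)))
    (bound := fun _ => M) (μ := MeasureTheory.volume) (a := 0) (b := 1)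
    (Metric.ball_mem_nhds ξ₀ hr) ?_ (hint f hf.continuousOn ξ₀ hmem)
    (intervalIntegrable_iff.1 hint').aestronglyMeasurable ?_ intervalIntegrable_const ?_).2
  · have h2 := ((hasDerivAt_id ξ₀).sub_const (1 / 2 : ℂ)).mul h1
    refine h2.congr_deriv ?_
    -- After differentiation under the integral sign the integrand is the t-derivative of t f(1/2 +
    -- t(ξ₀ - 1/2)), so its integral over [0,1] is f(ξ₀).
    have h3 : ∀ t ∈ Set.uIcc (0 : ℝ) 1, HasDerivAt
        (fun t : ℝ => (t : ℂ) * f (1 / 2 + t * (ξ₀ - 1 / 2)))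
        (f (1 / 2 + t * (ξ₀ - 1 / 2)) +
          (ξ₀ - 1 / 2) * ((t : ℂ) * deriv f (1 / 2 + t * (ξ₀ - 1 / 2)))) t := fun t ht => by
      rw [Set.uIcc_of_le zero_le_one] at ht
      have a1 : HasDerivAt (fun t : ℝ => (t : ℂ)) 1 t := Complex.ofRealCLM.hasDerivAt
      have a2 : HasDerivAt (fun t : ℝ => (1 / 2 + t * (ξ₀ - 1 / 2) : ℂ)) (1 * (ξ₀ - 1 / 2)) t :=
        (a1.mul_const _).const_add _
      refine (a1.mul ((hd t ht ξ₀ hmem).comp t a2)).congr_deriv ?_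
      simp only [Function.comp]
      ring
    have h4 := intervalIntegral.integral_eq_sub_of_hasDerivAt h3
      ((hint f hf.continuousOn ξ₀ hmem).add (hint'.const_mul _))
    rw [intervalIntegral.integral_add (hint f hf.continuousOn ξ₀ hmem) (hint'.const_mul _),
      intervalIntegral.integral_const_mul] at h4
    simp only [id, one_mul]
    rw [h4]
    simp
  · filter_upwards [Metric.ball_mem_nhds ξ₀ hr] with ξ hξ
    exact (intervalIntegrable_iff.1 (hint f hf.continuousOn ξ hξ)).aestronglyMeasurable
  · refine Eventually.of_forall fun t ht ξ hξ => ?_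
    have ht' := hsub t ht
    rw [norm_mul, Complex.norm_real, Real.norm_of_nonneg ht'.1]
    have := hM _ (hcone ξ (Metric.ball_subset_closedBall hξ) t ht')
    calc _ ≤ 1 * M := mul_le_mul ht'.2 this (norm_nonneg _) zero_le_one
      _ = M := one_mul M
  · refine Eventually.of_forall fun t ht ξ hξ => ?_
    have a2 : HasDerivAt (fun ξ : ℂ => (1 / 2 + t * (ξ - 1 / 2) : ℂ)) (t * 1) ξ :=
      (((hasDerivAt_id ξ).sub_const _).const_mul _).const_add _
    refine ((hd t (hsub t ht) ξ hξ).comp ξ a2).congr_deriv ?_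
    ring

theorem e_ne_one_of_mem_slitDomain {ξ : ℂ} (hξ : ξ ∈ slitDomain) : e ξ ≠ 1 := by
  intro h
  obtain ⟨n, rfl⟩ := e_eq_one_iff.1 h
  rcases hξ with h | ⟨h1, h2⟩
  · simp at h
  · simp only [Complex.intCast_re] at h1 h2
    have a : 0 < n := by exact_mod_cast h1
    have b : n < 1 := by exact_mod_cast h2
    omega

theorem hasDerivAt_polylog_of_differentiableOn {k : ℕ}
    (h : DifferentiableOn ℂ (polylog k) slitDomain) {ξ : ℂ} (hξ : ξ ∈ slitDomain) :
    HasDerivAt (polylog (k + 1)) (2 * Real.pi * I * polylog k ξ) ξ := by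
  have h1 := ((hasDerivAt_segment_integral h hξ).const_mul (2 * Real.pi * I : ℂ)).const_add
    (2 * Real.pi * (∫ y in Set.Ioi (0 : ℝ), polylog k (1 / 2 + y * I)))
  have h2 : polylog (k + 1) = fun ξ => 2 * Real.pi * (∫ y in Set.Ioi (0 : ℝ),
      polylog k (1 / 2 + y * I)) + 2 * Real.pi * I *
      ((ξ - 1 / 2) * ∫ t in (0 : ℝ)..1, polylog k (1 / 2 + t * (ξ - 1 / 2))) := by
    ext ξ; rw [polylog, mul_assoc _ (ξ - 1 / 2)]
  rw [h2]
  exact h1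

theorem differentiableOn_polylog (k : ℕ) : DifferentiableOn ℂ (polylog k) slitDomain := by
  induction k with
  | zero =>
    have h : polylog 0 = fun ξ => e ξ / (1 - e ξ) := by ext ξ; rw [polylog]
    rw [h]
    refine DifferentiableOn.div (by fun_prop) (by fun_prop) fun ξ hξ => ?_
    exact sub_ne_zero.2 (e_ne_one_of_mem_slitDomain hξ).symm
  | succ k ih => exact fun ξ hξ =>
      (hasDerivAt_polylog_of_differentiableOn ih hξ).differentiableAt.differentiableWithinAt

theorem hasDerivAt_polylog (k : ℕ) {ξ : ℂ} (hξ : ξ ∈ slitDomain) :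
    HasDerivAt (polylog (k + 1)) (2 * Real.pi * I * polylog k ξ) ξ :=
  hasDerivAt_polylog_of_differentiableOn (differentiableOn_polylog k) hξ

/-! ### Power series in `e(ξ)` -/

/-- The series `∑_{m ≥ 1} g_{m-1} e(mξ)`. -/
def expSeries (g : ℕ → ℂ) (ξ : ℂ) : ℂ := ∑' m : ℕ, e ξ ^ (m + 1) * g m

theorem summable_expSeries {g : ℕ → ℂ} {G : ℝ} (hg : ∀ m, ‖g m‖ ≤ G) {ξ : ℂ} (hξ : 0 < ξ.im) :
    Summable fun m : ℕ => e ξ ^ (m + 1) * g m := by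
  refine Summable.of_norm_bounded (summable_pow_succ_mul (norm_e_lt_one_iff.2 hξ) G) fun m => ?_
  rw [norm_mul, norm_pow]
  exact mul_le_mul_of_nonneg_left (hg m) (by positivity)

theorem hasDerivAt_expSeries {g : ℕ → ℂ} {G : ℝ} (hg : ∀ m : ℕ, ‖((m : ℂ) + 1) * g m‖ ≤ G) {ξ : ℂ}
    (hξ : 0 < ξ.im) :
    HasDerivAt (expSeries g) (2 * Real.pi * I * expSeries (fun m => ((m : ℂ) + 1) * g m) ξ) ξ := by
  obtain ⟨δ, hδ, hδξ⟩ := exists_between hξ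
  have hopen : IsOpen {z : ℂ | δ < z.im} := isOpen_lt continuous_const Complex.continuous_im
  have hconv : Convex ℝ {z : ℂ | δ < z.im} := convex_halfSpace_im_gt δ
  have hq : ‖e (δ * I)‖ < 1 := norm_e_lt_one_iff.2 (by simpa using hδ)
  have hg' : ∀ m, ‖g m‖ ≤ G := fun m => by
    refine le_trans ?_ (hg m)
    rw [norm_mul]
    refine le_mul_of_one_le_left (norm_nonneg _) ?_
    have := Complex.norm_natCast (m + 1)
    push_cast at this
    rw [this]
    have hm : (0 : ℝ) ≤ m := m.cast_nonneg
    linarith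
  have key := hasDerivAt_tsum_of_isPreconnected (𝕜 := ℂ)
    (g := fun (m : ℕ) (z : ℂ) => e z ^ (m + 1) * g m)
    (g' := fun (m : ℕ) (z : ℂ) => 2 * Real.pi * I * (e z ^ (m + 1) * (((m : ℂ) + 1) * g m)))
    (summable_pow_succ_mul hq (2 * Real.pi * G)) hopen hconv.isPreconnected (fun m z _ => ?_)
    (fun m z hz => ?_) (y₀ := ξ) hδξ (summable_expSeries hg' hξ) hδξ
  · rw [tsum_mul_left] at key
    exact key
  · refine (((hasDerivAt_e z).pow (m + 1)).mul_const (g m)).congr_deriv ?_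
    rw [Nat.add_sub_cancel]
    push_cast
    ring
  · have h1 : ‖e z‖ ≤ ‖e (δ * I)‖ := by
      rw [norm_e, norm_e, Real.exp_le_exp, neg_le_neg_iff]
      have : (δ * I : ℂ).im = δ := by simp
      rw [this]
      have hz' : δ ≤ z.im := le_of_lt hz
      gcongr
    have h3 : ‖(2 * Real.pi * I : ℂ)‖ = 2 * Real.pi := by simp [abs_of_pos Real.pi_pos]
    rw [norm_mul (2 * Real.pi * I : ℂ), h3, norm_mul (e z ^ (m + 1)), norm_pow]
    calc 2 * Real.pi * (‖e z‖ ^ (m + 1) * ‖((m : ℂ) + 1) * g m‖)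
        ≤ 2 * Real.pi * (‖e (δ * I)‖ ^ (m + 1) * G) := by gcongr; exact hg m
      _ = _ := by ring

theorem norm_natCast_add_one (m : ℕ) : ‖(m : ℂ) + 1‖ = m + 1 := by
  have := Complex.norm_natCast (m + 1)
  push_cast at this
  exact this

theorem norm_inv_pow_le_one (m k : ℕ) : ‖(((m : ℂ) + 1) ^ k)⁻¹‖ ≤ 1 := by
  rw [norm_inv, norm_pow, norm_natCast_add_one]
  refine inv_le_one_of_one_le₀ (one_le_pow₀ ?_)
  have hm : (0 : ℝ) ≤ m := m.cast_nonneg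
  linarith

theorem hasDerivAt_expSeries_polylog (k : ℕ) {ξ : ℂ} (hξ : 0 < ξ.im) :
    HasDerivAt (expSeries fun m => (((m : ℂ) + 1) ^ (k + 1))⁻¹)
      (2 * Real.pi * I * expSeries (fun m => (((m : ℂ) + 1) ^ k)⁻¹) ξ) ξ := by
  have h : ∀ m : ℕ, ((m : ℂ) + 1) * (((m : ℂ) + 1) ^ (k + 1))⁻¹ = (((m : ℂ) + 1) ^ k)⁻¹ :=
    fun m => by
      have : (m : ℂ) + 1 ≠ 0 := by exact_mod_cast m.succ_ne_zero
      rw [pow_succ]; field_simp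
  have := hasDerivAt_expSeries (g := fun m => (((m : ℂ) + 1) ^ (k + 1))⁻¹) (G := 1)
    (fun m => by rw [h]; exact norm_inv_pow_le_one m k) hξ
  simp_rw [h] at this
  exact this

theorem norm_expSeries_le {g : ℕ → ℂ} {G : ℝ} (hg : ∀ m, ‖g m‖ ≤ G) {ξ : ℂ} (hξ : 0 < ξ.im) :
    ‖expSeries g ξ‖ ≤ ‖e ξ‖ * ((1 - ‖e ξ‖)⁻¹ * G) := by
  have h := norm_e_lt_one_iff.2 hξ
  have h1 := ((hasSum_geometric_of_lt_one (norm_nonneg _) h).mul_right G).mul_left ‖e ξ‖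
  refine tsum_of_norm_bounded h1 fun m => ?_
  rw [norm_mul, norm_pow, pow_succ]
  calc ‖e ξ‖ ^ m * ‖e ξ‖ * ‖g m‖ ≤ ‖e ξ‖ ^ m * ‖e ξ‖ * G := by gcongr; exact hg m
    _ = _ := by ring

theorem exists_eq_add_of_hasDerivAt {s : Set ℂ} (hs : IsOpen s) (hs' : IsPreconnected s)
    {f g f' : ℂ → ℂ} (hf : ∀ z ∈ s, HasDerivAt f (f' z) z) (hg : ∀ z ∈ s, HasDerivAt g (f' z) z) :
    ∃ a, ∀ z ∈ s, f z = g z + a :=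
  hs.exists_eq_add_of_deriv_eq hs' (fun z hz => (hf z hz).differentiableAt.differentiableWithinAt)
    (fun z hz => (hg z hz).differentiableAt.differentiableWithinAt)
    fun z hz => (hf z hz).deriv.trans (hg z hz).deriv.symm

theorem mem_slitDomain_of_im_pos {ξ : ℂ} (h : 0 < ξ.im) : ξ ∈ slitDomain := Or.inl h.ne'

theorem isOpen_im_pos : IsOpen {z : ℂ | 0 < z.im} := isOpen_lt continuous_const Complex.continuous_im

theorem isPreconnected_im_pos : IsPreconnected {z : ℂ | 0 < z.im} :=
  (convex_halfSpace_im_gt 0).isPreconnected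

theorem vertical_mem_slitDomain (y : ℝ) : (1 / 2 + y * I : ℂ) ∈ slitDomain := by
  by_cases h : y = 0
  · right; subst h; norm_num
  · left; simpa using h

theorem expSeries_zero_pow {ξ : ℂ} (hξ : 0 < ξ.im) :
    polylog 0 ξ = expSeries (fun m => (((m : ℂ) + 1) ^ 0)⁻¹) ξ := by
  have h := norm_e_lt_one_iff.2 hξ
  have h1 := ((hasSum_geometric_of_norm_lt_one h).mul_left (e ξ)).tsum_eq
  rw [polylog, expSeries, div_eq_mul_inv, ← h1]
  exact tsum_congr fun m => by rw [pow_succ]; simp [mul_comm]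

theorem norm_e_vertical (y : ℝ) : ‖e (1 / 2 + y * I)‖ = Real.exp (-(2 * Real.pi * y)) := by
  rw [norm_e]; simp

theorem norm_expSeries_vertical_le {g : ℕ → ℂ} (hg : ∀ m, ‖g m‖ ≤ 1) {y : ℝ} (hy : 1 ≤ y) :
    ‖expSeries g (1 / 2 + y * I)‖ ≤ 2 * Real.exp (-(2 * Real.pi) * y) := by
  have h0 : (0 : ℝ) < (1 / 2 + y * I : ℂ).im := by simp; linarith
  have h1 := norm_expSeries_le hg h0
  rw [norm_e_vertical] at h1
  have h2 : Real.exp (-(2 * Real.pi * y)) ≤ 1 / 2 := by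
    have h3 : (2 : ℝ) ≤ Real.exp (2 * Real.pi * y) := by
      have h4 := Real.add_one_le_exp (2 * Real.pi * y)
      have h5 : 1 ≤ 2 * Real.pi * y := by nlinarith [Real.pi_gt_three]
      linarith
    rw [Real.exp_neg, one_div]
    exact inv_anti₀ two_pos h3
  have h6 : (1 - Real.exp (-(2 * Real.pi * y)))⁻¹ ≤ 2 := by
    rw [inv_le_comm₀ (by linarith) two_pos]
    linarith
  have h7 : -(2 * Real.pi) * y = -(2 * Real.pi * y) := by ring
  rw [h7]
  have := Real.exp_pos (-(2 * Real.pi * y))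
  nlinarith

theorem tendsto_expSeries_vertical {g : ℕ → ℂ} (hg : ∀ m, ‖g m‖ ≤ 1) :
    Tendsto (fun y : ℝ => expSeries g (1 / 2 + y * I)) atTop (𝓝 0) := by
  have h : Tendsto (fun y : ℝ => 2 * Real.exp (-(2 * Real.pi) * y)) atTop (𝓝 0) := by
    have h1 : Tendsto (fun y : ℝ => -(2 * Real.pi) * y) atTop atBot :=
      tendsto_id.const_mul_atTop_of_neg (by linarith [Real.pi_pos])
    simpa using (Real.tendsto_exp_atBot.comp h1).const_mul 2
  exact squeeze_zero_norm' ((eventually_ge_atTop 1).mono fun y hy =>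
    norm_expSeries_vertical_le hg hy) h

/-- Both sides have the same derivative in the upper half-plane, hence differ by a constant. The
series vanishes at 1/2 + i∞, and so does the polylogarithm by the choice of its constant term. -/
theorem polylog_eq_expSeries (k : ℕ) {ξ : ℂ} (hξ : 0 < ξ.im) :
    polylog k ξ = expSeries (fun m => (((m : ℂ) + 1) ^ k)⁻¹) ξ := by
  induction k generalizing ξ with
  | zero => exact expSeries_zero_pow hξ
  | succ k ih =>
    obtain ⟨a, ha⟩ := exists_eq_add_of_hasDerivAt isOpen_im_pos isPreconnected_im_pos
      (f := polylog (k + 1)) (g := expSeries fun m => (((m : ℂ) + 1) ^ (k + 1))⁻¹)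
      (fun z hz => hasDerivAt_polylog k (mem_slitDomain_of_im_pos hz))
      (fun z hz => by rw [ih hz]; exact hasDerivAt_expSeries_polylog k hz)
    have hcont : Continuous fun y : ℝ => polylog k (1 / 2 + y * I) := by
      refine continuous_iff_continuousAt.2 fun y => ?_
      refine ContinuousAt.comp (f := fun y : ℝ => (1 / 2 + y * I : ℂ)) ?_ (by fun_prop)
      exact ((differentiableOn_polylog k).differentiableAt
        (isOpen_slitDomain.mem_nhds (vertical_mem_slitDomain y))).continuousAt
    have hO : (fun y : ℝ => ‖polylog k (1 / 2 + y * I)‖) =O[atTop]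
        fun y => Real.exp (-(2 * Real.pi) * y) := by
      refine IsBigO.of_bound 2 ((eventually_ge_atTop 1).mono fun y hy => ?_)
      have hy0 : (0 : ℝ) < (1 / 2 + y * I : ℂ).im := by simp; linarith
      rw [norm_norm, Real.norm_of_nonneg (Real.exp_pos _).le, ih hy0]
      exact norm_expSeries_vertical_le (fun m => norm_inv_pow_le_one m k) hy
    have hint : MeasureTheory.IntegrableOn (fun y : ℝ => polylog k (1 / 2 + y * I))
        (Set.Ioi 0) := by
      refine (MeasureTheory.integrable_norm_iff hcont.aestronglyMeasurable).1 ?_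
      exact integrable_of_isBigO_exp_neg (by linarith [Real.pi_pos])
        hcont.norm.continuousOn hO
    have hT := MeasureTheory.intervalIntegral_tendsto_integral_Ioi 0 hint tendsto_id
    have hP : Tendsto (fun y : ℝ => polylog (k + 1) (1 / 2 + y * I)) atTop (𝓝 0) := by
      -- On the vertical line the polylogarithm is 2π times the tail of a convergent integral over
      -- (0,∞).
      have h1 : ∀ y : ℝ, polylog (k + 1) (1 / 2 + y * I) = 2 * Real.pi *
          ((∫ y in Set.Ioi (0 : ℝ), polylog k (1 / 2 + y * I)) -
            ∫ y in (0 : ℝ)..(id y), polylog k (1 / 2 + y * I)) := fun y => by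
        rw [polylog, id]
        have h2 := intervalIntegral.smul_integral_comp_mul_right (a := 0) (b := 1)
          (fun y : ℝ => polylog k (1 / 2 + y * I)) y
        rw [zero_mul, one_mul] at h2
        rw [← h2, Complex.real_smul]
        have h3 : ∀ t : ℝ, (1 / 2 + t * (1 / 2 + y * I - 1 / 2) : ℂ) =
            1 / 2 + ((t * y : ℝ) : ℂ) * I := fun t => by push_cast; ring
        simp_rw [h3]
        linear_combination (2 * Real.pi * y * ∫ t in (0 : ℝ)..1,
          polylog k (1 / 2 + ((t * y : ℝ) : ℂ) * I)) * I_sq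
      simp_rw [h1]
      have h4 := (hT.const_sub (∫ y in Set.Ioi (0 : ℝ), polylog k (1 / 2 + y * I))).const_mul
        (2 * Real.pi : ℂ)
      rw [sub_self, mul_zero] at h4
      exact h4
    have ha0 : a = 0 := by
      have h1 : Tendsto (fun y : ℝ => polylog (k + 1) (1 / 2 + y * I)) atTop (𝓝 (0 + a)) := by
        refine Tendsto.congr' ((eventually_gt_atTop 0).mono fun y hy => (ha _ ?_).symm)
          ((tendsto_expSeries_vertical fun m => norm_inv_pow_le_one m (k + 1)).add_const a)
        simpa using hy
      simpa using tendsto_nhds_unique h1 hP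
    rw [ha ξ hξ, ha0, add_zero]

theorem summable_inv_sq : Summable fun m : ℕ => (((m : ℝ) + 1) ^ 2)⁻¹ := by
  have := (summable_nat_add_iff 1).2 (Real.summable_one_div_nat_pow.2 (one_lt_two))
  simpa using this

theorem norm_polylog_le {k : ℕ} (hk : 2 ≤ k) {ξ : ℂ} (hξ : 0 < ξ.im) :
    ‖polylog k ξ‖ ≤ ∑' m : ℕ, (((m : ℝ) + 1) ^ 2)⁻¹ := by
  rw [polylog_eq_expSeries k hξ]
  refine tsum_of_norm_bounded summable_inv_sq.hasSum fun m => ?_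
  rw [norm_mul, norm_inv, norm_pow, norm_pow, norm_natCast_add_one]
  have h1 : ‖e ξ‖ ^ (m + 1) ≤ 1 := pow_le_one₀ (norm_nonneg _) (norm_e_lt_one_iff.2 hξ).le
  have hm : (1 : ℝ) ≤ m + 1 := by linarith [m.cast_nonneg (α := ℝ)]
  calc _ ≤ 1 * (((m : ℝ) + 1) ^ 2)⁻¹ := by
        gcongr
    _ = _ := one_mul _

/-- For k ≥ 2 the bound ∑ 1/m² on the upper half-plane passes to the boundary point 1/2 by
continuity; k = 0 and k = 1 are only two further values. -/
theorem exists_norm_polylog_half_le : ∃ C, ∀ k, ‖polylog k (1 / 2)‖ ≤ C := by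
  refine ⟨max (‖polylog 0 (1 / 2)‖) (max ‖polylog 1 (1 / 2)‖ (∑' m : ℕ, (((m : ℝ) + 1) ^ 2)⁻¹)),
    fun k => ?_⟩
  match k with
  | 0 => exact le_max_left _ _
  | 1 => exact (le_max_left _ _).trans (le_max_right _ _)
  | k + 2 =>
    refine le_trans ?_ ((le_max_right _ _).trans (le_max_right _ _))
    have h1 : Tendsto (fun y : ℝ => ‖polylog (k + 2) (1 / 2 + y * I)‖) (𝓝[>] 0)
        (𝓝 ‖polylog (k + 2) (1 / 2)‖) := by
      have h2 : ContinuousAt (polylog (k + 2)) (1 / 2 + (0 : ℝ) * I) :=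
        ((differentiableOn_polylog _).differentiableAt
          (isOpen_slitDomain.mem_nhds (vertical_mem_slitDomain 0))).continuousAt
      have h3 : ContinuousAt (fun y : ℝ => ‖polylog (k + 2) (1 / 2 + y * I)‖) 0 :=
        (ContinuousAt.comp (f := fun y : ℝ => (1 / 2 + y * I : ℂ)) h2 (by fun_prop)).norm
      have h4 := h3.tendsto
      simp only [ofReal_zero, zero_mul, add_zero] at h4
      exact h4.mono_left nhdsWithin_le_nhds
    refine le_of_tendsto h1 (eventually_mem_nhdsWithin.mono fun y hy => ?_)
    refine norm_polylog_le (by omega) ?_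
    simpa using hy

/-- The bound has to be uniform in k so that ∑ Li_k β^(k-1) converges for |β| < 1. Along the segment
from 1/2 each Li_{k+1} has derivative 2πi(ξ - 1/2) Li_k in the parameter, and the majorant C e^(Lt)
equals its own derivative divided by L; it therefore reproduces itself in the induction on k. -/
theorem exists_norm_polylog_le {ξ₀ : ℂ} (hξ₀ : ξ₀ ∈ slitDomain) :
    ∃ r > 0, Metric.closedBall ξ₀ r ⊆ slitDomain ∧
      ∃ C, ∀ ξ ∈ Metric.closedBall ξ₀ r, ∀ k, ‖polylog k ξ‖ ≤ C := by
  obtain ⟨r, hr, hrD, K, hK, hKD, hcone⟩ := exists_compact_cone hξ₀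
  obtain ⟨C₀, hC₀⟩ := exists_norm_polylog_half_le
  obtain ⟨M, hM⟩ := hK.exists_bound_of_continuousOn
    ((differentiableOn_polylog 0).continuousOn.mono hKD)
  obtain ⟨L, hL0, hL⟩ : ∃ L, 0 ≤ L ∧ ∀ ξ ∈ Metric.closedBall ξ₀ r,
      ‖(2 * Real.pi * I * (ξ - 1 / 2) : ℂ)‖ ≤ L := by
    obtain ⟨L, hL⟩ := (isCompact_closedBall ξ₀ r).exists_bound_of_continuousOn
      (f := fun ξ : ℂ => (2 * Real.pi * I * (ξ - 1 / 2) : ℂ)) (by fun_prop)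
    exact ⟨L, (norm_nonneg _).trans (hL ξ₀ (Metric.mem_closedBall_self hr.le)), hL⟩
  have hmax : 0 ≤ max C₀ M := (norm_nonneg _).trans ((hC₀ 0).trans (le_max_left _ _))
  refine ⟨r, hr, hrD, max C₀ M * Real.exp (L * 1), fun ξ hξ => ?_⟩
  suffices h : ∀ k, ∀ t ∈ Set.Icc (0 : ℝ) 1,
      ‖polylog k (1 / 2 + t * (ξ - 1 / 2))‖ ≤ max C₀ M * Real.exp (L * t) by
    intro k
    have := h k 1 (by simp)
    simpa using this
  intro k
  induction k with
  | zero =>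
    intro t ht
    refine (hM _ (hcone ξ hξ t ht)).trans ((le_max_right C₀ M).trans ?_)
    exact le_mul_of_one_le_right hmax (Real.one_le_exp (mul_nonneg hL0 ht.1))
  | succ k ih =>
    have hd : ∀ t ∈ Set.Icc (0 : ℝ) 1, HasDerivAt
        (fun t : ℝ => polylog (k + 1) (1 / 2 + t * (ξ - 1 / 2)))
        (2 * Real.pi * I * polylog k (1 / 2 + t * (ξ - 1 / 2)) * (1 * (ξ - 1 / 2))) t :=
      fun t ht => by
        have a1 : HasDerivAt (fun t : ℝ => (t : ℂ)) 1 t := Complex.ofRealCLM.hasDerivAt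
        have a2 : HasDerivAt (fun t : ℝ => (1 / 2 + t * (ξ - 1 / 2) : ℂ)) (1 * (ξ - 1 / 2)) t :=
          (a1.mul_const _).const_add _
        exact HasDerivAt.comp (h₂ := polylog (k + 1)) (h := fun t : ℝ => (1 / 2 + t * (ξ - 1 / 2) : ℂ)) t
          (hasDerivAt_polylog k (segment_mem_slitDomain (hrD hξ) ht)) a2
    intro t ht
    refine image_norm_le_of_norm_deriv_right_le_deriv_boundary
      (f := fun t : ℝ => polylog (k + 1) (1 / 2 + t * (ξ - 1 / 2))) (a := 0) (b := 1)
      (B := fun t => max C₀ M * Real.exp (L * t))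
      (B' := fun t => max C₀ M * (Real.exp (L * t) * (L * 1)))
      (fun t ht => (hd t ht).continuousAt.continuousWithinAt)
      (fun t ht => (hd t ⟨ht.1, ht.2.le⟩).hasDerivWithinAt) ?_
      (fun t => (((hasDerivAt_id t).const_mul L).exp).const_mul _) (fun t ht => ?_) ht
    · simpa using Or.inl (hC₀ (k + 1))
    · have h1 : (2 * Real.pi * I * polylog k (1 / 2 + t * (ξ - 1 / 2)) * (1 * (ξ - 1 / 2)) : ℂ) =
          (2 * Real.pi * I * (ξ - 1 / 2)) * polylog k (1 / 2 + t * (ξ - 1 / 2)) := by ring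
      rw [h1, norm_mul (2 * Real.pi * I * (ξ - 1 / 2) : ℂ)]
      calc _ ≤ L * (max C₀ M * Real.exp (L * t)) :=
            mul_le_mul (hL ξ hξ) (ih t ⟨ht.1, ht.2.le⟩) (norm_nonneg _) hL0
        _ = _ := by ring

/-! ### The Debye generating series on the slit domain -/

theorem summable_polylog_mul_pow {ξ β : ℂ} (hξ : ξ ∈ slitDomain) (hβ : ‖β‖ < 1) :
    Summable fun k : ℕ => polylog (k + 1) ξ * β ^ k := by
  obtain ⟨r, hr, -, C, hC⟩ := exists_norm_polylog_le hξ
  refine Summable.of_norm_bounded ((summable_geometric_of_lt_one (norm_nonneg β) hβ).mul_left C)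
    fun k => ?_
  rw [norm_mul, norm_pow]
  gcongr
  exact hC ξ (Metric.mem_closedBall_self hr.le) (k + 1)

theorem hasDerivAt_debyeSum {ξ β : ℂ} (hξ : ξ ∈ slitDomain) (hβ : ‖β‖ < 1) :
    HasDerivAt (fun ξ => ∑' k : ℕ, polylog (k + 1) ξ * β ^ k)
      (2 * Real.pi * I * (polylog 0 ξ + β * ∑' k : ℕ, polylog (k + 1) ξ * β ^ k)) ξ := by
  obtain ⟨r, hr, hrD, C, hC⟩ := exists_norm_polylog_le hξ
  have hmem := Metric.mem_ball_self (x := ξ) hr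
  have key := hasDerivAt_tsum_of_isPreconnected (𝕜 := ℂ)
    (g := fun (k : ℕ) (z : ℂ) => polylog (k + 1) z * β ^ k)
    (g' := fun (k : ℕ) (z : ℂ) => 2 * Real.pi * I * (polylog k z * β ^ k))
    ((summable_geometric_of_lt_one (norm_nonneg β) hβ).mul_left (2 * Real.pi * C))
    Metric.isOpen_ball (convex_ball ξ r).isPreconnected (fun k z hz => ?_) (fun k z hz => ?_)
    hmem (summable_polylog_mul_pow hξ hβ) hmem
  · refine key.congr_deriv ?_
    rw [tsum_mul_left]
    congr 1
    have h0 : Summable fun k : ℕ => polylog k ξ * β ^ k := by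
      refine Summable.of_norm_bounded
        ((summable_geometric_of_lt_one (norm_nonneg β) hβ).mul_left C) fun k => ?_
      rw [norm_mul, norm_pow]
      gcongr
      exact hC ξ (Metric.mem_closedBall_self hr.le) k
    rw [h0.tsum_eq_zero_add, pow_zero, mul_one, ← tsum_mul_left]
    congr 1
    exact tsum_congr fun k => by rw [pow_succ]; ring
  · refine ((hasDerivAt_polylog k (hrD (Metric.ball_subset_closedBall hz))).mul_const
      (β ^ k)).congr_deriv ?_
    ring
  · have h3 : ‖(2 * Real.pi * I : ℂ)‖ = 2 * Real.pi := by simp [abs_of_pos Real.pi_pos]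
    rw [norm_mul (2 * Real.pi * I : ℂ), h3, norm_mul (polylog k z), norm_pow]
    have := hC z (Metric.ball_subset_closedBall hz) k
    calc 2 * Real.pi * (‖polylog k z‖ * ‖β‖ ^ k) ≤ 2 * Real.pi * (C * ‖β‖ ^ k) := by gcongr
      _ = _ := by ring

theorem hasDerivAt_e_neg_mul (ξ β : ℂ) :
    HasDerivAt (fun ξ => e (-(ξ * β))) (-(2 * Real.pi * I * β * e (-(ξ * β)))) ξ := by
  have h1 : HasDerivAt (fun ξ : ℂ => -(ξ * β)) (-(1 * β)) ξ :=
    ((hasDerivAt_id ξ).mul_const β).neg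
  refine ((hasDerivAt_e _).comp ξ h1).congr_deriv ?_
  ring

/-- The prefactor e(-ξβ) is an integrating factor: the terms containing β cancel, and only the
elementary Li_0 survives. -/
theorem hasDerivAt_debye {ξ β : ℂ} (hξ : ξ ∈ slitDomain) (hβ : ‖β‖ < 1) :
    HasDerivAt (fun ξ => debye ξ β) (2 * Real.pi * I * e (-(ξ * β)) * polylog 0 ξ) ξ := by
  refine ((hasDerivAt_e_neg_mul ξ β).mul (hasDerivAt_debyeSum hξ hβ)).congr_deriv ?_
  ring

theorem natCast_add_one_ne_zero (m : ℕ) : (m : ℂ) + 1 ≠ 0 := by exact_mod_cast m.succ_ne_zero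

theorem hasSum_inv_sub {β : ℂ} (hβ : ‖β‖ < 1) (m : ℕ) :
    HasSum (fun k : ℕ => (((m : ℂ) + 1) ^ (k + 1))⁻¹ * β ^ k) ((m : ℂ) + 1 - β)⁻¹ := by
  have hm := natCast_add_one_ne_zero m
  have h1 : ‖β / ((m : ℂ) + 1)‖ < 1 := by
    rw [norm_div, norm_natCast_add_one]
    have : (0 : ℝ) ≤ m := m.cast_nonneg
    rw [div_lt_one (by linarith)]
    linarith
  refine hasSum_of_eq ((hasSum_geometric_of_norm_lt_one h1).mul_left ((m : ℂ) + 1)⁻¹)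
    (fun k => ?_) ?_
  · rw [div_pow, pow_succ]
    field_simp
  · rw [← mul_inv, mul_sub, mul_div_cancel₀ _ hm, mul_one]

theorem debye_eq_of_im_pos {ξ β : ℂ} (hξ : 0 < ξ.im) (hβ : ‖β‖ < 1) :
    debye ξ β = e (-(ξ * β)) * expSeries (fun m => ((m : ℂ) + 1 - β)⁻¹) ξ := by
  rw [debye]
  congr 1
  have h := norm_e_lt_one_iff.2 hξ
  have hs : Summable (Function.uncurry fun (m k : ℕ) =>
      e ξ ^ (m + 1) * ((((m : ℂ) + 1) ^ (k + 1))⁻¹ * β ^ k)) := by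
    have h1 : Summable fun m : ℕ => ‖e ξ‖ ^ (m + 1) := by
      simpa using summable_pow_succ_mul h 1
    refine Summable.of_norm_bounded
      (h1.mul_of_nonneg (summable_geometric_of_lt_one (norm_nonneg β) hβ)
        (fun m => by positivity) (fun m => by positivity)) fun p => ?_
    simp only [Function.uncurry]
    rw [norm_mul, norm_mul, norm_pow, norm_pow]
    have := norm_inv_pow_le_one p.1 (p.2 + 1)
    calc _ ≤ ‖e ξ‖ ^ (p.1 + 1) * (1 * ‖β‖ ^ p.2) := by gcongr
      _ = _ := by rw [one_mul]
  have h2 := hs.tsum_comm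
  rw [expSeries]
  calc ∑' k : ℕ, polylog (k + 1) ξ * β ^ k
      = ∑' (k : ℕ) (m : ℕ), e ξ ^ (m + 1) * ((((m : ℂ) + 1) ^ (k + 1))⁻¹ * β ^ k) := by
        refine tsum_congr fun k => ?_
        rw [polylog_eq_expSeries _ hξ, expSeries, ← tsum_mul_right]
        exact tsum_congr fun m => by ring
    _ = _ := h2
    _ = _ := tsum_congr fun m => by rw [tsum_mul_left, (hasSum_inv_sub hβ m).tsum_eq]

/-! ### Continuity up to the real line -/

/-- The coefficients `1/(m-β) - 1/m`, `m ≥ 1`. -/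
def invDiff (β : ℂ) (m : ℕ) : ℂ := ((m : ℂ) + 1 - β)⁻¹ - ((m : ℂ) + 1)⁻¹

theorem natCast_add_one_sub_ne_zero {β : ℂ} (hβ : ‖β‖ < 1) (m : ℕ) : (m : ℂ) + 1 - β ≠ 0 := by
  have := (one_sub_norm_le m β).1
  exact norm_pos_iff.1 (by linarith)

/-- Subtracting 1/m leaves coefficients of size 1/m², so the series converges uniformly on the
closed upper half-plane, in particular at ξ = 0. The subtracted part is Li_1, which carries the
logarithm. -/
theorem norm_invDiff_le {b : ℝ} (hb : b < 1) {β : ℂ} (hβ : ‖β‖ ≤ b) (m : ℕ) :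
    ‖invDiff β m‖ ≤ (1 - b)⁻¹ * (((m : ℝ) + 1) ^ 2)⁻¹ := by
  have hm := natCast_add_one_ne_zero m
  have h0 := natCast_add_one_sub_ne_zero (hβ.trans_lt hb) m
  have h1 : invDiff β m = β * (((m : ℂ) + 1 - β)⁻¹ * ((m : ℂ) + 1)⁻¹) := by
    rw [invDiff]; field_simp; ring
  have hm0 : (0 : ℝ) ≤ m := m.cast_nonneg
  have h2 : (1 - b) * (m + 1) ≤ ‖(m : ℂ) + 1 - β‖ := by
    have := norm_sub_norm_le ((m : ℂ) + 1) β
    rw [norm_natCast_add_one] at this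
    have hb0 := (norm_nonneg β).trans hβ
    nlinarith
  have h3 : ‖((m : ℂ) + 1 - β)⁻¹‖ ≤ ((1 - b) * (m + 1))⁻¹ := by
    rw [norm_inv]
    exact inv_anti₀ (mul_pos (by linarith) (by linarith)) h2
  rw [h1, norm_mul, norm_mul, norm_inv ((m : ℂ) + 1), norm_natCast_add_one]
  have hb1 : 0 < 1 - b := by linarith
  calc _ ≤ 1 * (((1 - b) * ((m : ℝ) + 1))⁻¹ * ((m : ℝ) + 1)⁻¹) := by
        gcongr; linarith
    _ = _ := by field_simp

theorem norm_e_pow_le_one {ξ : ℂ} (hξ : 0 ≤ ξ.im) (m : ℕ) : ‖e ξ ^ (m + 1)‖ ≤ 1 := by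
  rw [norm_pow]
  exact pow_le_one₀ (norm_nonneg _) (norm_e_le_one_iff.2 hξ)

theorem norm_expSeries_invDiff_term_le {b : ℝ} (hb : b < 1) {ξ β : ℂ} (hξ : 0 ≤ ξ.im)
    (hβ : ‖β‖ ≤ b) (m : ℕ) :
    ‖e ξ ^ (m + 1) * invDiff β m‖ ≤ (1 - b)⁻¹ * (((m : ℝ) + 1) ^ 2)⁻¹ := by
  rw [norm_mul]
  calc _ ≤ 1 * ((1 - b)⁻¹ * (((m : ℝ) + 1) ^ 2)⁻¹) :=
        mul_le_mul (norm_e_pow_le_one hξ m) (norm_invDiff_le hb hβ m) (norm_nonneg _) zero_le_one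
    _ = _ := one_mul _

theorem continuousOn_expSeries_invDiff {b : ℝ} (hb : b < 1) :
    ContinuousOn (fun p : ℂ × ℂ => expSeries (invDiff p.2) p.1)
      ({z | 0 ≤ z.im} ×ˢ Metric.closedBall 0 b) := by
  refine continuousOn_tsum (fun m => ?_) (summable_inv_sq.mul_left (1 - b)⁻¹)
    fun m p hp => norm_expSeries_invDiff_term_le hb hp.1 (mem_closedBall_zero_iff.1 hp.2) m
  refine ContinuousOn.mul (by fun_prop) ?_
  refine ContinuousOn.sub (ContinuousOn.inv₀ (by fun_prop) fun p hp => ?_) continuousOn_const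
  exact natCast_add_one_sub_ne_zero ((mem_closedBall_zero_iff.1 hp.2).trans_lt hb) m

theorem continuousOn_expSeries_invDiff_left {β : ℂ} (hβ : ‖β‖ < 1) :
    ContinuousOn (fun ξ : ℂ => expSeries (invDiff β) ξ) {z | 0 ≤ z.im} :=
  (continuousOn_expSeries_invDiff hβ).comp (f := fun ξ : ℂ => (ξ, β)) (by fun_prop)
    fun _ hz => ⟨hz, by simp⟩

theorem expSeries_sub {g h : ℕ → ℂ} {G H : ℝ} (hg : ∀ m, ‖g m‖ ≤ G) (hh : ∀ m, ‖h m‖ ≤ H) {ξ : ℂ}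
    (hξ : 0 < ξ.im) : expSeries (fun m => g m - h m) ξ = expSeries g ξ - expSeries h ξ := by
  rw [expSeries, expSeries, expSeries,
    ← (summable_expSeries hg hξ).tsum_sub (summable_expSeries hh hξ)]
  exact tsum_congr fun m => mul_sub _ _ _

theorem norm_inv_natCast_add_one_le (m : ℕ) : ‖((m : ℂ) + 1)⁻¹‖ ≤ 1 := by
  simpa using norm_inv_pow_le_one m 1

theorem expSeries_invDiff {ξ β : ℂ} (hξ : 0 < ξ.im) (hβ : ‖β‖ < 1) :
    expSeries (invDiff β) ξ = expSeries (fun m => ((m : ℂ) + 1 - β)⁻¹) ξ -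
      expSeries (fun m => ((m : ℂ) + 1)⁻¹) ξ :=
  expSeries_sub (fun m => (norm_inv_add_le hβ m).1) norm_inv_natCast_add_one_le hξ

theorem polylog_one_of_im_pos {ξ : ℂ} (hξ : 0 < ξ.im) :
    polylog 1 ξ = expSeries (fun m => ((m : ℂ) + 1)⁻¹) ξ := by
  rw [polylog_eq_expSeries 1 hξ]; simp

theorem debye_sub_polylog_of_im_pos {ξ β : ℂ} (hξ : 0 < ξ.im) (hβ : ‖β‖ < 1) :
    debye ξ β - e (-(ξ * β)) * polylog 1 ξ = e (-(ξ * β)) * expSeries (invDiff β) ξ := by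
  rw [debye_eq_of_im_pos hξ hβ, polylog_one_of_im_pos hξ, expSeries_invDiff hξ hβ, mul_sub]

/-- A device for passing from an open half-plane to its boundary: D is continuous at x, L is
continuous on the closed side only, and they agree along a ray ending at x. -/
theorem eq_of_eq_on_ray {D L : ℂ → ℂ} {T : Set ℂ} {x c : ℂ} (hD : ContinuousAt D x)
    (hL : ContinuousWithinAt L T x)
    (h : ∀ y : ℝ, 0 < y → x + y * c ∈ T ∧ D (x + y * c) = L (x + y * c)) : D x = L x := by
  have h0 : Tendsto (fun y : ℝ => x + y * c) (𝓝[>] 0) (𝓝 x) := by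
    have h1 : Tendsto (fun y : ℝ => x + y * c) (𝓝 0) (𝓝 (x + (0 : ℝ) * c)) :=
      Continuous.tendsto (by fun_prop) 0
    simp only [ofReal_zero, zero_mul, add_zero] at h1
    exact h1.mono_left nhdsWithin_le_nhds
  have h1 := hD.tendsto.comp h0
  have h2 := hL.tendsto.comp (tendsto_nhdsWithin_iff.2
    ⟨h0, eventually_mem_nhdsWithin.mono fun y hy => (h y hy).1⟩)
  exact tendsto_nhds_unique_of_eventuallyEq h1 h2
    (eventually_mem_nhdsWithin.mono fun y hy => (h y hy).2)

theorem continuousAt_debye_sub_polylog {ξ β : ℂ} (hξ : ξ ∈ slitDomain) (hβ : ‖β‖ < 1) :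
    ContinuousAt (fun ξ => debye ξ β - e (-(ξ * β)) * polylog 1 ξ) ξ :=
  (hasDerivAt_debye hξ hβ).continuousAt.sub
    ((hasDerivAt_e_neg_mul ξ β).continuousAt.mul (hasDerivAt_polylog 0 hξ).continuousAt)

theorem debye_sub_polylog {ξ β : ℂ} (hξ : ξ ∈ slitDomain) (hξ' : 0 ≤ ξ.im) (hβ : ‖β‖ < 1) :
    debye ξ β - e (-(ξ * β)) * polylog 1 ξ = e (-(ξ * β)) * expSeries (invDiff β) ξ := by
  refine eq_of_eq_on_ray (L := fun ξ => e (-(ξ * β)) * expSeries (invDiff β) ξ)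
    (T := {z | 0 ≤ z.im}) (c := I) (continuousAt_debye_sub_polylog hξ hβ) ?_ fun y hy => ?_
  · exact (hasDerivAt_e_neg_mul ξ β).continuousAt.continuousWithinAt.mul
      (continuousOn_expSeries_invDiff_left hβ ξ hξ')
  · have : 0 < (ξ + y * I).im := by simp; linarith
    exact ⟨this.le, debye_sub_polylog_of_im_pos this hβ⟩

/-! ### The lower half-plane -/

theorem isOpen_im_neg : IsOpen {z : ℂ | z.im < 0} := isOpen_lt Complex.continuous_im continuous_const

theorem isPreconnected_im_neg : IsPreconnected {z : ℂ | z.im < 0} :=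
  (convex_halfSpace_im_lt 0).isPreconnected

theorem polylog_zero_of_im_neg {ξ : ℂ} (hξ : ξ.im < 0) :
    polylog 0 ξ = -(1 + expSeries (fun _ => 1) (-ξ)) := by
  have h0 : 0 < (-ξ).im := by simpa using hξ
  have h1 := expSeries_zero_pow h0
  simp only [pow_zero, inv_one] at h1
  rw [← h1, polylog, polylog, e_neg]
  have h2 : 1 - e ξ ≠ 0 := sub_ne_zero.2 (e_ne_one_of_mem_slitDomain (Or.inl hξ.ne)).symm
  have h3 := e_ne_zero ξ
  have h4 : 1 - (e ξ)⁻¹ ≠ 0 := by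
    intro h
    apply h2
    field_simp at h
    linear_combination -h
  have h5 : (e ξ)⁻¹ / (1 - (e ξ)⁻¹) = -(1 / (1 - e ξ)) := by
    rw [div_eq_iff h4]
    field_simp
    ring
  rw [h5]
  field_simp
  ring

theorem hasDerivAt_expSeries_neg {g : ℕ → ℂ} {G : ℝ} (hg : ∀ m : ℕ, ‖((m : ℂ) + 1) * g m‖ ≤ G)
    {ξ : ℂ} (hξ : ξ.im < 0) :
    HasDerivAt (fun ξ => expSeries g (-ξ))
      (-(2 * Real.pi * I * expSeries (fun m => ((m : ℂ) + 1) * g m) (-ξ))) ξ := by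
  have h0 : 0 < (-ξ).im := by simpa using hξ
  refine ((hasDerivAt_expSeries hg h0).comp ξ (hasDerivAt_neg ξ)).congr_deriv ?_
  ring

theorem exists_polylog_one_of_im_neg : ∃ c : ℂ, ∀ ξ : ℂ, ξ.im < 0 →
    polylog 1 ξ = -(2 * Real.pi * I * ξ) + expSeries (fun m => ((m : ℂ) + 1)⁻¹) (-ξ) + c := by
  refine exists_eq_add_of_hasDerivAt isOpen_im_neg isPreconnected_im_neg
    (fun z hz => hasDerivAt_polylog 0 (Or.inl (ne_of_lt hz))) fun z hz => ?_
  have h1 : ∀ m : ℕ, ((m : ℂ) + 1) * ((m : ℂ) + 1)⁻¹ = 1 := fun m =>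
    mul_inv_cancel₀ (natCast_add_one_ne_zero m)
  have h2 := hasDerivAt_expSeries_neg (g := fun m => ((m : ℂ) + 1)⁻¹) (G := 1)
    (fun m => by rw [h1]; simp) hz
  simp_rw [h1] at h2
  refine ((((hasDerivAt_id z).const_mul (2 * Real.pi * I : ℂ)).neg).add h2).congr_deriv ?_
  rw [polylog_zero_of_im_neg hz]
  ring

theorem expSeries_one_eq {β : ℂ} (hβ : ‖β‖ < 1) {ξ : ℂ} (hξ : 0 < ξ.im) :
    expSeries (fun m => ((m : ℂ) + 1) * ((m : ℂ) + 1 + β)⁻¹) ξ =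
      expSeries (fun _ => 1) ξ - β * expSeries (fun m => ((m : ℂ) + 1 + β)⁻¹) ξ := by
  rw [expSeries, expSeries, expSeries, ← tsum_mul_left]
  have hs : Summable fun m : ℕ => β * (e ξ ^ (m + 1) * ((m : ℂ) + 1 + β)⁻¹) :=
    (summable_expSeries (fun m => (norm_inv_add_le hβ m).2) hξ).mul_left β
  rw [← (summable_expSeries (g := fun _ => 1) (G := 1) (fun m => by simp) hξ).tsum_sub hs]
  refine tsum_congr fun m => ?_
  have h := natCast_add_one_sub_ne_zero (β := -β) (by rwa [norm_neg]) m
  rw [sub_neg_eq_add] at h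
  field_simp
  ring

theorem norm_natCast_mul_inv_le {β : ℂ} (hβ : ‖β‖ < 1) (m : ℕ) :
    ‖((m : ℂ) + 1) * ((m : ℂ) + 1 + β)⁻¹‖ ≤ 1 + ‖β‖ * (1 - ‖β‖)⁻¹ := by
  have h := natCast_add_one_sub_ne_zero (β := -β) (by rwa [norm_neg]) m
  rw [sub_neg_eq_add] at h
  have h1 : ((m : ℂ) + 1) * ((m : ℂ) + 1 + β)⁻¹ = 1 - β * ((m : ℂ) + 1 + β)⁻¹ := by
    field_simp; ring
  rw [h1]
  refine (norm_sub_le _ _).trans ?_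
  rw [norm_one, norm_mul]
  gcongr
  exact (norm_inv_add_le hβ m).2

theorem exists_debye_of_im_neg {β : ℂ} (hβ : ‖β‖ < 1) (hβ0 : β ≠ 0) : ∃ C : ℂ, ∀ ξ : ℂ, ξ.im < 0 →
    debye ξ β = e (-(ξ * β)) * (β⁻¹ + expSeries (fun m => ((m : ℂ) + 1 + β)⁻¹) (-ξ)) + C := by
  refine exists_eq_add_of_hasDerivAt isOpen_im_neg isPreconnected_im_neg
    (fun z hz => hasDerivAt_debye (Or.inl (ne_of_lt hz)) hβ) fun z hz => ?_
  have h0 : 0 < (-z).im := by simpa using hz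
  have h2 := hasDerivAt_expSeries_neg (g := fun m => ((m : ℂ) + 1 + β)⁻¹)
    (norm_natCast_mul_inv_le hβ) hz
  refine ((hasDerivAt_e_neg_mul z β).mul (h2.const_add β⁻¹)).congr_deriv ?_
  rw [polylog_zero_of_im_neg hz, expSeries_one_eq hβ h0]
  field_simp
  ring

/-- Integration in the lower half-plane leaves two unknown constants, c for Li_1 and C for Λ. After
removal of the Li_1 part, the formulas of both half-planes extend continuously to the real line and
agree on (0,1), hence at 0 and at 1. The series are 1-periodic whereas e(-ξβ) and 2πiξ are not, so
eliminating c between the two relations yields C = -2πi/(e(β) - 1). -/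
theorem debye_of_im_neg {ξ β : ℂ} (hξ : ξ.im < 0) (hβ : ‖β‖ < 1) (hβ0 : β ≠ 0) :
    debye ξ β = e (-(ξ * β)) * (β⁻¹ + expSeries (fun m => ((m : ℂ) + 1 + β)⁻¹) (-ξ))
      - 2 * Real.pi * I / (e β - 1) := by
  obtain ⟨c, hc⟩ := exists_polylog_one_of_im_neg
  obtain ⟨C, hC⟩ := exists_debye_of_im_neg hβ hβ0
  have hβ' : ‖-β‖ < 1 := by rwa [norm_neg]
  rw [hC ξ hξ, sub_eq_add_neg]
  congr 1
  have hlow : ∀ z : ℂ, z.im < 0 → debye z β - e (-(z * β)) * polylog 1 z =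
      e (-(z * β)) * (β⁻¹ + expSeries (invDiff (-β)) (-z) + 2 * Real.pi * I * z - c) + C :=
    fun z hz => by
      have h0 : 0 < (-z).im := by simpa using hz
      rw [hC z hz, hc z hz, expSeries_invDiff h0 hβ']
      simp_rw [sub_neg_eq_add]
      ring
  have hcl : ContinuousOn (fun z : ℂ =>
      e (-(z * β)) * (β⁻¹ + expSeries (invDiff (-β)) (-z) + 2 * Real.pi * I * z - c) + C)
      {z | z.im ≤ 0} := by
    have h1 : ContinuousOn (fun z : ℂ => expSeries (invDiff (-β)) (-z)) {z | z.im ≤ 0} :=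
      (continuousOn_expSeries_invDiff_left hβ').comp (f := fun z : ℂ => -z) (by fun_prop)
        fun z hz => by simpa using hz
    refine ContinuousOn.add (ContinuousOn.mul (by fun_prop) ?_) continuousOn_const
    exact ((continuousOn_const.add h1).add (by fun_prop)).sub continuousOn_const
  have hcu : ContinuousOn (fun z : ℂ => e (-(z * β)) * expSeries (invDiff β) z) {z | 0 ≤ z.im} :=
    ContinuousOn.mul (by fun_prop) (continuousOn_expSeries_invDiff_left hβ)
  have heq : Set.EqOn (fun x : ℝ => e (-(x * β)) * expSeries (invDiff β) x)
      (fun x : ℝ => e (-(x * β)) * (β⁻¹ + expSeries (invDiff (-β)) (-x) + 2 * Real.pi * I * x - c)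
        + C) (Set.Ioo 0 1) := fun x hx => by
    have hxs : (x : ℂ) ∈ slitDomain := Or.inr (by simpa using hx)
    have h1 := debye_sub_polylog hxs (by simp) hβ
    have h2 := eq_of_eq_on_ray (x := (x : ℂ)) (c := -I) (continuousAt_debye_sub_polylog hxs hβ)
      (hcl (x : ℂ) (by simp)) fun y hy => ?_
    · exact h1.symm.trans h2
    · have : (x + y * -I : ℂ).im < 0 := by simpa using hy
      exact ⟨this.le, hlow _ this⟩
  have heq' := heq.closure
    (hcu.comp_continuous (f := fun x : ℝ => (x : ℂ)) (by fun_prop) fun x => by simp)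
    (hcl.comp_continuous (f := fun x : ℝ => (x : ℂ)) (by fun_prop) fun x => by simp)
  rw [closure_Ioo zero_ne_one] at heq'
  have e0 := heq' (show (0 : ℝ) ∈ Set.Icc (0 : ℝ) 1 by simp)
  have e1 := heq' (show (1 : ℝ) ∈ Set.Icc (0 : ℝ) 1 by simp)
  have p1 : expSeries (invDiff β) 1 = expSeries (invDiff β) 0 := by
    simp [expSeries, e_one, e_zero]
  have p2 : expSeries (invDiff (-β)) (-1) = expSeries (invDiff (-β)) 0 := by
    simp [expSeries, e_one, e_zero, e_neg]
  simp only [ofReal_zero, ofReal_one, zero_mul, neg_zero, e_zero, one_mul, mul_zero, mul_one] at e0 e1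
  rw [p1, p2, e0, e_neg] at e1
  have hb : e β - 1 ≠ 0 := sub_ne_zero.2 (e_ne_one hβ hβ0)
  have hb' := e_ne_zero β
  rw [← neg_div, eq_div_iff hb]
  linear_combination -(e β) * e1 + (C - 2 * Real.pi * I) * mul_inv_cancel₀ hb'

/-! ### Zeta values -/

theorem hasSum_invDiff {β : ℂ} (hβ : ‖β‖ < 1) (m : ℕ) :
    HasSum (fun k : ℕ => (((m : ℂ) + 1) ^ (k + 2))⁻¹ * β ^ (k + 1)) (invDiff β m) := by
  have h := (hasSum_nat_add_iff' 1).2 (hasSum_inv_sub hβ m)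
  refine hasSum_of_eq h (fun k => rfl) ?_
  simp [invDiff]

theorem hasSum_zeta {β : ℂ} (hβ : ‖β‖ < 1) :
    HasSum (fun k : ℕ => riemannZeta (k + 2) * β ^ (k + 1)) (expSeries (invDiff β) 0) := by
  have hs : Summable fun p : ℕ × ℕ => (((p.2 : ℂ) + 1) ^ (p.1 + 2))⁻¹ * β ^ (p.1 + 1) := by
    have h1 : Summable fun k : ℕ => ‖β‖ ^ (k + 1) :=
      (summable_nat_add_iff 1).2 (summable_geometric_of_lt_one (norm_nonneg β) hβ)
    refine Summable.of_norm_bounded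
      (h1.mul_of_nonneg summable_inv_sq (fun k => by positivity) (fun m => by positivity))
      fun p => ?_
    rw [norm_mul, norm_pow, norm_inv, norm_pow, norm_natCast_add_one, mul_comm]
    have hm : (1 : ℝ) ≤ p.2 + 1 := by linarith [p.2.cast_nonneg (α := ℝ)]
    gcongr
    omega
  have h1 : ∀ k : ℕ, HasSum (fun m : ℕ => (((m : ℂ) + 1) ^ (k + 2))⁻¹ * β ^ (k + 1))
      (riemannZeta (k + 2) * β ^ (k + 1)) := fun k => by
    have h2 : Summable fun n : ℕ => (1 : ℂ) / (n : ℂ) ^ (k + 2) :=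
      Summable.of_norm <| by
        simp
    have h3 : riemannZeta (k + 2) = ∑' m : ℕ, (((m : ℂ) + 1) ^ (k + 2))⁻¹ := by
      have h4 := zeta_nat_eq_tsum_of_gt_one (k := k + 2) (by omega)
      push_cast at h4
      rw [h4, h2.tsum_eq_zero_add]
      simp
    have h5 : Summable fun m : ℕ => (((m : ℂ) + 1) ^ (k + 2))⁻¹ := by
      have := (summable_nat_add_iff 1).2 h2
      simpa using this
    rw [h3]
    exact h5.hasSum.mul_right _
  have h2 := hs.hasSum.prod_fiberwise h1
  have h3 := ((Equiv.prodComm ℕ ℕ).hasSum_iff.2 hs.hasSum).prod_fiberwise (hasSum_invDiff hβ)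
  refine hasSum_of_eq h2 (fun _ => rfl) ?_
  rw [← h3.tsum_eq, expSeries]
  simp [e_zero]

/-! ### The logarithmic singularity at the origin -/

theorem norm_log_le (z : ℂ) : ‖Complex.log z‖ ≤ |Real.log ‖z‖| + Real.pi := by
  refine (Complex.norm_le_abs_re_add_abs_im _).trans ?_
  rw [Complex.log_re, Complex.log_im]
  gcongr
  exact Complex.abs_arg_le_pi z

theorem tendsto_mul_log : Tendsto (fun z : ℂ => z * Complex.log z) (𝓝 0) (𝓝 0) := by
  have h : Tendsto (fun z : ℂ => |‖z‖ * Real.log ‖z‖| + ‖z‖ * Real.pi) (𝓝 0) (𝓝 0) := by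
    have hc : Continuous fun z : ℂ => |‖z‖ * Real.log ‖z‖| + ‖z‖ * Real.pi :=
      (Real.continuous_mul_log.comp continuous_norm).abs.add (by fun_prop)
    simpa using hc.tendsto 0
  refine squeeze_zero_norm (fun z => ?_) h
  rw [norm_mul, abs_mul, abs_norm, ← mul_add]
  gcongr
  exact norm_log_le z

theorem one_sub_e_re_pos {ξ : ℂ} (hξ : 0 ≤ ξ.im) (h1 : e ξ ≠ 1) : 0 < (1 - e ξ).re := by
  have h2 := norm_e_le_one_iff.2 hξ
  have h3 := Complex.re_le_norm (e ξ)
  rw [Complex.sub_re, Complex.one_re, sub_pos]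
  refine lt_of_le_of_ne (h3.trans h2) fun h => h1 ?_
  have h4 : ‖e ξ‖ ^ 2 ≤ 1 := pow_le_one₀ (norm_nonneg _) h2
  rw [Complex.sq_norm, Complex.normSq_apply, h] at h4
  have h5 : (e ξ).im = 0 := by nlinarith
  exact Complex.ext (by simpa using h) (by simpa using h5)

theorem one_sub_e_mem_slitPlane {ξ : ℂ} (hξ : 0 ≤ ξ.im) (h1 : e ξ ≠ 1) :
    1 - e ξ ∈ Complex.slitPlane := Or.inl (one_sub_e_re_pos hξ h1)

theorem polylog_one_eq {ξ : ℂ} (hξ : ξ ∈ slitDomain) (hξ' : 0 ≤ ξ.im) :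
    polylog 1 ξ = -Complex.log (1 - e ξ) := by
  refine eq_of_eq_on_ray (T := {z | 0 ≤ z.im}) (c := I) (hasDerivAt_polylog 0 hξ).continuousAt
    (L := fun ξ => -Complex.log (1 - e ξ)) ?_ fun y hy => ?_
  · refine ContinuousAt.continuousWithinAt (ContinuousAt.neg (ContinuousAt.clog (by fun_prop) ?_))
    exact one_sub_e_mem_slitPlane hξ' (e_ne_one_of_mem_slitDomain hξ)
  · have h0 : 0 < (ξ + y * I).im := by simp; linarith
    refine ⟨h0.le, ?_⟩
    have h1 := (hasSum_nat_add_iff' 1).2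
      (Complex.hasSum_taylorSeries_neg_log (norm_e_lt_one_iff.2 h0))
    rw [polylog_one_of_im_pos h0]
    simp only [Finset.range_one, Finset.sum_singleton, pow_zero, Nat.cast_zero, div_zero,
      sub_zero] at h1
    rw [← h1.tsum_eq, expSeries]
    exact tsum_congr fun m => by push_cast; rw [div_eq_mul_inv]

/-- The function `ξ ↦ Λ(e(ξ),β) + log(-2πiξ)`, continued to the origin. -/
def debyeReg (ξ β : ℂ) : ℂ :=
  -Complex.log (expSlope ξ / (2 * Real.pi * I)) +
    β * expSlope (-(ξ * β)) * (ξ * Complex.log (1 - e ξ)) + e (-(ξ * β)) * expSeries (invDiff β) ξ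

/-- The intersection of a ball around the origin with the closed upper half-plane. -/
def upperBall (r : ℝ) : Set ℂ := {ξ | 0 ≤ ξ.im ∧ ‖ξ‖ < r}

theorem debyeReg_zero (β : ℂ) : debyeReg 0 β = expSeries (invDiff β) 0 := by
  simp [debyeReg, expSlope_zero, e_zero]

theorem exists_expSlope_re_pos : ∃ r : ℝ, 0 < r ∧ r < 1 ∧
    ∀ ξ : ℂ, ‖ξ‖ < r → 0 < (expSlope ξ / (2 * Real.pi * I)).re := by
  have hc : Continuous fun ξ : ℂ => (expSlope ξ / (2 * Real.pi * I)).re :=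
    Complex.continuous_re.comp (differentiable_expSlope.continuous.div_const _)
  have h0 : 0 < (expSlope 0 / (2 * Real.pi * I)).re := by
    rw [expSlope_zero, div_self two_pi_I_ne_zero]; simp
  obtain ⟨r, hr, h⟩ := Metric.eventually_nhds_iff.1 (hc.continuousAt.eventually_const_lt h0)
  refine ⟨min r (1 / 2), by positivity, by simp only [min_lt_iff]; right; norm_num, fun ξ hξ => ?_⟩
  exact h (by rw [dist_zero_right]; exact hξ.trans_le (min_le_left _ _))

/-- No branch jump occurs: -2πiξ has real part 2π Im ξ ≥ 0, so its argument is at most π/2 in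
absolute value, and the second factor, of positive real part, has argument strictly below π/2. -/
theorem log_one_sub_e {ξ : ℂ} (hξ : 0 ≤ ξ.im) (hξ0 : ξ ≠ 0)
    (h : 0 < (expSlope ξ / (2 * Real.pi * I)).re) :
    Complex.log (1 - e ξ) = Complex.log (-(2 * Real.pi * I * ξ)) +
      Complex.log (expSlope ξ / (2 * Real.pi * I)) := by
  have hπ := two_pi_I_ne_zero
  have h1 : 1 - e ξ = -(2 * Real.pi * I * ξ) * (expSlope ξ / (2 * Real.pi * I)) := by
    have := mul_expSlope ξ
    field_simp
    linear_combination this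
  have h2 : expSlope ξ / (2 * Real.pi * I) ≠ 0 := fun h0 => by simp [h0] at h
  rw [h1, Complex.log_mul (neg_ne_zero.2 (mul_ne_zero hπ hξ0)) h2]
  have h3 : |(-(2 * Real.pi * I * ξ)).arg| ≤ Real.pi / 2 := by
    rw [Complex.abs_arg_le_pi_div_two_iff]
    have : (-(2 * Real.pi * I * ξ)).re = 2 * Real.pi * ξ.im := by simp
    rw [this]
    have := Real.pi_pos
    positivity
  have h4 : |(expSlope ξ / (2 * Real.pi * I)).arg| < Real.pi / 2 :=
    Complex.abs_arg_lt_pi_div_two_iff.2 (Or.inl h)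
  rw [abs_le] at h3
  rw [abs_lt] at h4
  constructor <;> linarith

/-- In e(-ξβ) Li_1 = -e(-ξβ) log(1 - e(ξ)) the factor is 1 + (e(-ξβ) - 1). The 1 gives the pure
logarithm, and the bracket is divisible by ξ, leaving the harmless ξ log(1 - e(ξ)). -/
theorem debye_add_log {ξ β : ℂ} (hξ : ξ ∈ slitDomain) (hξ' : 0 ≤ ξ.im) (hβ : ‖β‖ < 1)
    (h : 0 < (expSlope ξ / (2 * Real.pi * I)).re) :
    debye ξ β + Complex.log (-(2 * Real.pi * I * ξ)) = debyeReg ξ β := by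
  have hξ0 : ξ ≠ 0 := by
    rintro rfl
    exact e_ne_one_of_mem_slitDomain hξ e_zero
  have h1 := debye_sub_polylog hξ hξ' hβ
  rw [polylog_one_eq hξ hξ'] at h1
  have h2 := log_one_sub_e hξ' hξ0 h
  have h3 := mul_expSlope (-(ξ * β))
  rw [debyeReg]
  linear_combination h1 - h2 + Complex.log (1 - e ξ) * h3

theorem continuousOn_debyeReg {r b : ℝ} (hr : r ≤ 1) (hb : b < 1)
    (h : ∀ ξ : ℂ, ‖ξ‖ < r → 0 < (expSlope ξ / (2 * Real.pi * I)).re) :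
    ContinuousOn (fun p : ℂ × ℂ => debyeReg p.1 p.2) (upperBall r ×ˢ Metric.closedBall 0 b) := by
  have hes := differentiable_expSlope.continuous
  have h1 : ContinuousOn (fun ξ : ℂ => Complex.log (expSlope ξ / (2 * Real.pi * I)))
      (upperBall r) := by
    refine ContinuousOn.clog (by fun_prop) fun ξ hξ => Or.inl (h ξ hξ.2)
  have h2 : ContinuousOn (fun ξ : ℂ => ξ * Complex.log (1 - e ξ)) (upperBall r) := by
    intro ξ hξ
    by_cases h0 : ξ = 0
    · subst h0
      refine ContinuousAt.continuousWithinAt ?_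
      -- At the origin ξ is replaced by a bounded multiple of z = 1 - e(ξ), and z log z → 0.
      have h3 : Tendsto (fun ξ : ℂ => -(expSlope ξ)⁻¹ * ((1 - e ξ) * Complex.log (1 - e ξ))) (𝓝 0)
          (𝓝 (-(expSlope 0)⁻¹ * 0)) := by
        refine Tendsto.mul ?_ (tendsto_mul_log.comp ?_)
        · exact ((hes.tendsto 0).inv₀ (expSlope_ne_zero (by simp))).neg
        · have : Continuous fun ξ : ℂ => 1 - e ξ := by fun_prop
          simpa [e_zero] using this.tendsto 0
      rw [ContinuousAt, zero_mul]
      rw [mul_zero] at h3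
      refine h3.congr' ?_
      filter_upwards [Metric.ball_mem_nhds (0 : ℂ) one_pos] with z hz
      have h4 := expSlope_ne_zero (mem_ball_zero_iff.1 hz)
      have h5 := mul_expSlope z
      have h6 : 1 - e z = -(z * expSlope z) := by linear_combination h5
      rw [h6]
      field_simp
    · refine ContinuousAt.continuousWithinAt
        (continuousAt_id.mul (ContinuousAt.clog (by fun_prop) ?_))
      exact one_sub_e_mem_slitPlane hξ.1 (e_ne_one (hξ.2.trans_le hr) h0)
  have hfst : Set.MapsTo (Prod.fst : ℂ × ℂ → ℂ) (upperBall r ×ˢ Metric.closedBall 0 b)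
    (upperBall r) := fun p hp => hp.1
  have h3 := h1.comp continuousOn_fst hfst
  have h4 := h2.comp continuousOn_fst hfst
  have h5 : ContinuousOn (fun p : ℂ × ℂ => expSeries (invDiff p.2) p.1)
      (upperBall r ×ˢ Metric.closedBall 0 b) :=
    (continuousOn_expSeries_invDiff hb).mono (Set.prod_mono (fun ξ hξ => hξ.1) subset_rfl)
  refine (h3.neg.add (ContinuousOn.mul (by fun_prop) h4)).add (ContinuousOn.mul (by fun_prop) h5)

/-! ### The fundamental parallelogram -/

theorem rCoord_mul_im (τ : UpperHalfPlane) (ξ : ℂ) : ξ.im = rCoord τ ξ * τ.im := by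
  rw [rCoord, div_mul_cancel₀ _ τ.im_ne_zero]

theorem im_nonneg_of_mem_punctured {τ : UpperHalfPlane} {ξ : ℂ} (hξ : ξ ∈ punctured τ) :
    0 ≤ ξ.im := by
  rw [rCoord_mul_im τ]
  exact mul_nonneg hξ.2.1.1 τ.im_pos.le

theorem im_lt_of_mem_punctured {τ : UpperHalfPlane} {ξ : ℂ} (hξ : ξ ∈ punctured τ) :
    ξ.im < τ.im := by
  rw [rCoord_mul_im τ]
  exact mul_lt_of_lt_one_left τ.im_pos hξ.2.1.2

theorem punctured_subset_slitDomain (τ : UpperHalfPlane) : punctured τ ⊆ slitDomain := by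
  intro ξ hξ
  by_cases h : ξ.im = 0
  · right
    have h1 : sCoord τ ξ = ξ.re := by simp [sCoord, rCoord, h]
    obtain ⟨h2, h3⟩ := hξ.2.2
    rw [h1] at h2 h3
    refine ⟨lt_of_le_of_ne h2 fun h4 => hξ.1 ?_, h3⟩
    exact Complex.ext (by simpa using h4.symm) (by simpa using h)
  · exact Or.inl h

/-! ### The averaged series -/

theorem summable_lambert_pow {q w u : ℂ} (hq : ‖q‖ < 1) (hw : ‖q * w‖ < 1) (hu : ‖q * u‖ < 1)
    {g : ℕ → ℂ} {G : ℝ} (hg : ∀ m, ‖g m‖ ≤ G) :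
    Summable fun m : ℕ => u ^ (m + 1) * lambert q w (m + 1) * g m := by
  have hc : 0 < 1 - ‖q * w‖ := by linarith
  have hG : 0 ≤ G := (norm_nonneg _).trans (hg 0)
  refine Summable.of_norm_bounded
    (summable_pow_succ_mul hu (‖w‖ / (1 - ‖q * w‖) * G)) fun m => ?_
  have h1 := lambert_norm_le hc (one_sub_le_norm hq m)
  rw [norm_mul, norm_mul, norm_pow, norm_mul, mul_pow]
  calc ‖u‖ ^ (m + 1) * ‖lambert q w (m + 1)‖ * ‖g m‖
      ≤ ‖u‖ ^ (m + 1) * (‖q‖ ^ (m + 1) * (‖w‖ / (1 - ‖q * w‖))) * G := by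
        gcongr
        exact hg m
    _ = _ := by ring

/-- For n > 0 the point ξ + nτ is in the upper half-plane, for n < 0 in the lower one, and the
corresponding Debye formulas apply. The factor e(nα) combines with e(-nτβ) to w^n, while the
connection constant keeps the factor e(nα). This accounts for the annulus: |qw| < 1 for positive n,
|w| > 1 and |e(α)| > 1 for the geometric series over negative n. -/
theorem hasSum_avgTerm {τ : UpperHalfPlane} {ξ α β : ℂ} (hξ : ξ ∈ punctured τ)
    (h : InAnnulus τ α β) (hβ : ‖β‖ < 1) (hβ0 : β ≠ 0) :
    HasSum (avgTerm ξ α β τ) (debye ξ β +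
      e (-(ξ * β)) * (lambertT (e τ) (e ξ) (e (α - τ * β)) β + (β * (e (α - τ * β) - 1))⁻¹) -
      2 * Real.pi * I / ((e β - 1) * (e α - 1))) := by
  obtain ⟨hv, hw1, hw2⟩ := h
  have hq := norm_e_tau_lt_one τ
  have hq0 : 0 < ‖e τ‖ := norm_pos_iff.2 (e_ne_zero _)
  obtain ⟨w, hw⟩ : ∃ w, w = e (α - τ * β) := ⟨_, rfl⟩
  rw [← hw] at hw1 hw2 ⊢
  have hw0 : w ≠ 0 := hw ▸ e_ne_zero _
  have hqw : ‖e τ * w‖ < 1 := by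
    rw [norm_mul]
    have := mul_lt_mul_of_pos_left hw2 hq0
    rwa [mul_inv_cancel₀ hq0.ne'] at this
  have hqw' : ‖e τ * w⁻¹‖ < 1 := by
    rw [norm_mul, norm_inv]
    exact mul_lt_one_of_nonneg_of_lt_one_left (norm_nonneg _) hq (inv_le_one_of_one_le₀ hw1.le)
  have him := im_nonneg_of_mem_punctured hξ
  have him' := im_lt_of_mem_punctured hξ
  -- Both |qu| < 1 and |qu⁻¹| < 1 follow from 0 ≤ Im ξ < Im τ.
  have hqu : ‖e τ * e ξ‖ < 1 := by
    rw [← e_add, norm_e_lt_one_iff, Complex.add_im]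
    have := τ.im_pos
    rw [UpperHalfPlane.coe_im]
    linarith
  have hqu' : ‖e τ * (e ξ)⁻¹‖ < 1 := by
    rw [← e_neg, ← e_add, norm_e_lt_one_iff, Complex.add_im, Complex.neg_im,
      UpperHalfPlane.coe_im]
    linarith
  have g1 : ∀ m : ℕ, ‖((m : ℂ) + 1 - β)⁻¹‖ ≤ (1 - ‖β‖)⁻¹ := fun m => (norm_inv_add_le hβ m).1
  have g2 : ∀ m : ℕ, ‖((m : ℂ) + 1 + β)⁻¹‖ ≤ (1 - ‖β‖)⁻¹ := fun m => (norm_inv_add_le hβ m).2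
  have hT : lambertT (e τ) (e ξ) w β =
      (∑' m : ℕ, e ξ ^ (m + 1) * lambert (e τ) w (m + 1) * ((m : ℂ) + 1 - β)⁻¹) +
      ∑' m : ℕ, (e ξ)⁻¹ ^ (m + 1) * lambert (e τ) w⁻¹ (m + 1) * ((m : ℂ) + 1 + β)⁻¹ :=
    (summable_lambert_pow hq hqw hqu g1).tsum_add (summable_lambert_pow hq hqw' hqu' g2)
  have s1 := (hasSum_lambert hq hqw hqu g1).mul_left (e (-(ξ * β)))
  have s2 := (hasSum_lambert hq hqw' hqu' g2).mul_left (e (-(ξ * β)))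
  have s3 := (hasSum_inv_pow_succ hw1).mul_left (e (-(ξ * β)) * β⁻¹)
  have s4 := (hasSum_inv_pow_succ hv).mul_left (2 * Real.pi * I / (e β - 1))
  have pos : HasSum (fun n : ℕ => avgTerm ξ α β τ (n + 1 : ℕ)) (e (-(ξ * β)) *
      ∑' m : ℕ, e ξ ^ (m + 1) * lambert (e τ) w (m + 1) * ((m : ℂ) + 1 - β)⁻¹) := by
    refine hasSum_of_eq s1 (fun n => ?_) rfl
    have hp : 0 < (ξ + ((n + 1 : ℕ) : ℤ) * τ : ℂ).im := by
      have h1 : (ξ + ((n + 1 : ℕ) : ℤ) * τ : ℂ).im = ξ.im + (n + 1) * τ.im := by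
        push_cast
        simp
      rw [h1]
      have := τ.im_pos
      positivity
    rw [avgTerm, debye_eq_of_im_pos hp hβ, ← mul_assoc, ← e_add]
    have h2 : (((n + 1 : ℕ) : ℤ) : ℂ) * α + -((ξ + ((n + 1 : ℕ) : ℤ) * τ) * β) =
        -(ξ * β) + ((n + 1 : ℕ) : ℂ) * (α - τ * β) := by push_cast; ring
    have h3 : e (ξ + ((n + 1 : ℕ) : ℤ) * τ) = e τ ^ (n + 1) * e ξ := by
      rw [e_add, ← e_nat_mul, mul_comm]; push_cast; rfl
    rw [h2, e_add, e_nat_mul, ← hw, expSeries, h3, mul_assoc]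
  have neg : HasSum (fun n : ℕ => avgTerm ξ α β τ (-(n + 1 : ℤ))) (e (-(ξ * β)) *
      (∑' m : ℕ, (e ξ)⁻¹ ^ (m + 1) * lambert (e τ) w⁻¹ (m + 1) * ((m : ℂ) + 1 + β)⁻¹) +
      e (-(ξ * β)) * β⁻¹ * (1 / (w - 1)) - 2 * Real.pi * I / (e β - 1) * (1 / (e α - 1))) := by
    refine hasSum_of_eq ((s2.add s3).sub s4) (fun n => ?_) rfl
    have hn : (ξ + (-(n + 1 : ℤ) : ℤ) * τ : ℂ).im < 0 := by
      have h1 : (ξ + (-(n + 1 : ℤ) : ℤ) * τ : ℂ).im = ξ.im - (n + 1) * τ.im := by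
        push_cast
        simp
        ring
      rw [h1]
      have := τ.im_pos
      have hn0 : (0 : ℝ) ≤ n := n.cast_nonneg
      nlinarith
    rw [avgTerm, debye_of_im_neg hn hβ hβ0, mul_sub, ← mul_assoc, ← e_add]
    have h2 : ((-(n + 1 : ℤ) : ℤ) : ℂ) * α + -((ξ + (-(n + 1 : ℤ) : ℤ) * τ) * β) =
        -(ξ * β) + -(((n + 1 : ℕ) : ℂ) * (α - τ * β)) := by push_cast; ring
    have h3 : e (-(ξ + (-(n + 1 : ℤ) : ℤ) * τ)) = e τ ^ (n + 1) * (e ξ)⁻¹ := by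
      rw [neg_add, e_add, ← e_nat_mul, ← e_neg, mul_comm]
      congr 2
      push_cast
      ring
    have h4 : ((-(n + 1 : ℤ) : ℤ) : ℂ) * α = -(((n + 1 : ℕ) : ℂ) * α) := by push_cast; ring
    rw [h2, e_add, e_neg (((n + 1 : ℕ) : ℂ) * (α - τ * β)), e_nat_mul, ← hw, expSeries, h3, h4,
      e_neg (((n + 1 : ℕ) : ℂ) * α), e_nat_mul, inv_pow, inv_pow]
    ring
  have hpos := (hasSum_nat_add_iff (f := fun n : ℕ => avgTerm ξ α β τ n) 1).1 pos
  refine hasSum_of_eq (HasSum.of_nat_of_neg_add_one hpos neg) (fun _ => rfl) ?_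
  have h0 : avgTerm ξ α β τ ((0 : ℕ) : ℤ) = debye ξ β := by simp [avgTerm, e_zero]
  rw [Finset.range_one, Finset.sum_singleton, h0, hT]
  have hw1' : w - 1 ≠ 0 := sub_ne_zero.2 fun h => by simp [h] at hw1
  have hv' : e α - 1 ≠ 0 := sub_ne_zero.2 fun h => by simp [h] at hv
  have hb' : e β - 1 ≠ 0 := sub_ne_zero.2 (e_ne_one hβ hβ0)
  field_simp
  ring

theorem E_eq {τ : UpperHalfPlane} {ξ α β : ℂ} (hξ : ξ ∈ punctured τ)
    (h : InAnnulus τ α β) (hβ : ‖β‖ < 1) (hβ0 : β ≠ 0) :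
    E ξ α β τ = debye ξ β +
      e (-(ξ * β)) * (lambertT (e τ) (e ξ) (e (α - τ * β)) β + (β * (e (α - τ * β) - 1))⁻¹) -
      2 * Real.pi * I / ((e β - 1) * (e α - 1)) := (hasSum_avgTerm hξ h hβ hβ0).tsum_eq

/-! ### Regularity of the Lambert series -/

/-- The closed strip `0 ≤ Im ξ ≤ h`. -/
def strip (h : ℝ) : Set ℂ := {ξ | 0 ≤ ξ.im ∧ ξ.im ≤ h}

/-- On the strip |e(ξ)| and |e(ξ)⁻¹| are at most exp(2πh), so q^m e(±mξ) is dominated by |e(τ -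
ih)|^m, which is summable when h < Im τ. -/
theorem lambertT_term_le {τ : UpperHalfPlane} {U : Set ℂ} {c W h b : ℝ}
    (hU : LambertBound (e τ) U c W) (hh : 0 ≤ h) (hb : b < 1) {ξ α β : ℂ}
    (hξ : ξ ∈ strip h) (hα : α ∈ U) (hβ : ‖β‖ ≤ b) (m : ℕ) :
    ‖e ξ ^ (m + 1) * lambert (e τ) (e α) (m + 1) * ((m : ℂ) + 1 - β)⁻¹ +
      (e ξ)⁻¹ ^ (m + 1) * lambert (e τ) (e α)⁻¹ (m + 1) * ((m : ℂ) + 1 + β)⁻¹‖ ≤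
    ‖e (τ - h * I)‖ ^ (m + 1) * (2 * (W / c * (1 - b)⁻¹)) := by
  obtain ⟨l1, l2⟩ := hU.norm_lambert_le hα m
  obtain ⟨n1, n2⟩ := norm_inv_add_le (hβ.trans_lt hb) m
  have hc := hU.1
  have hW : 0 ≤ W := (norm_nonneg _).trans (hU.2 α hα).1
  have hb1 : (1 - ‖β‖)⁻¹ ≤ (1 - b)⁻¹ := inv_anti₀ (by linarith) (by linarith)
  have hb0 : 0 ≤ (1 - b)⁻¹ := inv_nonneg.2 (by linarith)
  have e1 : ‖e ξ ^ (m + 1)‖ * ‖e τ‖ ^ (m + 1) ≤ ‖e (τ - h * I)‖ ^ (m + 1) := by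
    rw [norm_pow, ← mul_pow]
    refine pow_le_pow_left₀ (by positivity) ?_ _
    rw [← norm_mul, ← e_add, norm_e, norm_e, Real.exp_le_exp, neg_le_neg_iff]
    have : (τ - h * I : ℂ).im = τ.im - h := by simp
    rw [this, Complex.add_im, UpperHalfPlane.coe_im]
    have := hξ.1
    have := Real.pi_pos
    gcongr
    linarith
  have e2 : ‖(e ξ)⁻¹ ^ (m + 1)‖ * ‖e τ‖ ^ (m + 1) ≤ ‖e (τ - h * I)‖ ^ (m + 1) := by
    rw [norm_pow, ← mul_pow]
    refine pow_le_pow_left₀ (by positivity) ?_ _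
    rw [← norm_mul, ← e_neg, ← e_add, norm_e, norm_e, Real.exp_le_exp, neg_le_neg_iff]
    have : (τ - h * I : ℂ).im = τ.im - h := by simp
    rw [this, Complex.add_im, Complex.neg_im, UpperHalfPlane.coe_im]
    have := hξ.2
    have := Real.pi_pos
    gcongr
    linarith
  have key : ∀ x y z : ℂ, ‖x‖ * ‖e τ‖ ^ (m + 1) ≤ ‖e (τ - h * I)‖ ^ (m + 1) →
      ‖y‖ ≤ ‖e τ‖ ^ (m + 1) * (W / c) → ‖z‖ ≤ (1 - ‖β‖)⁻¹ →
      ‖x * y * z‖ ≤ ‖e (τ - h * I)‖ ^ (m + 1) * (W / c * (1 - b)⁻¹) := fun x y z hx hy hz => by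
    rw [norm_mul, norm_mul]
    calc ‖x‖ * ‖y‖ * ‖z‖ ≤ ‖x‖ * (‖e τ‖ ^ (m + 1) * (W / c)) * (1 - b)⁻¹ := by
          gcongr
          exact hz.trans hb1
      _ = ‖x‖ * ‖e τ‖ ^ (m + 1) * (W / c * (1 - b)⁻¹) := by ring
      _ ≤ _ := by gcongr
  refine (norm_add_le_of_le (key _ _ _ e1 l1 n1) (key _ _ _ e2 l2 n2)).trans_eq ?_
  ring

theorem summable_strip_bound {τ : UpperHalfPlane} {h : ℝ} (hh : h < τ.im) (K : ℝ) :
    Summable fun m : ℕ => ‖e (τ - h * I)‖ ^ (m + 1) * K := by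
  refine summable_pow_succ_mul (norm_e_lt_one_iff.2 ?_) K
  have : (τ - h * I : ℂ).im = τ.im - h := by simp
  rw [this]
  linarith

theorem continuousOn_lambertT {τ : UpperHalfPlane} {U : Set ℂ} {c W h b : ℝ}
    (hU : LambertBound (e τ) U c W) (hh : 0 ≤ h) (hh' : h < τ.im) (hb : b < 1) :
    ContinuousOn (fun p : ℂ × ℂ × ℂ => lambertT (e τ) (e p.1) (e p.2.1) p.2.2)
      (strip h ×ˢ U ×ˢ Metric.closedBall 0 b) := by
  refine continuousOn_tsum (fun m => ?_) (summable_strip_bound hh' (2 * (W / c * (1 - b)⁻¹)))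
    fun m p hp => lambertT_term_le hU hh hb hp.1 hp.2.1 (mem_closedBall_zero_iff.1 hp.2.2) m
  obtain ⟨d1, d2⟩ := differentiableOn_lambert hU m
  have hm : Set.MapsTo (fun p : ℂ × ℂ × ℂ => p.2.1) (strip h ×ˢ U ×ˢ Metric.closedBall 0 b) U :=
    fun p hp => hp.2.1
  have c1 := d1.continuousOn.comp (continuous_fst.comp continuous_snd).continuousOn hm
  have c2 := d2.continuousOn.comp (continuous_fst.comp continuous_snd).continuousOn hm
  have hβ : ∀ p ∈ strip h ×ˢ U ×ˢ Metric.closedBall (0 : ℂ) b, ‖p.2.2‖ < 1 := fun p hp =>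
    (mem_closedBall_zero_iff.1 hp.2.2).trans_lt hb
  have c3 : ContinuousOn (fun p : ℂ × ℂ × ℂ => ((m : ℂ) + 1 - p.2.2)⁻¹)
      (strip h ×ˢ U ×ˢ Metric.closedBall 0 b) :=
    ContinuousOn.inv₀ (by fun_prop) fun p hp => natCast_add_one_sub_ne_zero (hβ p hp) m
  have c4 : ContinuousOn (fun p : ℂ × ℂ × ℂ => ((m : ℂ) + 1 + p.2.2)⁻¹)
      (strip h ×ˢ U ×ˢ Metric.closedBall 0 b) :=
    ContinuousOn.inv₀ (by fun_prop) fun p hp => by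
      have := natCast_add_one_sub_ne_zero (β := -p.2.2) (by rw [norm_neg]; exact hβ p hp) m
      rwa [sub_neg_eq_add] at this
  have c5 : Continuous fun p : ℂ × ℂ × ℂ => (e p.1)⁻¹ :=
    (continuous_e.comp continuous_fst).inv₀ fun p => e_ne_zero _
  have c6 : Continuous fun p : ℂ × ℂ × ℂ => e p.1 := continuous_e.comp continuous_fst
  exact ((((c6.pow _).continuousOn).mul c1).mul c3).add
    ((((c5.pow _).continuousOn).mul c2).mul c4)

theorem differentiableOn_lambertT_comp {τ : UpperHalfPlane} {U V : Set ℂ} {c W h b : ℝ}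
    (hU : LambertBound (e τ) U c W) (hh : 0 ≤ h) (hh' : h < τ.im) (hb : b < 1)
    {ξ : ℂ} (hξ : ξ ∈ strip h) (hV : IsOpen V) {a β : ℂ → ℂ} (ha : DifferentiableOn ℂ a V)
    (hβ : DifferentiableOn ℂ β V) (haU : Set.MapsTo a V U) (hβb : ∀ z ∈ V, ‖β z‖ ≤ b) :
    DifferentiableOn ℂ (fun z => lambertT (e τ) (e ξ) (e (a z)) (β z)) V := by
  refine differentiableOn_tsum_of_summable_norm
    (summable_strip_bound hh' (2 * (W / c * (1 - b)⁻¹))) (fun m => ?_) hV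
    fun m z hz => lambertT_term_le hU hh hb hξ (haU hz) (hβb z hz) m
  obtain ⟨d1, d2⟩ := differentiableOn_lambert hU m
  have c1 := d1.comp ha haU
  have c2 := d2.comp ha haU
  have c3 : DifferentiableOn ℂ (fun z => ((m : ℂ) + 1 - β z)⁻¹) V :=
    (hβ.const_sub _).inv fun z hz => natCast_add_one_sub_ne_zero ((hβb z hz).trans_lt hb) m
  have c4 : DifferentiableOn ℂ (fun z => ((m : ℂ) + 1 + β z)⁻¹) V :=
    (hβ.const_add _).inv fun z hz => by
      have := natCast_add_one_sub_ne_zero (β := -β z)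
        (by rw [norm_neg]; exact (hβb z hz).trans_lt hb) m
      rwa [sub_neg_eq_add] at this
  exact ((c1.const_mul _).mul c3).add ((c2.const_mul _).mul c4)

/-! ### The value of the generating series at the origin -/

theorem norm_rCoord_add_sCoord_le (τ : UpperHalfPlane) (X Y : ℂ) : ∃ K, ∀ ξ : ℂ,
    ‖(rCoord τ ξ : ℂ) * X + sCoord τ ξ * Y‖ ≤ K * ‖ξ‖ := by
  refine ⟨(τ.im)⁻¹ * ‖X‖ + (1 + (τ.im)⁻¹ * |τ.re|) * ‖Y‖, fun ξ => ?_⟩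
  have hτ := τ.im_pos
  have h1 : |rCoord τ ξ| ≤ (τ.im)⁻¹ * ‖ξ‖ := by
    rw [rCoord, abs_div, abs_of_pos hτ, div_eq_inv_mul]
    gcongr
    exact Complex.abs_im_le_norm ξ
  have h2 : |sCoord τ ξ| ≤ (1 + (τ.im)⁻¹ * |τ.re|) * ‖ξ‖ := by
    rw [sCoord]
    refine (abs_sub _ _).trans ?_
    rw [abs_mul, add_mul, one_mul]
    have := Complex.abs_re_le_norm ξ
    calc |ξ.re| + |rCoord τ ξ| * |τ.re| ≤ ‖ξ‖ + (τ.im)⁻¹ * ‖ξ‖ * |τ.re| := by gcongr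
      _ = _ := by ring
  refine (norm_add_le _ _).trans ?_
  rw [norm_mul, norm_mul, Complex.norm_real, Complex.norm_real, Real.norm_eq_abs, Real.norm_eq_abs]
  calc _ ≤ (τ.im)⁻¹ * ‖ξ‖ * ‖X‖ + (1 + (τ.im)⁻¹ * |τ.re|) * ‖ξ‖ * ‖Y‖ := by gcongr
    _ = _ := by ring

theorem tendsto_mul_log_neg_two_pi_I :
    Tendsto (fun ξ : ℂ => ξ * Complex.log (-(2 * Real.pi * I * ξ))) (𝓝 0) (𝓝 0) := by
  have h0 : Continuous fun ξ : ℂ => -(2 * Real.pi * I * ξ) := by fun_prop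
  have h1 := h0.tendsto 0
  rw [mul_zero, neg_zero] at h1
  have h2 := (tendsto_mul_log.comp h1).const_mul (-(2 * Real.pi * I))⁻¹
  rw [mul_zero] at h2
  refine h2.congr fun ξ => ?_
  have := two_pi_I_ne_zero
  simp only [Function.comp]
  field_simp

/-- Levin's prefactor exp(rX + sY) is 1 + O(|ξ|), so it multiplies the logarithmic singularity
without altering the regularized limit. -/
theorem tendsto_one_sub_exp_mul_log (τ : UpperHalfPlane) (X Y : ℂ) :
    Tendsto (fun ξ : ℂ => (1 - Complex.exp (rCoord τ ξ * X + sCoord τ ξ * Y)) *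
      Complex.log (-(2 * Real.pi * I * ξ))) (𝓝 0) (𝓝 0) := by
  obtain ⟨K, hK⟩ := norm_rCoord_add_sCoord_le τ X Y
  have hlin : Tendsto (fun ξ : ℂ => (rCoord τ ξ : ℂ) * X + sCoord τ ξ * Y) (𝓝 0) (𝓝 0) := by
    refine squeeze_zero_norm hK ?_
    simpa using (continuous_norm (E := ℂ)).tendsto 0 |>.const_mul K
  have h1 : Tendsto (fun ξ : ℂ => ((rCoord τ ξ : ℂ) * X + sCoord τ ξ * Y) *
      Complex.log (-(2 * Real.pi * I * ξ))) (𝓝 0) (𝓝 0) := by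
    have h2 := tendsto_mul_log_neg_two_pi_I.norm.const_mul K
    rw [norm_zero, mul_zero] at h2
    refine squeeze_zero_norm (fun ξ => ?_) h2
    rw [norm_mul, norm_mul, ← mul_assoc]
    exact mul_le_mul_of_nonneg_right (hK ξ) (norm_nonneg _)
  have hπ := two_pi_I_ne_zero
  have hs : Continuous fun z : ℂ => -(expSlope (z / (2 * Real.pi * I)) / (2 * Real.pi * I)) := by
    have := differentiable_expSlope.continuous
    fun_prop
  have h2 := ((hs.tendsto 0).comp hlin).mul h1
  rw [mul_zero] at h2
  refine h2.congr fun ξ => ?_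
  obtain ⟨z, hz⟩ : ∃ z, z = (rCoord τ ξ : ℂ) * X + sCoord τ ξ * Y := ⟨_, rfl⟩
  simp only [Function.comp, ← hz]
  have h3 := mul_expSlope (z / (2 * Real.pi * I))
  have h4 : e (z / (2 * Real.pi * I)) = Complex.exp z := by rw [e, mul_div_cancel₀ _ hπ]
  rw [h4] at h3
  linear_combination (-Complex.log (-(2 * Real.pi * I * ξ))) * h3

theorem tendsto_exp_coord (τ : UpperHalfPlane) (X Y : ℂ) :
    Tendsto (fun ξ : ℂ => Complex.exp (rCoord τ ξ * X + sCoord τ ξ * Y)) (𝓝 0) (𝓝 1) := by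
  obtain ⟨K, hK⟩ := norm_rCoord_add_sCoord_le τ X Y
  have hlin : Tendsto (fun ξ : ℂ => (rCoord τ ξ : ℂ) * X + sCoord τ ξ * Y) (𝓝 0) (𝓝 0) := by
    refine squeeze_zero_norm hK ?_
    simpa using (continuous_norm (E := ℂ)).tendsto 0 |>.const_mul K
  have := (Complex.continuous_exp.tendsto 0).comp hlin
  rwa [Complex.exp_zero] at this

/-- The part of a neighbourhood of the origin in the closed upper half-plane with
`Im ξ ≤ Im τ / 2`. -/
def nearZero (τ : UpperHalfPlane) (r : ℝ) : Set ℂ :=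
  {ξ | (0 ≤ ξ.im ∧ ‖ξ‖ < r) ∧ ξ.im ≤ τ.im / 2}

theorem zero_mem_nearZero (τ : UpperHalfPlane) {r : ℝ} (hr : 0 < r) : (0 : ℂ) ∈ nearZero τ r := by
  refine ⟨⟨by simp, by simpa using hr⟩, ?_⟩
  rw [Complex.zero_im]
  linarith [τ.im_pos]

theorem eventually_mem_nearZero (τ : UpperHalfPlane) {r : ℝ} (hr : 0 < r) :
    ∀ᶠ ξ in 𝓝[punctured τ] (0 : ℂ), ξ ∈ nearZero τ r := by
  have hτ := τ.im_pos
  have h1 : ∀ᶠ ξ : ℂ in 𝓝 0, ‖ξ‖ < r ∧ ξ.im < τ.im / 2 :=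
    (continuous_norm.continuousAt.eventually_lt continuousAt_const (by simpa using hr)).and
      (Complex.continuous_im.continuousAt.eventually_lt continuousAt_const
        (by rw [Complex.zero_im]; linarith))
  filter_upwards [h1.filter_mono nhdsWithin_le_nhds, eventually_mem_nhdsWithin] with ξ h1 h2
  exact ⟨⟨im_nonneg_of_mem_punctured h2, h1.1⟩, h1.2.le⟩

theorem tendsto_nearZero (τ : UpperHalfPlane) {r : ℝ} (hr : 0 < r) :
    Tendsto (fun ξ : ℂ => ξ) (𝓝[punctured τ] 0) (𝓝[nearZero τ r] 0) :=
  tendsto_nhdsWithin_iff.2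
    ⟨tendsto_id.mono_left nhdsWithin_le_nhds, eventually_mem_nearZero τ hr⟩

theorem tendsto_E_add_log {τ : UpperHalfPlane} {α β : ℂ} (h : InAnnulus τ α β) (hβ : ‖β‖ < 1)
    (hβ0 : β ≠ 0)
    {c W : ℝ} (hb : LambertBound (e τ) {α - τ * β} c W) :
    Tendsto (fun ξ : ℂ => E ξ α β τ + Complex.log (-(2 * Real.pi * I * ξ))) (𝓝[punctured τ] 0)
      (𝓝 (expSeries (invDiff β) 0 + (lambertT (e τ) 1 (e (α - τ * β)) β +
        (β * (e (α - τ * β) - 1))⁻¹) - 2 * Real.pi * I / ((e β - 1) * (e α - 1)))) := by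
  obtain ⟨r, hr, hr1, hre⟩ := exists_expSlope_re_pos
  have hτ := τ.im_pos
  have c1 : ContinuousOn (fun ξ => debyeReg ξ β) (nearZero τ r) :=
    (continuousOn_debyeReg hr1.le hβ hre).comp (f := fun ξ => (ξ, β)) (by fun_prop)
      fun ξ hξ => ⟨hξ.1, by simp⟩
  have c2 : ContinuousOn (fun ξ => lambertT (e τ) (e ξ) (e (α - τ * β)) β) (nearZero τ r) :=
    (continuousOn_lambertT hb (h := τ.im / 2) (by linarith) (by linarith) hβ).comp
      (f := fun ξ => (ξ, α - τ * β, β)) (by fun_prop)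
      fun ξ hξ => ⟨⟨hξ.1.1, hξ.2⟩, rfl, by simp⟩
  have c3 : ContinuousOn (fun ξ => debyeReg ξ β + e (-(ξ * β)) *
      (lambertT (e τ) (e ξ) (e (α - τ * β)) β + (β * (e (α - τ * β) - 1))⁻¹) -
      2 * Real.pi * I / ((e β - 1) * (e α - 1))) (nearZero τ r) :=
    (c1.add (ContinuousOn.mul (by fun_prop) (c2.add continuousOn_const))).sub continuousOn_const
  have key := (c3 0 (zero_mem_nearZero τ hr)).tendsto.comp (tendsto_nearZero τ hr)
  rw [debyeReg_zero, zero_mul, neg_zero, e_zero, one_mul] at key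
  refine key.congr' ?_
  filter_upwards [eventually_mem_nearZero τ hr, eventually_mem_nhdsWithin] with ξ h1 h2
  have h3 := debye_add_log (punctured_subset_slitDomain τ h2) h1.1.1 hβ (hre ξ h1.1.2)
  rw [E_eq h2 h hβ hβ0]
  simp only [Function.comp]
  rw [← h3]
  ring

theorem tendsto_Xi {τ : UpperHalfPlane} {X Y l : ℂ}
    (h : Tendsto (fun ξ : ℂ => E ξ (X / (2 * Real.pi * I)) (Y / (2 * Real.pi * I)) τ +
      Complex.log (-(2 * Real.pi * I * ξ))) (𝓝[punctured τ] 0) (𝓝 l)) :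
    Tendsto (fun ξ : ℂ => Xi ξ X Y τ
      - 1 / (2 * Real.pi * I) * Complex.log (-(2 * Real.pi * I * ξ)))
      (𝓝[punctured τ] 0) (𝓝 (-(1 / (2 * Real.pi * I)) * l)) := by
  have h1 := (tendsto_exp_coord τ X Y).mono_left (nhdsWithin_le_nhds (s := punctured τ))
  have h2 := (tendsto_one_sub_exp_mul_log τ X Y).mono_left (nhdsWithin_le_nhds (s := punctured τ))
  have h3 := ((h1.mul h).add h2).const_mul (-(1 / (2 * Real.pi * I) : ℂ))
  rw [one_mul, add_zero] at h3
  refine h3.congr fun ξ => ?_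
  rw [Xi]
  ring

/-! ### The terms n = 0 and the comparison of the two generating series -/

theorem aCoef_zero (q : ℂ) (j : ℕ) : aCoef q 0 j = 1 / ((j : ℂ) + 1) := by
  have h1 : ∀ t : ℝ, kroneckerCoef q 0 t * (t : ℂ) ^ j = ((t ^ j : ℝ) : ℂ) := fun t => by
    simp [kroneckerCoef, kroneckerB_zero]
  rw [aCoef]
  simp_rw [h1]
  rw [intervalIntegral.integral_ofReal, integral_pow]
  simp

theorem hasSum_exp_slope {y : ℂ} (hy : y ≠ 0) :
    HasSum (fun j : ℕ => 1 / ((j : ℂ) + 1) * (y ^ j / j.factorial)) ((Complex.exp y - 1) / y) := by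
  have h1 : HasSum (fun n : ℕ => y ^ n / n.factorial) (Complex.exp y) := by
    rw [Complex.exp_eq_exp_ℂ]
    exact NormedSpace.expSeries_div_hasSum_exp y
  have h2 := ((hasSum_nat_add_iff' 1).2 h1).div_const y
  refine hasSum_of_eq h2 (fun j => ?_) (by simp)
  have h3 := natCast_add_one_ne_zero j
  have h4 : ((j.factorial : ℕ) : ℂ) ≠ 0 := by exact_mod_cast j.factorial_ne_zero
  rw [Nat.factorial_succ, pow_succ]
  push_cast
  field_simp

/-- Splitting off the pole of the generating series of depth one. -/
theorem tsum_genTerm_eq {a : ℕ → ℕ → ℂ} {q : ℂ}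
    (ha : ∀ n r, a n (r + 1) = (2 * Real.pi * I) ^ r / r.factorial *
      (2 * Real.pi * I / (2 * Real.pi * I) ^ n) * aCoef q n r) {α y : ℂ} (hy : y ≠ 0)
    (hs : Summable (genTerm a (2 * Real.pi * I * α) y)) :
    ∑' p, genTerm a (2 * Real.pi * I * α) y p = α⁻¹ * ((Complex.exp y - 1) / y) +
      ∑' p : ℕ × ℕ, genTerm a (2 * Real.pi * I * α) y (p.1 + 1, p.2) := by
  have hs' : Summable fun p : ℕ × ℕ => genTerm a (2 * Real.pi * I * α) y (p.1 + 1, p.2) :=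
    hs.comp_injective (i := fun p : ℕ × ℕ => (p.1 + 1, p.2)) fun p r h => by
      simp only [Prod.mk.injEq, Nat.add_right_cancel_iff] at h
      exact Prod.ext h.1 h.2
  rw [hs.tsum_prod, hs'.tsum_prod, hs.prod.tsum_eq_zero_add]
  congr 1
  rw [← (hasSum_exp_slope hy).tsum_eq, ← tsum_mul_left]
  refine tsum_congr fun j => ?_
  rw [genTerm_of_aCoef ha, aCoef_zero]
  simp only [Nat.cast_zero, zero_sub, zpow_neg_one]
  ring

theorem summable_zeta {β : ℂ} (hβ : ‖β‖ < 1) :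
    HasSum (fun k : ℕ => riemannZeta (k + 2) / (2 * Real.pi * I) ^ (k + 2) *
      (2 * Real.pi * I * β) ^ (k + 1)) ((2 * Real.pi * I)⁻¹ * expSeries (invDiff β) 0) := by
  have hπ := two_pi_I_ne_zero
  refine hasSum_of_eq ((hasSum_zeta hβ).mul_left (2 * Real.pi * I : ℂ)⁻¹) (fun k => ?_) rfl
  obtain ⟨c, hc⟩ : ∃ c : ℂ, c = 2 * Real.pi * I := ⟨_, rfl⟩
  rw [← hc] at hπ ⊢
  rw [mul_pow, pow_succ c (k + 1)]
  field_simp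

/-- Both sides are now explicit in w = e(α - τβ), e(α), e(β), the zeta series and `lambertT` at u =
1; what remains is an identity of rational functions in these quantities. -/
theorem generating_series_at_origin (τ : UpperHalfPlane) {α β : ℂ} (hβ0 : β ≠ 0) (hα : ‖α‖ < 1)
    (hβ : ‖β‖ < 1) (hαβ : ∀ m n : ℤ, (m, n) ≠ (0, 0) → ‖α - τ * β‖ < ‖(m : ℂ) * τ + n‖)
    (h : InAnnulus τ α β) {X Y : ℂ} (hX : X = 2 * Real.pi * I * α) (hY : Y = 2 * Real.pi * I * β) :
    (∀ ξ ∈ punctured τ,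
      Summable (avgTerm ξ (X / (2 * Real.pi * I)) (Y / (2 * Real.pi * I)) τ)) ∧
    Summable (genTerm (fun n r => A n r τ) (X - τ * Y) (-Y)) ∧
    Summable (genTerm AInf X (-Y)) ∧
    Summable (fun k : ℕ => riemannZeta (k + 2) / (2 * Real.pi * I) ^ (k + 2) * Y ^ (k + 1)) ∧
    Tendsto (fun ξ : ℂ => Xi ξ X Y τ
        - 1 / (2 * Real.pi * I) * Complex.log (-(2 * Real.pi * I * ξ)))
      (𝓝[punctured τ] 0)
      (𝓝 (-(calAInf X (-Y) / (2 * Real.pi * I * (Complex.exp (-Y) - 1)))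
        + calA (X - τ * Y) (-Y) τ / (2 * Real.pi * I * (Complex.exp (-Y) - 1))
        + 1 / (Complex.exp X - 1) * (1 / (Complex.exp Y - 1) - 1 / Y)
        - ∑' k : ℕ, riemannZeta (k + 2) / (2 * Real.pi * I) ^ (k + 2) * Y ^ (k + 1))) ∧
    Tendsto (fun ξ : ℂ => Xi ξ X Y τ
        - 1 / (2 * Real.pi * I) * Complex.log (-(2 * Real.pi * I * ξ)))
      (𝓝[punctured τ] 0)
      (𝓝 (-(τ / (X * (X - τ * Y)))
        - calAInfPos X (-Y) / (2 * Real.pi * I * (Complex.exp (-Y) - 1))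
        + calAPos (X - τ * Y) (-Y) τ / (2 * Real.pi * I * (Complex.exp (-Y) - 1))
        + 1 / (Complex.exp X - 1) * (1 / (Complex.exp Y - 1) - 1 / Y)
        - ∑' k : ℕ, riemannZeta (k + 2) / (2 * Real.pi * I) ^ (k + 2) * Y ^ (k + 1))) := by
  have hπ := two_pi_I_ne_zero
  have hX' : X / (2 * Real.pi * I) = α := by rw [hX, mul_div_cancel_left₀ _ hπ]
  have hY' : Y / (2 * Real.pi * I) = β := by rw [hY, mul_div_cancel_left₀ _ hπ]
  have hv1 : e α ≠ 1 := fun h1 => by have := h.1; simp [h1] at this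
  have hw1 : e (α - τ * β) ≠ 1 := fun h1 => by have := h.2.1; simp [h1] at this
  have hα0 : α ≠ 0 := by rintro rfl; exact hv1 e_zero
  have hαβ0 : α - τ * β ≠ 0 := fun h1 => hw1 (by rw [h1, e_zero])
  have hXY : X - τ * Y = 2 * Real.pi * I * (α - τ * β) := by rw [hX, hY]; ring
  have sA := hasSum_genTerm_A τ hαβ0 hαβ hβ hβ0
  have sI := hasSum_genTerm_AInf hα0 hα hβ hβ0
  have sZ := summable_zeta hβ
  have eA := tsum_genTerm_eq (a := fun n r => A n r τ) (fun n r => A_eq n r τ)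
    (neg_ne_zero.2 (mul_ne_zero hπ hβ0)) sA.summable
  have eI := tsum_genTerm_eq AInf_eq (neg_ne_zero.2 (mul_ne_zero hπ hβ0)) sI.summable
  rw [← hXY, ← hY] at sA eA
  rw [← hX, ← hY] at sI eI
  rw [← hY] at sZ
  obtain ⟨R, hR, -, c, W, hb⟩ := exists_lambertBound_lattice τ hαβ
  have lim := tendsto_E_add_log h hβ hβ0
    (hb.mono (Set.singleton_subset_iff.2 (mem_ball_zero_iff.2 hR)))
  rw [← hX', ← hY'] at lim
  have lim' := tendsto_Xi lim
  rw [hX', hY'] at lim'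
  have eX : Complex.exp X = e α := by rw [hX, e]
  have eY : Complex.exp Y = e β := by rw [hY, e]
  have eY' : Complex.exp (-Y) = (e β)⁻¹ := by rw [Complex.exp_neg, eY]
  have a1 : e β - 1 ≠ 0 := sub_ne_zero.2 (e_ne_one hβ hβ0)
  have a2 : e α - 1 ≠ 0 := sub_ne_zero.2 hv1
  have a3 : e (α - τ * β) - 1 ≠ 0 := sub_ne_zero.2 hw1
  have a4 : (e β)⁻¹ - 1 ≠ 0 := by
    rw [← e_neg]
    exact sub_ne_zero.2 (e_ne_one (by rwa [norm_neg]) (neg_ne_zero.2 hβ0))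
  have a5 : 1 - e α ≠ 0 := sub_ne_zero.2 hv1.symm
  have a6 : 1 - e (α - τ * β) ≠ 0 := sub_ne_zero.2 hw1.symm
  have b1 : calA (X - τ * Y) (-Y) τ = genValue (e τ) (e (α - τ * β)) β := sA.tsum_eq
  have b2 : calAInf X (-Y) = genValue 0 (e α) β := sI.tsum_eq
  have key : -(1 / (2 * Real.pi * I)) * (expSeries (invDiff β) 0 + (lambertT (e τ) 1
      (e (α - τ * β)) β + (β * (e (α - τ * β) - 1))⁻¹) -
      2 * Real.pi * I / ((e β - 1) * (e α - 1))) =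
      -(calAInf X (-Y) / (2 * Real.pi * I * (Complex.exp (-Y) - 1)))
        + calA (X - τ * Y) (-Y) τ / (2 * Real.pi * I * (Complex.exp (-Y) - 1))
        + 1 / (Complex.exp X - 1) * (1 / (Complex.exp Y - 1) - 1 / Y)
        - ∑' k : ℕ, riemannZeta (k + 2) / (2 * Real.pi * I) ^ (k + 2) * Y ^ (k + 1) := by
    -- The term `rhoGen` depends only on β and cancels in the difference, and the Lambert series at
    -- q = 0 vanishes.
    have b3 : -(calAInf X (-Y) / (2 * Real.pi * I * (Complex.exp (-Y) - 1)))
        + calA (X - τ * Y) (-Y) τ / (2 * Real.pi * I * (Complex.exp (-Y) - 1)) =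
        (e (α - τ * β) / ((1 - e (α - τ * β)) * β) - lambertT (e τ) 1 (e (α - τ * β)) β -
          e α / ((1 - e α) * β)) / (2 * Real.pi * I) := by
      rw [b1, b2, eY', genValue, genValue, lambertT_zero, e_neg]
      generalize rhoGen (-(2 * Real.pi * I * β)) = ρ
      generalize lambertT (e τ) 1 (e (α - τ * β)) β = T
      generalize e α / ((1 - e α) * β) = x1
      generalize e (α - τ * β) / ((1 - e (α - τ * β)) * β) = x2
      generalize (e β)⁻¹ - 1 = x3 at a4 ⊢
      field_simp
      ring
    rw [b3, sZ.tsum_eq, eX, eY, hY]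
    have b4 : e (α - τ * β) / ((1 - e (α - τ * β)) * β) =
        -(1 / β) - (β * (e (α - τ * β) - 1))⁻¹ := by
      generalize e (α - τ * β) = w at a3 a6 ⊢
      field_simp
      ring
    have b5 : e α / ((1 - e α) * β) = -(1 / β) - (β * (e α - 1))⁻¹ := by
      generalize e α = w at a2 a5 ⊢
      field_simp
      ring
    rw [b4, b5]
    generalize e (α - τ * β) = w at a3 ⊢
    generalize e α = v at a2 ⊢
    generalize e β = x at a1 ⊢
    generalize lambertT (e τ) 1 w β = T
    generalize expSeries (invDiff β) 0 = Z
    field_simp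
    ring
  rw [key] at lim'
  refine ⟨fun ξ hξ => ?_, sA.summable, sI.summable, sZ.summable, lim', ?_⟩
  · rw [hX', hY']
    exact (hasSum_avgTerm hξ h hβ hβ0).summable
  · have b6 : calA (X - τ * Y) (-Y) τ = (α - τ * β)⁻¹ * ((Complex.exp (-Y) - 1) / (-Y)) +
        calAPos (X - τ * Y) (-Y) τ := eA
    have b7 : calAInf X (-Y) = α⁻¹ * ((Complex.exp (-Y) - 1) / (-Y)) + calAInfPos X (-Y) := eI
    -- The terms with n = 0 differ only in the factors 1/(α - τβ) and 1/α, whose difference τβ/(α(α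
    -- - τβ)) becomes -τ/(X(X - τY)).
    have b8 : -(calAInf X (-Y) / (2 * Real.pi * I * (Complex.exp (-Y) - 1)))
        + calA (X - τ * Y) (-Y) τ / (2 * Real.pi * I * (Complex.exp (-Y) - 1)) =
        -(τ / (X * (X - τ * Y)))
        - calAInfPos X (-Y) / (2 * Real.pi * I * (Complex.exp (-Y) - 1))
        + calAPos (X - τ * Y) (-Y) τ / (2 * Real.pi * I * (Complex.exp (-Y) - 1)) := by
      have a7 : Complex.exp (-Y) - 1 ≠ 0 := by rwa [eY']
      have a8 : α - β * τ ≠ 0 := by rwa [mul_comm]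
      rw [b6, b7]
      generalize calAInfPos X (-Y) = S1
      generalize calAPos (X - τ * Y) (-Y) τ = S2
      generalize Complex.exp (-Y) - 1 = x at a7 ⊢
      rw [hXY, hX, hY]
      field_simp
      ring
    rw [← b8]
    exact lim'

/-! ### Double power series -/

/-- The open set need not contain the centre 0. Convergence at one point of U makes the series
analytic on the disc reaching up to that point, and a point of U inside the disc starts the identity
theorem. -/
theorem coef_eq_zero_of_hasSum_zero {b : ℕ → ℂ} {U : Set ℂ} (hU : IsOpen U) (hne : U.Nonempty)
    (h : ∀ z ∈ U, HasSum (fun n => b n * z ^ n) 0) (n : ℕ) : b n = 0 := by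
  obtain ⟨z₀, hz₀, hz0⟩ := (dense_compl_singleton (0 : ℂ)).inter_open_nonempty U hU hne
  have hz0' : 0 < ‖z₀‖ := norm_pos_iff.2 hz0
  -- The point z₀ is pushed slightly outwards within U, so that it lies in the open disc of
  -- convergence given by z₁.
  obtain ⟨s, hs, hsU⟩ : ∃ s : ℝ, 0 < s ∧ ((1 + s : ℝ) : ℂ) * z₀ ∈ U := by
    have hc : Continuous fun s : ℝ => ((1 + s : ℝ) : ℂ) * z₀ := by fun_prop
    have h1 : ∀ᶠ s : ℝ in 𝓝 0, ((1 + s : ℝ) : ℂ) * z₀ ∈ U :=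
      hc.continuousAt.eventually_mem (hU.mem_nhds (by simpa using hz₀))
    obtain ⟨s, hs1, hs2⟩ := ((h1.filter_mono nhdsWithin_le_nhds).and
      (eventually_mem_nhdsWithin (a := (0 : ℝ)) (s := Set.Ioi 0))).exists
    exact ⟨s, hs2, hs1⟩
  obtain ⟨z₁, hz₁⟩ : ∃ z₁, z₁ = ((1 + s : ℝ) : ℂ) * z₀ := ⟨_, rfl⟩
  rw [← hz₁] at hsU
  have hlt : ‖z₀‖ < ‖z₁‖ := by
    rw [hz₁, norm_mul, Complex.norm_real, Real.norm_of_nonneg (by linarith)]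
    nlinarith
  have hsum := (h z₁ hsU).summable.norm
  have hle : ∀ n, ∀ z ∈ Metric.ball (0 : ℂ) ‖z₁‖, ‖b n * z ^ n‖ ≤ ‖b n * z₁ ^ n‖ := fun n z hz => by
    rw [norm_mul, norm_mul, norm_pow, norm_pow]
    have := (mem_ball_zero_iff.1 hz).le
    gcongr
  have hd : DifferentiableOn ℂ (fun z => ∑' n, b n * z ^ n) (Metric.ball 0 ‖z₁‖) :=
    differentiableOn_tsum_of_summable_norm hsum (fun n => by fun_prop) Metric.isOpen_ball hle
  have hz : Set.EqOn (fun z => ∑' n, b n * z ^ n) 0 (Metric.ball 0 ‖z₁‖) := by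
    refine (hd.analyticOnNhd Metric.isOpen_ball).eqOn_zero_of_preconnected_of_eventuallyEq_zero
      (convex_ball 0 _).isPreconnected (z₀ := z₀) (mem_ball_zero_iff.2 hlt) ?_
    filter_upwards [hU.mem_nhds hz₀] with z hz
    exact (h z hz).tsum_eq
  have hp : HasFPowerSeriesAt (0 : ℂ → ℂ) (FormalMultilinearSeries.ofScalars ℂ b) 0 := by
    rw [hasFPowerSeriesAt_iff]
    filter_upwards [Metric.ball_mem_nhds (0 : ℂ) (hz0'.trans hlt)] with z hz'
    have h1 : HasSum (fun n => b n * z ^ n) 0 := by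
      have h2 := (Summable.of_norm_bounded hsum fun n => hle n z hz').hasSum
      have h3 := hz hz'
      simp only [Pi.zero_apply] at h3
      rwa [h3] at h2
    refine hasSum_of_eq h1 (fun n => ?_) rfl
    rw [FormalMultilinearSeries.coeff_ofScalars, smul_eq_mul, mul_comm]
  have := hp.eq_zero
  rw [← FormalMultilinearSeries.coeff_ofScalars (𝕜 := ℂ) (p := b) (n := n), this]
  simp [FormalMultilinearSeries.coeff]

theorem coef_eq_zero_of_hasSum_zero₂ {d : ℕ → ℕ → ℂ} {U : Set ℂ} (hU : IsOpen U)
    (hne : U.Nonempty) {η : ℝ} (hη : 0 < η) (h : ∀ α ∈ U, ∀ β, β ≠ 0 → ‖β‖ < η →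
      HasSum (fun p : ℕ × ℕ => d p.1 p.2 * α ^ p.1 * β ^ p.2) 0) (m n : ℕ) : d m n = 0 := by
  have hV : IsOpen {β : ℂ | β ≠ 0 ∧ ‖β‖ < η} :=
    isOpen_ne.inter (isOpen_lt continuous_norm continuous_const)
  have hVne : {β : ℂ | β ≠ 0 ∧ ‖β‖ < η}.Nonempty := by
    refine ⟨((η / 2 : ℝ) : ℂ), ?_, ?_⟩
    · exact_mod_cast (half_pos hη).ne'
    · rw [Complex.norm_real, Real.norm_of_nonneg (half_pos hη).le]
      exact half_lt_self hη
  obtain ⟨α₀, hα₀, hα0⟩ := (dense_compl_singleton (0 : ℂ)).inter_open_nonempty U hU hne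
  have hα0' : α₀ ≠ 0 := hα0
  have hs : ∀ β, β ≠ 0 → ‖β‖ < η → ∀ m, Summable fun n => d m n * β ^ n := fun β h0 h1 m => by
    have h2 := ((h α₀ hα₀ β h0 h1).summable.comp_injective
      (i := fun n : ℕ => (m, n)) fun a b hab => by simpa using hab).mul_left (α₀ ^ m)⁻¹
    refine h2.congr fun n => ?_
    have := pow_ne_zero m hα0'
    simp only [Function.comp]
    field_simp
  have hinner : ∀ β, β ≠ 0 → ‖β‖ < η → ∀ m, ∑' n, d m n * β ^ n = 0 := fun β h0 h1 =>
    coef_eq_zero_of_hasSum_zero hU hne fun α hα => by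
      refine (h α hα β h0 h1).prod_fiberwise fun m => ?_
      refine hasSum_of_eq ((hs β h0 h1 m).hasSum.mul_right (α ^ m)) (fun n => ?_) rfl
      ring
  refine coef_eq_zero_of_hasSum_zero hV hVne (fun β hβ => ?_) n
  have := (hs β hβ.1 hβ.2 m).hasSum
  rwa [hinner β hβ.1 hβ.2 m] at this

/-- `F` has the expansion `∑ c_{mn} α^m β^n` near the origin. -/
def IsDoubleSeries (F : ℂ → ℂ → ℂ) (c : ℕ → ℕ → ℂ) : Prop :=
  ∃ δ : ℝ, 0 < δ ∧ ∀ α β : ℂ, ‖α‖ < δ → ‖β‖ < δ →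
    HasSum (fun p : ℕ × ℕ => c p.1 p.2 * α ^ p.1 * β ^ p.2) (F α β)

theorem IsDoubleSeries.add {F G : ℂ → ℂ → ℂ} {c d : ℕ → ℕ → ℂ} (hF : IsDoubleSeries F c)
    (hG : IsDoubleSeries G d) :
    IsDoubleSeries (fun α β => F α β + G α β) (fun m n => c m n + d m n) := by
  obtain ⟨δ, hδ, h1⟩ := hF
  obtain ⟨ε, hε, h2⟩ := hG
  refine ⟨min δ ε, lt_min hδ hε, fun α β hα hβ => ?_⟩
  rw [lt_min_iff] at hα hβ
  refine hasSum_of_eq ((h1 α β hα.1 hβ.1).add (h2 α β hα.2 hβ.2)) (fun p => ?_) rfl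
  ring

/-- The sum of a triple series, grouped by the sum of the last two indices. -/
theorem HasSum.antidiagonal_snd {f : ℕ × ℕ × ℕ → ℂ} {a : ℂ} (h : HasSum f a) :
    HasSum (fun p : ℕ × ℕ => ∑ x ∈ Finset.HasAntidiagonal.antidiagonal p.2, f (p.1, x.1, x.2)) a := by
  let ψ : (Σ p : ℕ × ℕ, Finset.HasAntidiagonal.antidiagonal p.2) ≃ ℕ × ℕ × ℕ :=
    { toFun := fun x => (x.1.1, x.2.1.1, x.2.1.2)
      invFun := fun q => ⟨(q.1, q.2.1 + q.2.2), ⟨(q.2.1, q.2.2), by simp⟩⟩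
      left_inv := by
        rintro ⟨⟨m, n⟩, ⟨⟨i, j⟩, hij⟩⟩
        obtain rfl : i + j = n := by simpa using hij
        rfl
      right_inv := fun q => rfl }
  refine HasSum.sigma (f := f ∘ ψ) (ψ.hasSum_iff.2 h) fun p => ?_
  have h1 := hasSum_fintype fun x : Finset.HasAntidiagonal.antidiagonal p.2 => (f ∘ ψ) ⟨p, x⟩
  refine hasSum_of_eq h1 (fun _ => rfl) ?_
  rw [← Finset.sum_coe_sort]
  rfl

theorem summable_of_antidiagonal_snd {f : ℕ × ℕ × ℕ → ℝ} (h0 : ∀ x, 0 ≤ f x)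
    (h : Summable fun p : ℕ × ℕ => ∑ x ∈ Finset.HasAntidiagonal.antidiagonal p.2, f (p.1, x.1, x.2)) :
    Summable f := by
  let ψ : (Σ p : ℕ × ℕ, Finset.HasAntidiagonal.antidiagonal p.2) ≃ ℕ × ℕ × ℕ :=
    { toFun := fun x => (x.1.1, x.2.1.1, x.2.1.2)
      invFun := fun q => ⟨(q.1, q.2.1 + q.2.2), ⟨(q.2.1, q.2.2), by simp⟩⟩
      left_inv := by
        rintro ⟨⟨m, n⟩, ⟨⟨i, j⟩, hij⟩⟩
        obtain rfl : i + j = n := by simpa using hij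
        rfl
      right_inv := fun q => rfl }
  refine ψ.summable_iff.1 ((summable_sigma_of_nonneg fun x => h0 _).2
    ⟨fun p => (hasSum_fintype _).summable, h.congr fun p => ?_⟩)
  rw [tsum_fintype, ← Finset.sum_coe_sort]
  rfl

theorem IsDoubleSeries.mul_right {F : ℂ → ℂ → ℂ} {c : ℕ → ℕ → ℂ} (hF : IsDoubleSeries F c)
    {Ψ : ℂ → ℂ} {ψ : ℕ → ℂ} {ε : ℝ} (hε : 0 < ε)
    (hΨ : ∀ β, ‖β‖ < ε → HasSum (fun n => ψ n * β ^ n) (Ψ β)) :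
    IsDoubleSeries (fun α β => Ψ β * F α β)
      (fun m n => ∑ x ∈ Finset.HasAntidiagonal.antidiagonal n, ψ x.1 * c m x.2) := by
  obtain ⟨δ, hδ, h1⟩ := hF
  refine ⟨min δ ε, lt_min hδ hε, fun α β hα hβ => ?_⟩
  rw [lt_min_iff] at hα hβ
  have h2 := hasSum_mul_of_summable (hΨ β hβ.2) (h1 α β hα.1 hβ.1)
  let χ : ℕ × ℕ × ℕ ≃ ℕ × ℕ × ℕ :=
    { toFun := fun x => (x.2.1, x.1, x.2.2)
      invFun := fun x => (x.2.1, x.1, x.2.2)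
      left_inv := fun _ => rfl
      right_inv := fun _ => rfl }
  refine hasSum_of_eq (HasSum.antidiagonal_snd (χ.hasSum_iff.2 h2)) (fun p => ?_) rfl
  rw [Finset.sum_mul, Finset.sum_mul]
  refine Finset.sum_congr rfl fun x hx => ?_
  rw [Finset.HasAntidiagonal.mem_antidiagonal] at hx
  simp only [Function.comp, χ, Equiv.coe_fn_mk]
  rw [← hx, pow_add]
  ring

/-- Every new coefficient is a finite sum and polynomial in t; with t = τ this is the source of the
polynomials in τ. -/
theorem IsDoubleSeries.comp_add_mul {F : ℂ → ℂ → ℂ} {c : ℕ → ℕ → ℂ} (hF : IsDoubleSeries F c)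
    (t : ℂ) : IsDoubleSeries (fun α β => F (α + t * β) β)
      (fun m n => ∑ x ∈ Finset.HasAntidiagonal.antidiagonal n,
        ((m + x.1).choose x.1 : ℂ) * t ^ x.1 * c (m + x.1) x.2) := by
  obtain ⟨δ, hδ, h1⟩ := hF
  obtain ⟨ε, hε, hεt⟩ : ∃ ε : ℝ, 0 < ε ∧ ε * (1 + ‖t‖) ≤ δ :=
    ⟨δ / (1 + ‖t‖), by positivity, (div_mul_cancel₀ _ (by positivity)).le⟩
  refine ⟨ε, hε, fun α β hα hβ => ?_⟩
  have hαt : ‖α‖ + ‖t‖ * ‖β‖ < δ := by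
    have := mul_le_mul_of_nonneg_left hβ.le (norm_nonneg t)
    nlinarith
  have hβδ : ‖β‖ < δ := by nlinarith [norm_nonneg t, norm_nonneg α, hεt]
  have hαβ : ‖α + t * β‖ < δ := (norm_add_le _ _).trans_lt (by rwa [norm_mul])
  let f : ℕ × ℕ × ℕ → ℂ := fun x =>
    c (x.2.2 + x.2.1) x.1 * β ^ x.1 * (α ^ x.2.2 * (t * β) ^ x.2.1 * (x.2.2 + x.2.1).choose x.2.1)
  have hbin : ∀ (a b : ℂ) (M : ℕ), ∑ x ∈ Finset.HasAntidiagonal.antidiagonal M,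
      a ^ x.2 * b ^ x.1 * ((x.2 + x.1).choose x.1 : ℂ) = (a + b) ^ M := fun a b M => by
    rw [add_comm a b, Commute.add_pow' (Commute.all b a)]
    refine Finset.sum_congr rfl fun x hx => ?_
    rw [Finset.HasAntidiagonal.mem_antidiagonal] at hx
    rw [add_comm x.2, hx, nsmul_eq_mul]
    ring
  have hbinR : ∀ (a b : ℝ) (M : ℕ), ∑ x ∈ Finset.HasAntidiagonal.antidiagonal M,
      a ^ x.2 * b ^ x.1 * ((x.2 + x.1).choose x.1 : ℝ) = (a + b) ^ M := fun a b M => by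
    exact_mod_cast hbin a b M
  have hfs : Summable f := by
    refine Summable.of_norm (summable_of_antidiagonal_snd (fun x => norm_nonneg _) ?_)
    -- Evaluating the given series at the nonnegative point (|α| + |t||β|, |β|) shows the absolute
    -- convergence of the fully expanded triple series.
    have h2 := (h1 ((‖α‖ + ‖t‖ * ‖β‖ : ℝ)) ((‖β‖ : ℝ)) (by
      rw [Complex.norm_real, Real.norm_of_nonneg (by positivity)]; exact hαt)
      (by rwa [Complex.norm_real, norm_norm])).summable.norm
    refine ((Equiv.prodComm ℕ ℕ).summable_iff.2 h2).congr fun p => ?_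
    simp only [Function.comp, Equiv.prodComm_apply, Prod.fst_swap, Prod.snd_swap]
    rw [norm_mul, norm_mul, norm_pow, norm_pow, Complex.norm_real, Complex.norm_real, norm_norm,
      Real.norm_of_nonneg (by positivity), ← hbinR, Finset.mul_sum, Finset.sum_mul]
    refine Finset.sum_congr rfl fun x hx => ?_
    rw [Finset.HasAntidiagonal.mem_antidiagonal] at hx
    simp only [f]
    rw [norm_mul, norm_mul, norm_mul, norm_mul, norm_pow, norm_pow, norm_pow, norm_mul,
      Complex.norm_natCast, add_comm x.2, hx]
    ring
  have hfa : ∑' x, f x = F (α + t * β) β := by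
    have h2 := HasSum.antidiagonal_snd hfs.hasSum
    have h3 := (Equiv.prodComm ℕ ℕ).hasSum_iff.2 (h1 _ _ hαβ hβδ)
    refine h2.unique (hasSum_of_eq h3 (fun p => ?_) rfl)
    simp only [Function.comp, Equiv.prodComm_apply, Prod.fst_swap, Prod.snd_swap]
    rw [← hbin, Finset.mul_sum, Finset.sum_mul]
    refine Finset.sum_congr rfl fun x hx => ?_
    rw [Finset.HasAntidiagonal.mem_antidiagonal] at hx
    simp only [f]
    rw [add_comm x.2, hx]
    ring
  let χ : ℕ × ℕ × ℕ ≃ ℕ × ℕ × ℕ :=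
    { toFun := fun x => (x.2.2, x.2.1, x.1)
      invFun := fun x => (x.2.2, x.2.1, x.1)
      left_inv := fun _ => rfl
      right_inv := fun _ => rfl }
  have h4 := HasSum.antidiagonal_snd (χ.hasSum_iff.2 hfs.hasSum)
  rw [hfa] at h4
  refine hasSum_of_eq h4 (fun p => ?_) rfl
  rw [Finset.sum_mul, Finset.sum_mul]
  refine Finset.sum_congr rfl fun x hx => ?_
  rw [Finset.HasAntidiagonal.mem_antidiagonal] at hx
  simp only [Function.comp, χ, Equiv.coe_fn_mk, f]
  rw [← hx, pow_add, mul_pow]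
  ring

theorem isDoubleSeries_left {G : ℂ → ℂ} {g : ℕ → ℂ} {ε : ℝ} (hε : 0 < ε)
    (hG : ∀ α, ‖α‖ < ε → HasSum (fun n => g n * α ^ n) (G α)) :
    IsDoubleSeries (fun α _ => G α) (fun m n => if n = 0 then g m else 0) := by
  refine ⟨ε, hε, fun α β hα _ => ?_⟩
  have hi : Function.Injective fun m : ℕ => (m, 0) := fun a b h => by simpa using h
  refine (hi.hasSum_iff fun p hp => ?_).1 (hasSum_of_eq (hG α hα) (fun m => ?_) rfl)
  · have : p.2 ≠ 0 := fun h => hp ⟨p.1, Prod.ext rfl h.symm⟩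
    simp [this]
  · simp

theorem isDoubleSeries_right {G : ℂ → ℂ} {g : ℕ → ℂ} {ε : ℝ} (hε : 0 < ε)
    (hG : ∀ β, ‖β‖ < ε → HasSum (fun n => g n * β ^ n) (G β)) :
    IsDoubleSeries (fun _ β => G β) (fun m n => if m = 0 then g n else 0) := by
  refine ⟨ε, hε, fun α β _ hβ => ?_⟩
  have hi : Function.Injective fun n : ℕ => (0, n) := fun a b h => by simpa using h
  refine (hi.hasSum_iff fun p hp => ?_).1 (hasSum_of_eq (hG β hβ) (fun m => ?_) rfl)
  · have : p.1 ≠ 0 := fun h => hp ⟨p.2, Prod.ext h.symm rfl⟩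
    simp [this]
  · simp

/-! ### Cauchy coefficients on the torus -/

/-- The `n`-th Taylor coefficient as an integral over the circle of radius `R`. -/
def circleCoef (R : ℝ) (n : ℕ) (f : ℂ → ℂ) : ℂ :=
  ∫ t in (0 : ℝ)..1, f (R * e t) * ((R * e t) ^ n)⁻¹

theorem norm_circle_point {R : ℝ} (hR : 0 ≤ R) (t : ℝ) : ‖(R * e t : ℂ)‖ = R := by
  rw [norm_mul, norm_e_ofReal, mul_one, Complex.norm_real, Real.norm_of_nonneg hR]

theorem circle_point_mem {R : ℝ} (hR : 0 ≤ R) (t : ℝ) : (R * e t : ℂ) ∈ Metric.closedBall 0 R := by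
  rw [mem_closedBall_zero_iff, norm_circle_point hR]

theorem norm_circleCoef_le {R M : ℝ} (hR : 0 < R) {n : ℕ} {f : ℂ → ℂ}
    (hf : ∀ z ∈ Metric.closedBall 0 R, ‖f z‖ ≤ M) : ‖circleCoef R n f‖ ≤ M * (R ^ n)⁻¹ := by
  have := intervalIntegral.norm_integral_le_of_norm_le_const (a := 0) (b := 1)
    (C := M * (R ^ n)⁻¹) (f := fun t : ℝ => f (R * e t) * ((R * e t) ^ n)⁻¹) fun t _ => by
      rw [norm_mul, norm_inv, norm_pow, norm_circle_point hR.le]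
      have := hf _ (circle_point_mem hR.le t)
      gcongr
  simpa [circleCoef] using this

theorem continuous_circle_point (R : ℝ) : Continuous fun t : ℝ => (R * e t : ℂ) :=
  continuous_const.mul (continuous_e.comp Complex.continuous_ofReal)

theorem continuous_circle_integrand {R : ℝ} (hR : 0 < R) (n : ℕ) {f : ℂ → ℂ}
    (hf : ContinuousOn f (Metric.closedBall 0 R)) :
    Continuous fun t : ℝ => f (R * e t) * ((R * e t) ^ n)⁻¹ := by
  refine (hf.comp_continuous (continuous_circle_point R) (circle_point_mem hR.le)).mul ?_
  refine ((continuous_circle_point R).pow n).inv₀ fun t => pow_ne_zero _ ?_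
  rw [← norm_pos_iff, norm_circle_point hR.le]
  exact hR

theorem circleCoef_sub {R : ℝ} (hR : 0 < R) (n : ℕ) {f g : ℂ → ℂ}
    (hf : ContinuousOn f (Metric.closedBall 0 R)) (hg : ContinuousOn g (Metric.closedBall 0 R)) :
    circleCoef R n (fun z => f z - g z) = circleCoef R n f - circleCoef R n g := by
  rw [circleCoef, circleCoef, circleCoef, ← intervalIntegral.integral_sub
    ((continuous_circle_integrand hR n hf).intervalIntegrable _ _)
    ((continuous_circle_integrand hR n hg).intervalIntegrable _ _)]
  refine intervalIntegral.integral_congr fun t _ => ?_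
  ring

theorem hasSum_circleCoef {R : ℝ} (hR : 0 < R) {f : ℂ → ℂ}
    (hc : ContinuousOn f (Metric.closedBall 0 R)) (hd : DifferentiableOn ℂ f (Metric.ball 0 R))
    {w : ℂ} (hw : ‖w‖ < R) : HasSum (fun n => circleCoef R n f * w ^ n) (f w) := by
  have hπ := two_pi_I_ne_zero
  have h1 := hasSum_two_pi_I_cauchyPowerSeries_integral (c := 0)
    ((hc.mono Metric.sphere_subset_closedBall).circleIntegrable hR.le) hw
  have hdc : DiffContOnCl ℂ f (Metric.ball 0 R) :=
    ⟨hd, by rwa [closure_ball 0 hR.ne']⟩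
  rw [zero_add, hdc.circleIntegral_sub_inv_smul (mem_ball_zero_iff.2 hw)] at h1
  refine hasSum_of_eq (h1.mul_left (2 * Real.pi * I : ℂ)⁻¹) (fun n => ?_) ?_
  · have h2 := intervalIntegral.smul_integral_comp_mul_right (a := 0) (b := 1)
      (fun θ : ℝ => deriv (circleMap 0 R) θ • ((w / (circleMap 0 R θ - 0)) ^ n •
        (circleMap 0 R θ - 0)⁻¹ • f (circleMap 0 R θ))) (2 * Real.pi)
    rw [zero_mul, one_mul] at h2
    rw [circleIntegral, ← h2, circleCoef, Complex.real_smul, ← intervalIntegral.integral_mul_const,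
      ← intervalIntegral.integral_const_mul, ← intervalIntegral.integral_const_mul]
    refine intervalIntegral.integral_congr fun t _ => ?_
    have h3 : circleMap 0 R (t * (2 * Real.pi)) = R * e t := by
      rw [circleMap_zero, e]
      congr 2
      push_cast
      ring
    have h4 : (R * e t : ℂ) ≠ 0 := by
      rw [← norm_pos_iff, norm_circle_point hR.le]; exact hR
    simp only [deriv_circleMap, smul_eq_mul, h3, sub_zero]
    push_cast
    generalize (R * e t : ℂ) = z at h4 ⊢
    rw [div_pow]
    have := pow_ne_zero n h4
    have hI := Complex.I_ne_zero
    have hp : (Real.pi : ℂ) ≠ 0 := by exact_mod_cast Real.pi_ne_zero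
    field_simp
  · rw [smul_eq_mul, inv_mul_cancel_left₀ hπ]

/-- Functions that are continuous on the closed polydisc of radius `R` and holomorphic in each
variable. -/
structure IsPolydiscHolomorphic (R : ℝ) (F : ℂ → ℂ → ℂ) : Prop where
  cont : ContinuousOn (fun p : ℂ × ℂ => F p.1 p.2)
    (Metric.closedBall 0 R ×ˢ Metric.closedBall 0 R)
  left : ∀ β ∈ Metric.closedBall (0 : ℂ) R, DifferentiableOn ℂ (fun α => F α β) (Metric.ball 0 R)
  right : ∀ α ∈ Metric.closedBall (0 : ℂ) R, DifferentiableOn ℂ (F α) (Metric.ball 0 R)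

/-- Taylor coefficients of a function of two variables. -/
def torusCoef (R : ℝ) (m n : ℕ) (F : ℂ → ℂ → ℂ) : ℂ :=
  circleCoef R m fun z => circleCoef R n (F z)

theorem continuousOn_left {R : ℝ} {F : ℂ → ℂ → ℂ} (hF : ContinuousOn (fun p : ℂ × ℂ => F p.1 p.2)
    (Metric.closedBall 0 R ×ˢ Metric.closedBall 0 R)) {β : ℂ} (hβ : β ∈ Metric.closedBall (0 : ℂ) R) :
    ContinuousOn (fun α => F α β) (Metric.closedBall 0 R) :=
  hF.comp (f := fun α => (α, β)) (by fun_prop) fun _ hα => ⟨hα, hβ⟩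

theorem continuousOn_right {R : ℝ} {F : ℂ → ℂ → ℂ} (hF : ContinuousOn (fun p : ℂ × ℂ => F p.1 p.2)
    (Metric.closedBall 0 R ×ˢ Metric.closedBall 0 R)) {α : ℂ} (hα : α ∈ Metric.closedBall (0 : ℂ) R) :
    ContinuousOn (F α) (Metric.closedBall 0 R) :=
  hF.comp (f := fun β => (α, β)) (by fun_prop) fun _ hβ => ⟨hα, hβ⟩

theorem continuousOn_circleCoef {R : ℝ} (hR : 0 < R) (n : ℕ) {F : ℂ → ℂ → ℂ}
    (hF : ContinuousOn (fun p : ℂ × ℂ => F p.1 p.2)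
      (Metric.closedBall 0 R ×ˢ Metric.closedBall 0 R)) :
    ContinuousOn (fun z => circleCoef R n (F z)) (Metric.closedBall 0 R) := by
  rw [continuousOn_iff_continuous_domRestrict]
  refine intervalIntegral.continuous_parametric_intervalIntegral_of_continuous'
    (f := fun (z : Metric.closedBall (0 : ℂ) R) (t : ℝ) => F z (R * e t) * ((R * e t) ^ n)⁻¹) ?_ 0 1
  have h1 : Continuous fun x : Metric.closedBall (0 : ℂ) R × ℝ => ((x.1 : ℂ), (R * e x.2 : ℂ)) :=
    (continuous_subtype_val.comp continuous_fst).prodMk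
      ((continuous_circle_point R).comp continuous_snd)
  refine (hF.comp_continuous h1 fun x => ⟨x.1.2, circle_point_mem hR.le x.2⟩).mul ?_
  refine (((continuous_circle_point R).comp continuous_snd).pow n).inv₀ fun x => pow_ne_zero _ ?_
  rw [← norm_pos_iff, Function.comp, norm_circle_point hR.le]
  exact hR

theorem norm_torusCoef_le {R M : ℝ} (hR : 0 < R) {m n : ℕ} {F : ℂ → ℂ → ℂ}
    (hF : ∀ z ∈ Metric.closedBall 0 R, ∀ w ∈ Metric.closedBall 0 R, ‖F z w‖ ≤ M) :
    ‖torusCoef R m n F‖ ≤ M * (R ^ n)⁻¹ * (R ^ m)⁻¹ :=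
  norm_circleCoef_le hR fun z hz => norm_circleCoef_le hR (hF z hz)

theorem circleCoef_congr {R : ℝ} (hR : 0 ≤ R) (n : ℕ) {f g : ℂ → ℂ}
    (h : ∀ z ∈ Metric.closedBall 0 R, f z = g z) : circleCoef R n f = circleCoef R n g :=
  intervalIntegral.integral_congr fun t _ => by simp only [h _ (circle_point_mem hR t)]

theorem torusCoef_sub {R : ℝ} (hR : 0 < R) (m n : ℕ) {F G : ℂ → ℂ → ℂ}
    (hF : ContinuousOn (fun p : ℂ × ℂ => F p.1 p.2)
      (Metric.closedBall 0 R ×ˢ Metric.closedBall 0 R))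
    (hG : ContinuousOn (fun p : ℂ × ℂ => G p.1 p.2)
      (Metric.closedBall 0 R ×ˢ Metric.closedBall 0 R)) :
    torusCoef R m n (fun z w => F z w - G z w) = torusCoef R m n F - torusCoef R m n G := by
  rw [torusCoef, torusCoef, torusCoef, ← circleCoef_sub hR m (continuousOn_circleCoef hR n hF)
    (continuousOn_circleCoef hR n hG)]
  exact circleCoef_congr hR.le m fun z hz =>
    circleCoef_sub hR n (continuousOn_right hF hz) (continuousOn_right hG hz)

theorem hasSum_torusCoef {R : ℝ} (hR : 0 < R) {F : ℂ → ℂ → ℂ} (hF : IsPolydiscHolomorphic R F)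
    {α β : ℂ} (hα : ‖α‖ < R) (hβ : ‖β‖ < R) :
    HasSum (fun p : ℕ × ℕ => torusCoef R p.1 p.2 F * α ^ p.1 * β ^ p.2) (F α β) := by
  obtain ⟨M, hM⟩ := ((isCompact_closedBall (0 : ℂ) R).prod
    (isCompact_closedBall (0 : ℂ) R)).exists_bound_of_continuousOn hF.cont
  have hM' : ∀ z ∈ Metric.closedBall (0 : ℂ) R, ∀ w ∈ Metric.closedBall (0 : ℂ) R, ‖F z w‖ ≤ M :=
    fun z hz w hw => hM (z, w) ⟨hz, hw⟩
  have hM0 : 0 ≤ M := (norm_nonneg _).trans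
    (hM' 0 (Metric.mem_closedBall_self hR.le) 0 (Metric.mem_closedBall_self hR.le))
  have ha : ‖α‖ / R < 1 := (div_lt_one hR).2 hα
  have hb : ‖β‖ / R < 1 := (div_lt_one hR).2 hβ
  have hβ' : β ∈ Metric.closedBall (0 : ℂ) R := mem_closedBall_zero_iff.2 hβ.le
  have ga := summable_geometric_of_lt_one (by positivity) ha
  have gb := summable_geometric_of_lt_one (by positivity) hb
  have hs : Summable fun p : ℕ × ℕ => torusCoef R p.1 p.2 F * α ^ p.1 * β ^ p.2 := by
    refine Summable.of_norm_bounded ((ga.mul_of_nonneg gb (fun _ => by positivity)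
      (fun _ => by positivity)).mul_left M) fun p => ?_
    rw [norm_mul, norm_mul, norm_pow, norm_pow]
    calc _ ≤ M * (R ^ p.2)⁻¹ * (R ^ p.1)⁻¹ * ‖α‖ ^ p.1 * ‖β‖ ^ p.2 := by
          gcongr
          exact norm_torusCoef_le hR hM'
      _ = _ := by rw [div_pow, div_pow]; ring
  have hinner : ∀ m, HasSum (fun n => torusCoef R m n F * β ^ n)
      (circleCoef R m fun z => F z β) := fun m => by
    have h1 := hasSum_intervalIntegral (F := fun (n : ℕ) (t : ℝ) =>
        circleCoef R n (F (R * e t)) * β ^ n * ((R * e t) ^ m)⁻¹)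
      (fun n => by
        have h2 := continuous_circle_integrand hR m
          ((continuousOn_circleCoef hR n hF.cont).mul (continuousOn_const (c := β ^ n)))
        exact h2)
      (gb.mul_left (M * (R ^ m)⁻¹)) (fun n t _ => by
        rw [norm_mul, norm_mul, norm_inv, norm_pow, norm_pow, norm_circle_point hR.le]
        have h3 := norm_circleCoef_le (n := n) hR (hM' _ (circle_point_mem hR.le t))
        calc _ ≤ M * (R ^ n)⁻¹ * ‖β‖ ^ n * (R ^ m)⁻¹ := by gcongr
          _ = _ := by rw [div_pow]; ring)
    refine hasSum_of_eq h1 (fun n => ?_) ?_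
    · rw [torusCoef, circleCoef, ← intervalIntegral.integral_mul_const]
      refine intervalIntegral.integral_congr fun t _ => ?_
      ring
    · rw [circleCoef]
      refine intervalIntegral.integral_congr fun t _ => ?_
      have h3 := hasSum_circleCoef hR (continuousOn_right hF.cont (circle_point_mem hR.le t))
        (hF.right _ (circle_point_mem hR.le t)) hβ
      exact ((h3.mul_right ((R * e t) ^ m)⁻¹).tsum_eq).symm
  have houter := hasSum_circleCoef hR (continuousOn_left hF.cont hβ') (hF.left β hβ') hα
  have h4 := hs.hasSum.prod_fiberwise fun m => by
    refine hasSum_of_eq ((hinner m).mul_right (α ^ m)) (fun n => ?_) rfl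
    ring
  rw [← h4.unique houter]
  exact hs.hasSum

/-- If `F` vanishes for `β = 0`, then `F / β` is given by the shifted series. -/
theorem hasSum_torusCoef_shift {R : ℝ} (hR : 0 < R) {F : ℂ → ℂ → ℂ}
    (hF : IsPolydiscHolomorphic R F) (h0 : ∀ α, ‖α‖ < R → F α 0 = 0)
    {α β : ℂ} (hα : ‖α‖ < R) (hβ : ‖β‖ < R) (hβ0 : β ≠ 0) :
    HasSum (fun p : ℕ × ℕ => torusCoef R p.1 (p.2 + 1) F * α ^ p.1 * β ^ p.2) (F α β / β) := by
  -- At β = 0 only the coefficients with n = 0 remain, and they sum to F(α,0) = 0; dividing by β is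
  -- therefore a shift of indices.
  have hz : ∀ m, torusCoef R m 0 F = 0 := by
    refine coef_eq_zero_of_hasSum_zero Metric.isOpen_ball
      (Metric.nonempty_ball.2 hR) (U := Metric.ball 0 R) fun z hz => ?_
    have hz' := mem_ball_zero_iff.1 hz
    have h1 := hasSum_torusCoef hR hF hz' (β := 0) (by simpa using hR)
    rw [h0 z hz'] at h1
    have hi : Function.Injective fun m : ℕ => (m, 0) := fun a b h => by simpa using h
    refine hasSum_of_eq ((hi.hasSum_iff fun p hp => ?_).2 h1) (fun m => ?_) rfl
    · have : p.2 ≠ 0 := fun h => hp ⟨p.1, Prod.ext rfl h.symm⟩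
      simp [this]
    · simp
  have h1 := (hasSum_torusCoef hR hF hα hβ).div_const β
  have hi : Function.Injective fun p : ℕ × ℕ => (p.1, p.2 + 1) := fun a b h => by
    simp only [Prod.mk.injEq, Nat.add_right_cancel_iff] at h
    exact Prod.ext h.1 h.2
  refine hasSum_of_eq ((hi.hasSum_iff fun p hp => ?_).2 h1) (fun p => ?_) rfl
  · obtain ⟨m, n⟩ := p
    cases n with
    | zero => simp [hz]
    | succ n => exact absurd ⟨(m, n), rfl⟩ hp
  · simp only [Function.comp]
    rw [pow_succ]
    field_simp

/-- Coefficients are written as integrals over a fixed torus for this purpose: joint continuity on a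
compact bidisc gives uniform convergence as ξ → 0 within T, and Cauchy's bound transfers it to each
coefficient. -/
theorem tendsto_torusCoef {R : ℝ} (hR : 0 < R) (m n : ℕ) {F : ℂ → ℂ → ℂ → ℂ} {T : Set ℂ}
    (h0 : (0 : ℂ) ∈ T) (hF : ContinuousOn (fun p : ℂ × ℂ × ℂ => F p.1 p.2.1 p.2.2)
      (T ×ˢ Metric.closedBall 0 R ×ˢ Metric.closedBall 0 R)) :
    Tendsto (fun ξ => torusCoef R m n (F ξ)) (𝓝[T] 0) (𝓝 (torusCoef R m n (F 0))) := by
  have hc : ∀ ξ ∈ T, ContinuousOn (fun p : ℂ × ℂ => F ξ p.1 p.2)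
      (Metric.closedBall 0 R ×ˢ Metric.closedBall 0 R) := fun ξ hξ =>
    hF.comp (f := fun p : ℂ × ℂ => (ξ, p.1, p.2)) (by fun_prop) fun p hp => ⟨hξ, hp⟩
  rw [Metric.tendsto_nhds]
  intro ε hε
  have hRm : 0 < R ^ m := by positivity
  have hRn : 0 < R ^ n := by positivity
  obtain ⟨v, hv, hvT⟩ := IsCompact.mem_uniformity_of_prod
    (f := fun (ξ : ℂ) (p : ℂ × ℂ) => F ξ p.1 p.2)
    ((isCompact_closedBall (0 : ℂ) R).prod (isCompact_closedBall (0 : ℂ) R)) hF h0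
    (Metric.dist_mem_uniformity (show 0 < ε / 2 * R ^ n * R ^ m by positivity))
  filter_upwards [hv, eventually_mem_nhdsWithin] with ξ h1 h2
  rw [dist_eq_norm, ← torusCoef_sub hR m n (hc ξ h2) (hc 0 h0)]
  have h3 := norm_torusCoef_le (m := m) (n := n) hR (F := fun z w => F ξ z w - F 0 z w)
    (M := ε / 2 * R ^ n * R ^ m) fun z hz w hw => by
      rw [← dist_eq_norm]
      exact (hvT ξ h1 (z, w) ⟨hz, hw⟩).le
  have h4 : ε / 2 * R ^ n * R ^ m * (R ^ n)⁻¹ * (R ^ m)⁻¹ = ε / 2 := by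
    field_simp
  linarith

/-! ### Expansion of Levin's generating series -/

/-- The function `1/(e(α)-1) - 1/(2πiα)`, holomorphic at the origin. -/
def bernoulliGen : ℂ → ℂ := dslope (fun z => (expSlope z)⁻¹) 0

theorem differentiableOn_bernoulliGen : DifferentiableOn ℂ bernoulliGen (Metric.ball 0 1) := by
  refine (Complex.differentiableOn_dslope (Metric.ball_mem_nhds 0 one_pos)).2 ?_
  exact differentiable_expSlope.differentiableOn.inv fun z hz =>
    expSlope_ne_zero (mem_ball_zero_iff.1 hz)

theorem bernoulliGen_eq {α : ℂ} (hα : ‖α‖ < 1) (hα0 : α ≠ 0) :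
    bernoulliGen α = (e α - 1)⁻¹ - (2 * Real.pi * I * α)⁻¹ := by
  have h1 := expSlope_ne_zero hα
  have hπ := two_pi_I_ne_zero
  rw [bernoulliGen, dslope_of_ne _ hα0, slope_def_field, expSlope_zero, ← mul_expSlope, sub_zero]
  obtain ⟨c, hc⟩ : ∃ c : ℂ, c = 2 * Real.pi * I := ⟨_, rfl⟩
  rw [← hc] at hπ ⊢
  field_simp

/-- The function `β (E - e(-ξβ)/(2πiβ(α-τβ)) - 1/(α(1-e(β))))`, with `D β` in place of
`Λ(e(ξ),β)`. -/
def levinN (τ : UpperHalfPlane) (D : ℂ → ℂ) (ξ α β : ℂ) : ℂ :=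
  β * D β + e (-(ξ * β)) * (β * lambertT (e τ) (e ξ) (e (α - τ * β)) β + bernoulliGen (α - τ * β)) -
    2 * Real.pi * I / expSlope β * bernoulliGen α

/-- At β = 0 the two terms `bernoulliGen α` cancel, so the quotient by β acquires no pole. -/
theorem levinN_zero (τ : UpperHalfPlane) (D : ℂ → ℂ) (ξ α : ℂ) : levinN τ D ξ α 0 = 0 := by
  have hπ := two_pi_I_ne_zero
  rw [levinN, expSlope_zero, div_self hπ]
  simp [e_zero]

/-- `R` is a radius such that `α - τβ` stays away from the nonzero lattice points for
`‖α‖, ‖β‖ ≤ R`. -/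
def IsAdmissible (τ : UpperHalfPlane) (R R₀ c W : ℝ) : Prop :=
  0 < R ∧ R ≤ 1 / 2 ∧ R₀ < 1 ∧ LambertBound (e τ) (Metric.ball 0 R₀) c W ∧
    ∀ α β : ℂ, ‖α‖ ≤ R → ‖β‖ ≤ R → ‖α - τ * β‖ < R₀

theorem exists_isAdmissible (τ : UpperHalfPlane) : ∃ R R₀ c W : ℝ, IsAdmissible τ R R₀ c W := by
  obtain ⟨R₀, h0, h1, c, W, hb⟩ := exists_lambertBound_zero (norm_e_tau_lt_one τ)
  have hp : 0 < 1 + ‖(τ : ℂ)‖ := by positivity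
  refine ⟨min (1 / 2) (R₀ / 2 / (1 + ‖(τ : ℂ)‖)), R₀, c, W, by positivity, min_le_left _ _, h1, hb,
    fun α β hα hβ => ?_⟩
  have hα' := hα.trans (min_le_right _ _)
  have hβ' := hβ.trans (min_le_right _ _)
  rw [le_div_iff₀ hp] at hα' hβ'
  refine (norm_sub_le _ _).trans_lt ?_
  rw [norm_mul]
  rcases le_total ‖α‖ ‖β‖ with h | h
  · nlinarith
  · have := mul_le_mul_of_nonneg_left h (norm_nonneg (τ : ℂ))
    nlinarith

theorem continuousOn_levinN {τ : UpperHalfPlane} {R R₀ c W h : ℝ} (hR : IsAdmissible τ R R₀ c W)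
    (hh : 0 ≤ h) (hh' : h < τ.im) {T : Set ℂ} (hT : T ⊆ strip h) {D : ℂ → ℂ → ℂ}
    (hD : ContinuousOn (fun p : ℂ × ℂ => D p.1 p.2) (T ×ˢ Metric.closedBall 0 R)) :
    ContinuousOn (fun p : ℂ × ℂ × ℂ => levinN τ (D p.1) p.1 p.2.1 p.2.2)
      (T ×ˢ Metric.closedBall 0 R ×ˢ Metric.closedBall 0 R) := by
  obtain ⟨hR0, hR2, hR1, hb, hsub⟩ := hR
  have hg := differentiableOn_bernoulliGen.continuousOn
  have c1 : ContinuousOn (fun p : ℂ × ℂ × ℂ => D p.1 p.2.2)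
      (T ×ˢ Metric.closedBall 0 R ×ˢ Metric.closedBall 0 R) :=
    hD.comp (f := fun p : ℂ × ℂ × ℂ => (p.1, p.2.2)) (by fun_prop) fun p hp => ⟨hp.1, hp.2.2⟩
  have hsub' : ∀ p ∈ T ×ˢ Metric.closedBall (0 : ℂ) R ×ˢ Metric.closedBall (0 : ℂ) R,
      ‖p.2.1 - τ * p.2.2‖ < R₀ := fun p hp =>
    hsub _ _ (mem_closedBall_zero_iff.1 hp.2.1) (mem_closedBall_zero_iff.1 hp.2.2)
  have c2 : ContinuousOn (fun p : ℂ × ℂ × ℂ =>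
      lambertT (e τ) (e p.1) (e (p.2.1 - τ * p.2.2)) p.2.2)
      (T ×ˢ Metric.closedBall 0 R ×ˢ Metric.closedBall 0 R) :=
    (continuousOn_lambertT hb hh hh' (show R < 1 by linarith)).comp
      (f := fun p : ℂ × ℂ × ℂ => (p.1, p.2.1 - τ * p.2.2, p.2.2)) (by fun_prop)
      fun p hp => ⟨hT hp.1, mem_ball_zero_iff.2 (hsub' p hp), hp.2.2⟩
  have c3 : ContinuousOn (fun p : ℂ × ℂ × ℂ => bernoulliGen (p.2.1 - τ * p.2.2))
      (T ×ˢ Metric.closedBall 0 R ×ˢ Metric.closedBall 0 R) :=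
    hg.comp (f := fun p : ℂ × ℂ × ℂ => p.2.1 - τ * p.2.2) (by fun_prop)
      fun p hp => mem_ball_zero_iff.2 ((hsub' p hp).trans hR1)
  have c4 : ContinuousOn (fun p : ℂ × ℂ × ℂ => bernoulliGen p.2.1)
      (T ×ˢ Metric.closedBall 0 R ×ˢ Metric.closedBall 0 R) :=
    hg.comp (f := fun p : ℂ × ℂ × ℂ => p.2.1) (by fun_prop) fun p hp =>
      mem_ball_zero_iff.2 ((mem_closedBall_zero_iff.1 hp.2.1).trans_lt (by linarith))
  have c5 : ContinuousOn (fun p : ℂ × ℂ × ℂ => 2 * Real.pi * I / expSlope p.2.2)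
      (T ×ˢ Metric.closedBall 0 R ×ˢ Metric.closedBall 0 R) :=
    continuousOn_const.div (differentiable_expSlope.continuous.comp_continuousOn (by fun_prop))
      fun p hp => expSlope_ne_zero ((mem_closedBall_zero_iff.1 hp.2.2).trans_lt (by linarith))
  exact ((ContinuousOn.mul (by fun_prop) c1).add (ContinuousOn.mul (by fun_prop)
    ((ContinuousOn.mul (by fun_prop) c2).add c3))).sub (c5.mul c4)

theorem isPolydiscHolomorphic_levinN {τ : UpperHalfPlane} {R R₀ c W h : ℝ}
    (hR : IsAdmissible τ R R₀ c W) (hh' : h < τ.im) {ξ : ℂ} (hξ : ξ ∈ strip h) {D : ℂ → ℂ}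
    (hD : DifferentiableOn ℂ D (Metric.ball 0 (3 / 4))) :
    IsPolydiscHolomorphic R (levinN τ D ξ) := by
  have hh : 0 ≤ h := hξ.1.trans hξ.2
  have hR' := hR
  obtain ⟨hR0, hR2, hR1, hb, hsub⟩ := hR
  have hball : Metric.closedBall (0 : ℂ) R ⊆ Metric.ball 0 (3 / 4) :=
    Metric.closedBall_subset_ball (by linarith)
  have hg := differentiableOn_bernoulliGen
  have hφ : ∀ β ∈ Metric.ball (0 : ℂ) R, expSlope β ≠ 0 := fun β hβ =>
    expSlope_ne_zero ((mem_ball_zero_iff.1 hβ).trans (by linarith))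
  have hβR : ∀ β ∈ Metric.ball (0 : ℂ) R, ‖β‖ ≤ R := fun β hβ => (mem_ball_zero_iff.1 hβ).le
  refine ⟨?_, fun β hβ => ?_, fun α hα => ?_⟩
  · have h1 := continuousOn_levinN hR' hh hh' (T := {ξ}) (D := fun _ => D)
      (Set.singleton_subset_iff.2 hξ)
      ((hD.continuousOn.mono hball).comp (f := Prod.snd) (by fun_prop) fun p hp => hp.2)
    exact h1.comp (f := fun p : ℂ × ℂ => (ξ, p.1, p.2)) (by fun_prop) fun p hp => ⟨rfl, hp⟩
  · have hβ' := mem_closedBall_zero_iff.1 hβ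
    have hm : Set.MapsTo (fun α : ℂ => α - τ * β) (Metric.ball 0 R) (Metric.ball 0 R₀) :=
      fun α hα => mem_ball_zero_iff.2 (hsub α β (hβR α hα) hβ')
    have d1 : DifferentiableOn ℂ (fun α => lambertT (e τ) (e ξ) (e (α - τ * β)) β)
        (Metric.ball 0 R) :=
      differentiableOn_lambertT_comp hb hh hh' (show R < 1 by linarith) hξ Metric.isOpen_ball
        (a := fun α => α - τ * β) (β := fun _ => β) (by fun_prop) (by fun_prop) hm fun _ _ => hβ'
    have d2 : DifferentiableOn ℂ (fun α => bernoulliGen (α - τ * β)) (Metric.ball 0 R) :=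
      hg.comp (by fun_prop) fun α hα => Metric.ball_subset_ball hR1.le (hm hα)
    have d3 : DifferentiableOn ℂ bernoulliGen (Metric.ball 0 R) :=
      hg.mono (Metric.ball_subset_ball (by linarith))
    exact (((d1.const_mul β).add d2).const_mul _).const_add _ |>.sub (d3.const_mul _)
  · have hα' := mem_closedBall_zero_iff.1 hα
    have hm : Set.MapsTo (fun β : ℂ => α - τ * β) (Metric.ball 0 R) (Metric.ball 0 R₀) :=
      fun β hβ => mem_ball_zero_iff.2 (hsub α β hα' (hβR β hβ))
    have d1 : DifferentiableOn ℂ (fun β => lambertT (e τ) (e ξ) (e (α - τ * β)) β)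
        (Metric.ball 0 R) :=
      differentiableOn_lambertT_comp hb hh hh' (show R < 1 by linarith) hξ Metric.isOpen_ball
        (a := fun β => α - τ * β) (β := fun β => β) (by fun_prop) (by fun_prop) hm hβR
    have d2 : DifferentiableOn ℂ (fun β => bernoulliGen (α - τ * β)) (Metric.ball 0 R) :=
      hg.comp (by fun_prop) fun β hβ => Metric.ball_subset_ball hR1.le (hm hβ)
    have d3 : DifferentiableOn ℂ D (Metric.ball 0 R) :=
      hD.mono (Metric.ball_subset_closedBall.trans hball)
    have d4 : DifferentiableOn ℂ (fun β => 2 * Real.pi * I / expSlope β) (Metric.ball 0 R) :=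
      (differentiableOn_const _).div differentiable_expSlope.differentiableOn hφ
    have d5 : DifferentiableOn ℂ (fun β => e (-(ξ * β))) (Metric.ball 0 R) :=
      (differentiable_e.comp (by fun_prop : Differentiable ℂ fun β : ℂ => -(ξ * β))).differentiableOn
    exact ((differentiableOn_id.mul d3).add (d5.mul ((differentiableOn_id.mul d1).add d2))).sub
      (d4.mul_const _)

/-- The two fractions subtracted in `EReg` are the principal parts of 1/(w - 1) at α = τβ and of
1/(e(α) - 1) at α = 0; what remains of these two functions is `bernoulliGen`. -/
theorem EReg_eq {τ : UpperHalfPlane} {R R₀ c W : ℝ} (hR : IsAdmissible τ R R₀ c W) {ξ α β : ℂ}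
    (hξ : ξ ∈ punctured τ) (h : InAnnulus τ α β) (hα : ‖α‖ ≤ R) (hβ : ‖β‖ ≤ R) (hβ0 : β ≠ 0) :
    EReg ξ α β τ = levinN τ (debye ξ) ξ α β / β := by
  obtain ⟨hR0, hR2, hR1, hb, hsub⟩ := hR
  have hπ := two_pi_I_ne_zero
  have hv1 : e α ≠ 1 := fun h1 => by have := h.1; simp [h1] at this
  have hw1 : e (α - τ * β) ≠ 1 := fun h1 => by have := h.2.1; simp [h1] at this
  have hα0 : α ≠ 0 := by rintro rfl; exact hv1 e_zero
  have hαβ0 : α - τ * β ≠ 0 := fun h1 => hw1 (by rw [h1, e_zero])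
  have hβ1 : ‖β‖ < 1 := by linarith
  have hs := expSlope_ne_zero hβ1
  have hv := sub_ne_zero.2 hv1
  have hw := sub_ne_zero.2 hw1
  have h1 : 1 - e β = -(β * expSlope β) := by rw [mul_expSlope]; ring
  rw [EReg, E_eq hξ h hβ1 hβ0, levinN, bernoulliGen_eq (by linarith) hα0,
    bernoulliGen_eq ((hsub α β hα hβ).trans hR1) hαβ0, h1, ← mul_expSlope β]
  generalize e (α - τ * β) = w at hw ⊢
  generalize α - τ * β = α' at hαβ0 ⊢
  generalize e α = v at hv ⊢
  generalize lambertT (e τ) (e ξ) w β = T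
  generalize debye ξ β = D
  generalize e (-(ξ * β)) = u
  generalize expSlope β = s at hs ⊢
  obtain ⟨k, hk⟩ : ∃ k : ℂ, k = 2 * Real.pi * I := ⟨_, rfl⟩
  rw [← hk] at hπ ⊢
  field_simp
  ring

theorem differentiableOn_debye {ξ : ℂ} (hξ : ξ ∈ slitDomain) :
    DifferentiableOn ℂ (debye ξ) (Metric.ball 0 (3 / 4)) := by
  obtain ⟨r, hr, -, C, hC⟩ := exists_norm_polylog_le hξ
  have hC' := hC ξ (Metric.mem_closedBall_self hr.le)
  have d5 : DifferentiableOn ℂ (fun β => e (-(ξ * β))) (Metric.ball 0 (3 / 4)) :=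
    (differentiable_e.comp (by fun_prop : Differentiable ℂ fun β : ℂ => -(ξ * β))).differentiableOn
  refine d5.mul (differentiableOn_tsum_of_summable_norm
    ((summable_geometric_of_lt_one (by norm_num) (by norm_num : (3 / 4 : ℝ) < 1)).mul_left C)
    (fun k => by fun_prop) Metric.isOpen_ball fun k β hβ => ?_)
  rw [norm_mul, norm_pow]
  have := (mem_ball_zero_iff.1 hβ).le
  have hC0 := (norm_nonneg _).trans (hC' 0)
  gcongr
  exact hC' (k + 1)

theorem differentiableOn_expSeries_invDiff {ξ : ℂ} (hξ : 0 ≤ ξ.im) :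
    DifferentiableOn ℂ (fun β => expSeries (invDiff β) ξ) (Metric.ball 0 (3 / 4)) := by
  refine differentiableOn_tsum_of_summable_norm
    (summable_inv_sq.mul_left (1 - 3 / 4 : ℝ)⁻¹) (fun m => ?_) Metric.isOpen_ball
    fun m β hβ => norm_expSeries_invDiff_term_le (by norm_num) hξ (mem_ball_zero_iff.1 hβ).le m
  refine DifferentiableOn.const_mul (DifferentiableOn.sub (DifferentiableOn.inv (by fun_prop)
    fun β hβ => ?_) (differentiableOn_const _)) _
  exact natCast_add_one_sub_ne_zero ((mem_ball_zero_iff.1 hβ).trans (by norm_num)) m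

theorem differentiableOn_debyeReg {ξ : ℂ} (hξ : 0 ≤ ξ.im) :
    DifferentiableOn ℂ (debyeReg ξ) (Metric.ball 0 (3 / 4)) := by
  have d1 : Differentiable ℂ fun β : ℂ => e (-(ξ * β)) :=
    differentiable_e.comp (by fun_prop : Differentiable ℂ fun β : ℂ => -(ξ * β))
  have d2 : Differentiable ℂ fun β : ℂ => expSlope (-(ξ * β)) :=
    differentiable_expSlope.comp (by fun_prop : Differentiable ℂ fun β : ℂ => -(ξ * β))
  exact (((differentiableOn_id.mul d2.differentiableOn).mul_const _).const_add _).add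
    (d1.differentiableOn.mul (differentiableOn_expSeries_invDiff hξ))

theorem isEllipticPolylog_torusCoef {τ : UpperHalfPlane} {R R₀ c W : ℝ}
    (hR : IsAdmissible τ R R₀ c W) {ξ : ℂ} (hξ : ξ ∈ punctured τ) :
    IsEllipticPolylog ξ τ fun m n => torusCoef R m (n + 1) (levinN τ (debye ξ) ξ) := by
  refine ⟨R, hR.1, fun α β hα hβ hβ0 h => ?_⟩
  rw [EReg_eq hR hξ h hα.le hβ.le hβ0]
  exact hasSum_torusCoef_shift hR.1 (isPolydiscHolomorphic_levinN hR (im_lt_of_mem_punctured hξ)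
    ⟨im_nonneg_of_mem_punctured hξ, le_rfl⟩
    (differentiableOn_debye (punctured_subset_slitDomain τ hξ)))
    (fun α _ => levinN_zero _ _ _ _) hα hβ hβ0

/-! ### Uniqueness of the elliptic polylogarithms and their special values -/

theorem IsEllipticPolylog.unique {τ : UpperHalfPlane} {ξ : ℂ} {c d : ℕ → ℕ → ℂ}
    (hc : IsEllipticPolylog ξ τ c) (hd : IsEllipticPolylog ξ τ d) (m n : ℕ) : c m n = d m n := by
  obtain ⟨δ, hδ, h1⟩ := hc
  obtain ⟨ε, hε, h2⟩ := hd
  have hτ := τ.im_pos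
  obtain ⟨ρ, hρ, hρδ, hρε, hρτ⟩ : ∃ ρ : ℝ, 0 < ρ ∧ ρ ≤ δ ∧ ρ ≤ ε ∧ ρ ≤ τ.im / 2 :=
    ⟨min (min δ ε) (τ.im / 2), by positivity, (min_le_left _ _).trans (min_le_left _ _),
      (min_le_left _ _).trans (min_le_right _ _), min_le_right _ _⟩
  -- For these α one has -ρ ≤ Im α < -ρ/2, and the small β give |Im(τβ)| < ρ/4. Hence -Im τ < Im(α -
  -- τβ) < 0, so (α,β) is in the annulus and the expansions can be compared on an open set of α.
  have hU : IsOpen {α : ℂ | ‖α‖ < ρ ∧ α.im < -(ρ / 2)} :=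
    (isOpen_lt continuous_norm continuous_const).inter
      (isOpen_lt Complex.continuous_im continuous_const)
  have hUne : {α : ℂ | ‖α‖ < ρ ∧ α.im < -(ρ / 2)}.Nonempty := by
    refine ⟨((-(3 / 4 * ρ) : ℝ) : ℂ) * I, ?_, ?_⟩
    · rw [norm_mul, Complex.norm_I, Complex.norm_real, mul_one, Real.norm_eq_abs, abs_neg,
        abs_of_pos (by positivity)]
      linarith
    · rw [Complex.im_ofReal_mul, Complex.I_im]
      linarith
  have hp : 0 < 1 + ‖(τ : ℂ)‖ := by positivity
  have hη : 0 < ρ / 4 / (1 + ‖(τ : ℂ)‖) := by positivity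
  refine sub_eq_zero.1 (coef_eq_zero_of_hasSum_zero₂ (d := fun m n => c m n - d m n) hU hUne hη
    (fun α hα β hβ0 hβ => ?_) m n)
  rw [lt_div_iff₀ hp] at hβ
  have hβρ : ‖β‖ < ρ := by nlinarith [norm_nonneg (τ : ℂ), norm_nonneg β]
  have hτβ : |(τ * β : ℂ).im| < ρ / 4 := by
    refine (Complex.abs_im_le_norm _).trans_lt ?_
    rw [norm_mul]
    nlinarith [norm_nonneg β]
  rw [abs_lt] at hτβ
  have hαim := (abs_le.1 ((Complex.abs_im_le_norm α).trans hα.1.le)).1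
  have hsub : (α - τ * β : ℂ).im = α.im - (τ * β : ℂ).im := Complex.sub_im _ _
  have hα2 := hα.2
  have hann : InAnnulus τ α β := by
    refine ⟨one_lt_norm_e_iff.2 (by linarith), one_lt_norm_e_iff.2 (by rw [hsub]; linarith), ?_⟩
    rw [← norm_inv, ← e_neg, norm_e, norm_e, Real.exp_lt_exp, neg_lt_neg_iff, Complex.neg_im,
      UpperHalfPlane.coe_im, hsub]
    have := Real.pi_pos
    gcongr
    linarith
  refine hasSum_of_eq ((h1 α β (hα.1.trans_le hρδ) (hβρ.trans_le hρδ) hβ0 hann).sub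
    (h2 α β (hα.1.trans_le hρε) (hβρ.trans_le hρε) hβ0 hann)) (fun p => ?_) (sub_self _).symm
  ring

theorem ellipticPolylog_eq {τ : UpperHalfPlane} {ξ : ℂ} {c : ℕ → ℕ → ℂ}
    (hc : IsEllipticPolylog ξ τ c) (m n : ℕ) : ellipticPolylog m n ξ τ = c m n := by
  have h : ∃ c, IsEllipticPolylog ξ τ c := ⟨c, hc⟩
  rw [ellipticPolylog, dif_pos h]
  exact h.choose_spec.unique hc m n

theorem isEllipticPolylog_ellipticPolylog {τ : UpperHalfPlane} {ξ : ℂ} (hξ : ξ ∈ punctured τ) :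
    IsEllipticPolylog ξ τ fun m n => ellipticPolylog m n ξ τ := by
  obtain ⟨R, R₀, c, W, hR⟩ := exists_isAdmissible τ
  have h := isEllipticPolylog_torusCoef hR hξ
  have h2 : (fun m n => ellipticPolylog m n ξ τ) =
      fun m n => torusCoef R m (n + 1) (levinN τ (debye ξ) ξ) := by
    ext m n
    exact ellipticPolylog_eq h m n
  rw [h2]
  exact h

/-- `debyeReg` differs from the Debye series by log(-2πiξ), a constant in α and β. After division by
β only the coefficient (0,0) is affected, and this coefficient is exactly the one regularized; the
function with `debyeReg` is continuous up to ξ = 0. -/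
theorem isSpecialValue_torusCoef {τ : UpperHalfPlane} {R R₀ c W : ℝ}
    (hR : IsAdmissible τ R R₀ c W) (m n : ℕ) :
    IsSpecialValue m n τ (torusCoef R m (n + 1) (levinN τ (debyeReg 0) 0)) := by
  obtain ⟨r, hr, hr1, hre⟩ := exists_expSlope_re_pos
  have hτ := τ.im_pos
  have hstrip : nearZero τ r ⊆ strip (τ.im / 2) := fun ξ hξ => ⟨hξ.1.1, hξ.2⟩
  have hD : ContinuousOn (fun p : ℂ × ℂ => debyeReg p.1 p.2)
      (nearZero τ r ×ˢ Metric.closedBall 0 R) :=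
    (continuousOn_debyeReg hr1.le (show R < 1 by linarith [hR.2.1]) hre).mono
      (Set.prod_mono (fun ξ hξ => hξ.1) subset_rfl)
  have h1 := tendsto_torusCoef hR.1 m (n + 1) (F := fun ξ => levinN τ (debyeReg ξ) ξ)
    (zero_mem_nearZero τ hr)
    (continuousOn_levinN hR (by linarith) (by linarith) hstrip hD)
  refine (h1.comp (tendsto_nearZero τ hr)).congr' ?_
  filter_upwards [eventually_mem_nearZero τ hr, eventually_mem_nhdsWithin] with ξ hξ hξp
  have hslit := punctured_subset_slitDomain τ hξp
  obtain ⟨L, hL⟩ : ∃ L, L = Complex.log (-(2 * Real.pi * I * ξ)) := ⟨_, rfl⟩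
  have h2 : IsEllipticPolylog ξ τ fun m n => torusCoef R m (n + 1) (levinN τ (debyeReg ξ) ξ) -
      if m = 0 ∧ n = 0 then L else 0 := by
    refine ⟨R, hR.1, fun α β hα hβ hβ0 hann => ?_⟩
    have h3 := hasSum_torusCoef_shift hR.1 (isPolydiscHolomorphic_levinN hR
      (im_lt_of_mem_punctured hξp) ⟨hξ.1.1, le_rfl⟩ (differentiableOn_debyeReg hξ.1.1))
      (fun α _ => levinN_zero _ _ _ _) hα hβ hβ0
    have h4 : HasSum (fun p : ℕ × ℕ => (if p.1 = 0 ∧ p.2 = 0 then L else 0) * α ^ p.1 * β ^ p.2)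
        L := by
      refine hasSum_of_eq (hasSum_single (0, 0) fun p hp => ?_) (fun _ => rfl) (by simp)
      have : ¬(p.1 = 0 ∧ p.2 = 0) := fun h => hp (Prod.ext h.1 h.2)
      simp [this]
    refine hasSum_of_eq (h3.sub h4) (fun p => by ring) ?_
    have h5 := debye_add_log hslit hξ.1.1
      (show ‖β‖ < 1 by linarith [hR.2.1]) (hre ξ hξ.1.2)
    rw [EReg_eq hR hξp hann hα.le hβ.le hβ0, levinN, levinN, ← h5, ← hL]
    field_simp
    ring
  simp only [Function.comp]
  rw [ellipticPolylog_eq h2, ← hL]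
  ring

/-! ### Polynomial combinations of special values -/

/-- Functions on the upper half-plane of the form `p(τ) + ∑ P_{ab}(τ) λ_{ab}(τ)`. -/
def IsPolyComb (lam : ℕ → ℕ → UpperHalfPlane → ℂ) (x : UpperHalfPlane → ℂ) : Prop :=
  ∃ (p : Polynomial ℂ) (P : ℕ × ℕ →₀ Polynomial ℂ), ∀ τ : UpperHalfPlane,
    x τ = p.eval (τ : ℂ) + P.sum fun a Q => Q.eval (τ : ℂ) * lam a.1 a.2 τ

theorem isPolyComb_const (lam : ℕ → ℕ → UpperHalfPlane → ℂ) (c : ℂ) :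
    IsPolyComb lam fun _ => c :=
  ⟨Polynomial.C c, 0, fun τ => by simp⟩

theorem isPolyComb_lam (lam : ℕ → ℕ → UpperHalfPlane → ℂ) (a b : ℕ) : IsPolyComb lam (lam a b) :=
  ⟨0, Finsupp.single (a, b) 1, fun τ => by simp⟩

theorem IsPolyComb.add {lam : ℕ → ℕ → UpperHalfPlane → ℂ} {x y : UpperHalfPlane → ℂ}
    (hx : IsPolyComb lam x) (hy : IsPolyComb lam y) : IsPolyComb lam fun τ => x τ + y τ := by
  obtain ⟨p, P, h1⟩ := hx
  obtain ⟨q, Q, h2⟩ := hy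
  refine ⟨p + q, P + Q, fun τ => ?_⟩
  change x τ + y τ = _
  rw [h1, h2, Finsupp.sum_add_index' (by simp) (by intros; rw [Polynomial.eval_add, add_mul]),
    Polynomial.eval_add]
  ring

theorem IsPolyComb.poly_mul {lam : ℕ → ℕ → UpperHalfPlane → ℂ} {x : UpperHalfPlane → ℂ}
    (hx : IsPolyComb lam x) (q : Polynomial ℂ) :
    IsPolyComb lam fun τ => q.eval (τ : ℂ) * x τ := by
  obtain ⟨p, P, h1⟩ := hx
  refine ⟨q * p, P.mapRange (fun Q => q * Q) (mul_zero q), fun τ => ?_⟩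
  change q.eval (τ : ℂ) * x τ = _
  rw [h1, Finsupp.sum_mapRange_index (by simp), Polynomial.eval_mul, mul_add, Finsupp.mul_sum]
  congr 1
  refine Finsupp.sum_congr fun a _ => ?_
  rw [Polynomial.eval_mul]
  ring

theorem IsPolyComb.const_mul {lam : ℕ → ℕ → UpperHalfPlane → ℂ} {x : UpperHalfPlane → ℂ}
    (hx : IsPolyComb lam x) (c : ℂ) : IsPolyComb lam fun τ => c * x τ := by
  simpa using hx.poly_mul (Polynomial.C c)

theorem isPolyComb_sum {lam : ℕ → ℕ → UpperHalfPlane → ℂ} {ι : Type*} (s : Finset ι)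
    {x : ι → UpperHalfPlane → ℂ} (hx : ∀ i ∈ s, IsPolyComb lam (x i)) :
    IsPolyComb lam fun τ => ∑ i ∈ s, x i τ := by
  classical
  induction s using Finset.induction_on with
  | empty => simpa using isPolyComb_const lam 0
  | insert i s hi ih =>
    simp_rw [Finset.sum_insert hi]
    exact (hx i (Finset.mem_insert_self i s)).add
      (ih fun j hj => hx j (Finset.mem_insert_of_mem hj))

theorem IsPolyComb.exists_eq_sum {lam : ℕ → ℕ → UpperHalfPlane → ℂ} {x : UpperHalfPlane → ℂ}
    (hx : IsPolyComb lam x) : ∃ (N : ℕ) (p : Polynomial ℂ) (P : ℕ → ℕ → Polynomial ℂ),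
      ∀ τ : UpperHalfPlane, x τ = p.eval (τ : ℂ) + ∑ a ∈ Finset.range N, ∑ b ∈ Finset.range N,
        (P a b).eval (τ : ℂ) * lam a b τ := by
  obtain ⟨p, P, h⟩ := hx
  -- N exceeds a + b for every index (a,b) in the support, hence each index separately.
  refine ⟨P.support.sup (fun a => a.1 + a.2) + 1, p, fun a b => P (a, b), fun τ => ?_⟩
  rw [h, ← Finset.sum_product']
  congr 1
  refine Finsupp.sum_of_support_subset P (fun a ha => ?_) _ (by simp)
  have := Finset.le_sup (f := fun a : ℕ × ℕ => a.1 + a.2) ha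
  simp only [Finset.mem_product, Finset.mem_range]
  omega

/-! ### Comparison of coefficients -/

/-- The regularized special values `λ_{m,n}(τ)`. -/
def specialValue (m n : ℕ) (τ : UpperHalfPlane) : ℂ :=
  torusCoef (exists_isAdmissible τ).choose m (n + 1) (levinN τ (debyeReg 0) 0)

theorem isSpecialValue_specialValue (m n : ℕ) (τ : UpperHalfPlane) :
    IsSpecialValue m n τ (specialValue m n τ) := by
  obtain ⟨R₀, c, W, hR⟩ := (exists_isAdmissible τ).choose_spec
  exact isSpecialValue_torusCoef hR m n

theorem isDoubleSeries_levinN (τ : UpperHalfPlane) :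
    IsDoubleSeries (levinN τ (debyeReg 0) 0)
      fun m n => if n = 0 then 0 else specialValue m (n - 1) τ := by
  obtain ⟨R₀, c, W, hR⟩ := (exists_isAdmissible τ).choose_spec
  have hF := isPolydiscHolomorphic_levinN hR (h := 0) τ.im_pos (ξ := 0)
    ⟨zero_im.ge, zero_im.le⟩ (differentiableOn_debyeReg (ξ := 0) zero_im.ge)
  refine ⟨_, hR.1, fun α β hα hβ => ?_⟩
  have hi : Function.Injective fun p : ℕ × ℕ => (p.1, p.2 + 1) := fun a b h => by
    simp only [Prod.mk.injEq, Nat.add_right_cancel_iff] at h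
    exact Prod.ext h.1 h.2
  have h0 : ∀ p : ℕ × ℕ, p ∉ Set.range (fun p : ℕ × ℕ => (p.1, p.2 + 1)) → p.2 = 0 := by
    rintro ⟨m, n⟩ hp
    cases n with
    | zero => rfl
    | succ n => exact absurd ⟨(m, n), rfl⟩ hp
  refine (hi.hasSum_iff fun p hp => by simp [h0 p hp]).1 ?_
  by_cases hβ0 : β = 0
  · subst hβ0
    rw [levinN_zero]
    refine hasSum_of_eq hasSum_zero (fun p => ?_) rfl
    simp
  · have h1 := (hasSum_torusCoef_shift hR.1 hF (fun α _ => levinN_zero _ _ _ _) hα hβ hβ0).mul_left β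
    rw [mul_div_cancel₀ _ hβ0] at h1
    refine hasSum_of_eq h1 (fun p => ?_) rfl
    simp only [Function.comp, Nat.add_sub_cancel, Nat.succ_ne_zero, if_false, specialValue]
    rw [pow_succ]
    ring

/-- Taylor coefficients at the origin of a function on the disc of radius `3/4`. -/
theorem hasSum_taylor {f : ℂ → ℂ} (hf : DifferentiableOn ℂ f (Metric.ball 0 (3 / 4))) {z : ℂ}
    (hz : ‖z‖ < 1 / 2) : HasSum (fun n => circleCoef (1 / 2) n f * z ^ n) (f z) :=
  hasSum_circleCoef (by norm_num)
    (hf.continuousOn.mono (Metric.closedBall_subset_ball (by norm_num)))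
    (hf.mono (Metric.ball_subset_ball (by norm_num))) hz

/-- The series `∑_{n ≥ 1}` of the depth one values, in terms of the Levin series. -/
theorem genValue_eq {τ : UpperHalfPlane} {α β : ℂ} (hα : ‖α‖ < 1) (hα0 : α ≠ 0) (hβ : ‖β‖ < 1)
    (hβ0 : β ≠ 0) :
    genValue (e τ) (e α) β - α⁻¹ * ((Complex.exp (-(2 * Real.pi * I * β)) - 1) /
      (-(2 * Real.pi * I * β))) = rhoGen (-(2 * Real.pi * I * β)) + expSlope (-β) *
      (1 - β * expSeries (invDiff β) 0 + levinN τ (debyeReg 0) 0 (α + τ * β) β +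
        2 * Real.pi * I / expSlope β * bernoulliGen (α + τ * β)) := by
  have hπ := two_pi_I_ne_zero
  have h1 := mul_expSlope (-β)
  have h2 : Complex.exp (-(2 * Real.pi * I * β)) = e (-β) := by rw [e]; ring_nf
  have h3 := expSlope_ne_zero hβ
  have h4 : e α ≠ 1 := e_ne_one hα hα0
  have h5 := sub_ne_zero.2 h4
  have h6 : 1 - e α ≠ 0 := sub_ne_zero.2 h4.symm
  rw [genValue, levinN, debyeReg_zero, h2, zero_mul, neg_zero, e_zero, add_sub_cancel_right,
    bernoulliGen_eq hα hα0, ← h1]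
  generalize e α = w at h5 h6 ⊢
  generalize expSeries (invDiff β) 0 = Z
  generalize lambertT (e τ) 1 w β = T
  generalize rhoGen (-(2 * Real.pi * I * β)) = ρ
  generalize bernoulliGen (α + τ * β) = g
  generalize 2 * Real.pi * I / expSlope β = φ
  obtain ⟨k, hk⟩ : ∃ k : ℂ, k = 2 * Real.pi * I := ⟨_, rfl⟩
  rw [← hk] at hπ ⊢
  field_simp
  ring

/-- The Taylor coefficients of the part of the generating series with `n ≥ 1`. -/
def posCoef (q : ℂ) (m n : ℕ) : ℂ :=
  aCoef q (m + 1) n * ((-(2 * Real.pi * I)) ^ n / n.factorial)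

theorem hasSum_posCoef {τ : UpperHalfPlane} {R c W : ℝ} (hR : R ≤ 1)
    (h : LambertBound (e τ) (Metric.ball 0 R) c W) {α β : ℂ} (hα : ‖α‖ < R) (hα0 : α ≠ 0)
    (hβ : ‖β‖ < 1) (hβ0 : β ≠ 0) :
    HasSum (fun p : ℕ × ℕ => posCoef (e τ) p.1 p.2 * α ^ p.1 * β ^ p.2)
      (genValue (e τ) (e α) β - α⁻¹ * ((Complex.exp (-(2 * Real.pi * I * β)) - 1) /
        (-(2 * Real.pi * I * β)))) := by
  have hπ := two_pi_I_ne_zero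
  have hg : HasSum (genTerm (fun n r => A n r τ) (2 * Real.pi * I * α) (-(2 * Real.pi * I * β)))
      (genValue (e τ) (e α) β) :=
    hasSum_of_eq (hasSum_aCoef_eq (norm_e_tau_lt_one τ) hR h (mem_ball_zero_iff.2 hα) hα0 hβ hβ0)
      (fun p => genTerm_of_aCoef (fun n r => A_eq n r τ) _ _ p) rfl
  have h1 := tsum_genTerm_eq (a := fun n r => A n r τ) (fun n r => A_eq n r τ)
    (neg_ne_zero.2 (mul_ne_zero hπ hβ0)) hg.summable
  rw [hg.tsum_eq] at h1
  have hs : Summable fun p : ℕ × ℕ => genTerm (fun n r => A n r τ) (2 * Real.pi * I * α)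
      (-(2 * Real.pi * I * β)) (p.1 + 1, p.2) :=
    hg.summable.comp_injective (i := fun p : ℕ × ℕ => (p.1 + 1, p.2)) fun p r h => by
      simp only [Prod.mk.injEq, Nat.add_right_cancel_iff] at h
      exact Prod.ext h.1 h.2
  refine hasSum_of_eq hs.hasSum (fun p => ?_) (by rw [h1]; ring)
  rw [genTerm_of_aCoef (fun n r => A_eq n r τ), posCoef]
  have h2 : α ^ ((((p.1 + 1 : ℕ) : ℤ)) - 1) = α ^ p.1 := by
    push_cast
    rw [add_sub_cancel_right, zpow_natCast]
  have h3 : -(2 * Real.pi * I * β) = -(2 * Real.pi * I) * β := by ring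
  simp only [h2]
  rw [h3, mul_pow]
  ring

/-- In `genValue_eq` the variable τ enters the right side only through `levinN` and through the
substitution α ↦ α + τβ. Multiplications by series in β and this substitution act on coefficients by
finite sums, and uniqueness of double power series allows the comparison. -/
theorem isPolyComb_posCoef (m n : ℕ) :
    IsPolyComb specialValue fun τ => posCoef (e τ) m n := by
  have hes := differentiable_expSlope
  have dψ : DifferentiableOn ℂ (fun β : ℂ => expSlope (-β)) (Metric.ball 0 (3 / 4)) :=
    (hes.comp (by fun_prop : Differentiable ℂ fun β : ℂ => -β)).differentiableOn
  have dz : DifferentiableOn ℂ (fun β : ℂ => 1 - β * expSeries (invDiff β) 0)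
      (Metric.ball 0 (3 / 4)) :=
    (differentiableOn_id.mul (differentiableOn_expSeries_invDiff (by simp))).const_sub 1
  have dφ : DifferentiableOn ℂ (fun β : ℂ => 2 * Real.pi * I / expSlope β)
      (Metric.ball 0 (3 / 4)) :=
    (differentiableOn_const _).div hes.differentiableOn fun β hβ =>
      expSlope_ne_zero ((mem_ball_zero_iff.1 hβ).trans (by norm_num))
  have dg : DifferentiableOn ℂ bernoulliGen (Metric.ball 0 (3 / 4)) :=
    differentiableOn_bernoulliGen.mono (Metric.ball_subset_ball (by norm_num))
  obtain ⟨ψ, hψ⟩ : ∃ ψ, ψ = fun n => circleCoef (1 / 2) n fun β : ℂ => expSlope (-β) := ⟨_, rfl⟩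
  obtain ⟨z, hz⟩ : ∃ z, z = fun n => circleCoef (1 / 2) n fun β : ℂ =>
    1 - β * expSeries (invDiff β) 0 := ⟨_, rfl⟩
  obtain ⟨φ, hφ⟩ : ∃ φ, φ = fun n => circleCoef (1 / 2) n fun β : ℂ =>
    2 * Real.pi * I / expSlope β := ⟨_, rfl⟩
  obtain ⟨g, hg⟩ : ∃ g, g = fun n => circleCoef (1 / 2) n bernoulliGen := ⟨_, rfl⟩
  have hhalf : (0 : ℝ) < 1 / 2 := by norm_num
  have sρ : ∀ β : ℂ, ‖β‖ < 1 / 2 → HasSum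
      (fun j : ℕ => rho j * ((-(2 * Real.pi * I)) ^ j / j.factorial) * β ^ j)
      (rhoGen (-(2 * Real.pi * I * β))) := fun β _ => by
    refine hasSum_of_eq (summable_norm_rhoGen (-(2 * Real.pi * I * β))).of_norm.hasSum
      (fun j => ?_) rfl
    have h3 : -(2 * Real.pi * I * β) = -(2 * Real.pi * I) * β := by ring
    rw [h3, mul_pow]
    ring
  -- The coefficients of the bracket in `genValue_eq` before the substitution α ↦ α + τβ: a series
  -- in β, the special values shifted by the factor β, and a product of a series in β with one in α.
  let l : UpperHalfPlane → ℕ → ℕ → ℂ := fun τ m n => (if m = 0 then z n else 0) +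
    (if n = 0 then 0 else specialValue m (n - 1) τ) +
    ∑ x ∈ Finset.HasAntidiagonal.antidiagonal n, φ x.1 * if x.2 = 0 then g m else 0
  have hl : ∀ m n, IsPolyComb specialValue fun τ => l τ m n := fun m n => by
    refine IsPolyComb.add (IsPolyComb.add (isPolyComb_const _ _) ?_) (isPolyComb_const _ _)
    split_ifs
    · exact isPolyComb_const _ _
    · exact isPolyComb_lam _ _ _
  have key : ∀ τ : UpperHalfPlane, posCoef (e τ) m n =
      (if m = 0 then rho n * ((-(2 * Real.pi * I)) ^ n / n.factorial) else 0) +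
      ∑ x ∈ Finset.HasAntidiagonal.antidiagonal n, ψ x.1 *
        ∑ y ∈ Finset.HasAntidiagonal.antidiagonal x.2,
          ((m + y.1).choose y.1 : ℂ) * (τ : ℂ) ^ y.1 * l τ (m + y.1) y.2 := fun τ => by
    have s1 := ((isDoubleSeries_right hhalf fun β hβ => hasSum_taylor dz hβ).add
      (isDoubleSeries_levinN τ)).add
      ((isDoubleSeries_left hhalf fun α hα => hasSum_taylor dg hα).mul_right hhalf
        fun β hβ => hasSum_taylor dφ hβ)
    have s2 := (isDoubleSeries_right hhalf sρ).add ((s1.comp_add_mul (τ : ℂ)).mul_right hhalf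
      fun β hβ => hasSum_taylor dψ hβ)
    obtain ⟨δ, hδ, s3⟩ := s2
    obtain ⟨R, hR0, hR1, c, W, hb⟩ := exists_lambertBound_zero (norm_e_tau_lt_one τ)
    have hε : 0 < min δ R := lt_min hδ hR0
    -- The point α = 0 is left out because the terms with n = 0 have a pole there.
    have hU : IsOpen {α : ℂ | α ≠ 0 ∧ ‖α‖ < min δ R} :=
      isOpen_ne.inter (isOpen_lt continuous_norm continuous_const)
    have hUne : {α : ℂ | α ≠ 0 ∧ ‖α‖ < min δ R}.Nonempty := by
      refine ⟨((min δ R / 2 : ℝ) : ℂ), ?_, ?_⟩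
      · exact_mod_cast (half_pos hε).ne'
      · rw [Complex.norm_real, Real.norm_of_nonneg (half_pos hε).le]
        exact half_lt_self hε
    have h0 := coef_eq_zero_of_hasSum_zero₂ (d := fun m n => posCoef (e τ) m n -
      ((if m = 0 then rho n * ((-(2 * Real.pi * I)) ^ n / n.factorial) else 0) +
      ∑ x ∈ Finset.HasAntidiagonal.antidiagonal n, ψ x.1 *
        ∑ y ∈ Finset.HasAntidiagonal.antidiagonal x.2,
          ((m + y.1).choose y.1 : ℂ) * (τ : ℂ) ^ y.1 * l τ (m + y.1) y.2)) hU hUne hε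
      (fun α hα β hβ0 hβ => ?_) m n
    · exact sub_eq_zero.1 h0
    · have hα' := lt_min_iff.1 hα.2
      have hβ' := lt_min_iff.1 hβ
      have hβ1 : ‖β‖ < 1 := hβ'.2.trans hR1
      have h1 := hasSum_posCoef hR1.le hb hα'.2 hα.1 hβ1 hβ0
      have h2 := s3 α β hα'.1 hβ'.1
      refine hasSum_of_eq (h1.sub h2) (fun p => ?_) ?_
      · rw [hψ]
        simp only [l, hz, hφ, hg]
        ring
      · rw [genValue_eq (hα'.2.trans hR1) hα.1 hβ1 hβ0, sub_self]
  have hfun : (fun τ : UpperHalfPlane => posCoef (e τ) m n) = fun τ : UpperHalfPlane =>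
      (if m = 0 then rho n * ((-(2 * Real.pi * I)) ^ n / n.factorial) else 0) +
      ∑ x ∈ Finset.HasAntidiagonal.antidiagonal n, ψ x.1 *
        ∑ y ∈ Finset.HasAntidiagonal.antidiagonal x.2,
          ((m + y.1).choose y.1 : ℂ) * (τ : ℂ) ^ y.1 * l τ (m + y.1) y.2 := funext key
  rw [hfun]
  refine (isPolyComb_const _ _).add
    (isPolyComb_sum _ fun x _ => (isPolyComb_sum _ fun y _ => ?_).const_mul _)
  have := (hl (m + y.1) y.2).poly_mul (Polynomial.C ((m + y.1).choose y.1 : ℂ) * Polynomial.X ^ y.1)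
  simpa using this

theorem isPolyComb_aCoef (n j : ℕ) : IsPolyComb specialValue fun τ => aCoef (e τ) n j := by
  cases n with
  | zero =>
    simp_rw [aCoef_zero]
    exact isPolyComb_const _ _
  | succ n =>
    have h1 := (isPolyComb_posCoef n j).const_mul ((-(2 * Real.pi * I)) ^ j / j.factorial)⁻¹
    have h2 : ((-(2 * Real.pi * I)) ^ j / (j.factorial : ℂ)) ≠ 0 :=
      div_ne_zero (pow_ne_zero _ (neg_ne_zero.2 two_pi_I_ne_zero))
        (by exact_mod_cast j.factorial_ne_zero)
    have h3 : (fun τ : UpperHalfPlane => aCoef (e τ) (n + 1) j) = fun τ : UpperHalfPlane =>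
        ((-(2 * Real.pi * I)) ^ j / (j.factorial : ℂ))⁻¹ * posCoef (e τ) n j := by
      ext τ
      rw [posCoef, mul_comm (aCoef _ _ _), inv_mul_cancel_left₀ h2]
    rw [h3]
    exact h1

theorem isPolyComb_ellMZV (s n r : ℕ) : IsPolyComb specialValue
    (ellMZV (List.replicate s 0 ++ n :: List.replicate r 0)) := by
  have h1 : ellMZV (List.replicate s 0 ++ n :: List.replicate r 0) = fun τ : UpperHalfPlane =>
      (2 * Real.pi * I) ^ (r + s) / (r.factorial * s.factorial) *
      (2 * Real.pi * I / (2 * Real.pi * I) ^ n) * ∑ k ∈ Finset.range (s + 1),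
        (-1) ^ k * (s.choose k) * aCoef (e τ) n (r + k) := by
    ext τ
    exact ellMZV_depth_one s n r τ
  rw [h1]
  exact (isPolyComb_sum _ fun k _ => (isPolyComb_aCoef n (r + k)).const_mul _).const_mul _

end

end EllPol

/-! ### The main theorem -/

theorem mainTheorem10 :
    -- the constant terms of the `q`-expansions are the values at the cusp
    (∀ n r : ℕ, 1 ≤ r → Tendsto (EllPol.A n r) atImInfty (𝓝 (EllPol.AInf n r))) ∧
    -- the regularized value of the generating series at the origin
    (∀ (τ : UpperHalfPlane) (X Y : ℂ), Y ≠ 0 → ‖X‖ < 2 * Real.pi → ‖Y‖ < 2 * Real.pi →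
      (∀ m n : ℤ, (m, n) ≠ (0, 0) → ‖X - τ * Y‖ < 2 * Real.pi * ‖(m : ℂ) * τ + n‖) →
      EllPol.InAnnulus τ (X / (2 * Real.pi * I)) (Y / (2 * Real.pi * I)) →
        (∀ ξ ∈ EllPol.punctured τ,
          Summable (EllPol.avgTerm ξ (X / (2 * Real.pi * I)) (Y / (2 * Real.pi * I)) τ)) ∧
        Summable (EllPol.genTerm (fun n r => EllPol.A n r τ) (X - τ * Y) (-Y)) ∧
        Summable (EllPol.genTerm EllPol.AInf X (-Y)) ∧
        Summable (fun k : ℕ => riemannZeta (k + 2) / (2 * Real.pi * I) ^ (k + 2) * Y ^ (k + 1)) ∧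
        Tendsto (fun ξ : ℂ => EllPol.Xi ξ X Y τ
            - 1 / (2 * Real.pi * I) * Complex.log (-(2 * Real.pi * I * ξ)))
          (𝓝[EllPol.punctured τ] 0)
          (𝓝 (-(EllPol.calAInf X (-Y) / (2 * Real.pi * I * (Complex.exp (-Y) - 1)))
            + EllPol.calA (X - τ * Y) (-Y) τ / (2 * Real.pi * I * (Complex.exp (-Y) - 1))
            + 1 / (Complex.exp X - 1) * (1 / (Complex.exp Y - 1) - 1 / Y)
            - ∑' k : ℕ, riemannZeta (k + 2) / (2 * Real.pi * I) ^ (k + 2) * Y ^ (k + 1))) ∧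
        Tendsto (fun ξ : ℂ => EllPol.Xi ξ X Y τ
            - 1 / (2 * Real.pi * I) * Complex.log (-(2 * Real.pi * I * ξ)))
          (𝓝[EllPol.punctured τ] 0)
          (𝓝 (-(τ / (X * (X - τ * Y)))
            - EllPol.calAInfPos X (-Y) / (2 * Real.pi * I * (Complex.exp (-Y) - 1))
            + EllPol.calAPos (X - τ * Y) (-Y) τ / (2 * Real.pi * I * (Complex.exp (-Y) - 1))
            + 1 / (Complex.exp X - 1) * (1 / (Complex.exp Y - 1) - 1 / Y)
            - ∑' k : ℕ, riemannZeta (k + 2) / (2 * Real.pi * I) ^ (k + 2) * Y ^ (k + 1)))) ∧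
    -- depth one A-elliptic multiple zeta values are special values of elliptic polylogarithms
    (∀ (τ : UpperHalfPlane), ∀ ξ ∈ EllPol.punctured τ,
      EllPol.IsEllipticPolylog ξ τ (fun m n => EllPol.ellipticPolylog m n ξ τ)) ∧
    (∃ lam : ℕ → ℕ → UpperHalfPlane → ℂ,
      (∀ m n τ, EllPol.IsSpecialValue m n τ (lam m n τ)) ∧
      ∀ s n r : ℕ, ∃ (N : ℕ) (p : Polynomial ℂ) (P : ℕ → ℕ → Polynomial ℂ),
        ∀ τ : UpperHalfPlane,
          EllPol.ellMZV (List.replicate s 0 ++ n :: List.replicate r 0) τ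
            = p.eval (τ : ℂ) + ∑ a ∈ Finset.range N, ∑ b ∈ Finset.range N,
                (P a b).eval (τ : ℂ) * lam a b τ) := by
  refine ⟨EllPol.tendsto_A_AInf, fun τ X Y hY hX1 hY1 hXY h => ?_,
    fun τ ξ hξ => EllPol.isEllipticPolylog_ellipticPolylog hξ, EllPol.specialValue,
    EllPol.isSpecialValue_specialValue, fun s n r => (EllPol.isPolyComb_ellMZV s n r).exists_eq_sum⟩
  have hπ := Complex.two_pi_I_ne_zero
  have hn : ‖(2 * Real.pi * I : ℂ)‖ = 2 * Real.pi := by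
    rw [norm_mul, norm_mul, Complex.norm_I, Complex.norm_real, Real.norm_of_nonneg Real.pi_pos.le]
    norm_num
  have hp : 0 < 2 * Real.pi := Real.two_pi_pos
  -- In the coordinates α = X/2πi and β = Y/2πi the radius 2π becomes 1 and the bounds 2π|mτ + n|
  -- become |mτ + n|.
  refine EllPol.generating_series_at_origin τ (div_ne_zero hY hπ) ?_ ?_ (fun m n hmn => ?_) h
    (mul_div_cancel₀ X hπ).symm (mul_div_cancel₀ Y hπ).symm
  · rwa [norm_div, hn, div_lt_one hp]
  · rwa [norm_div, hn, div_lt_one hp]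
  · rw [← mul_div_assoc, ← sub_div, norm_div, hn, div_lt_iff₀' hp]
    exact hXY m n hmn
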